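/- Conventions. A polygon is a nonempty finite union of nondegenerate closed triangles in $\mathbb R^2$ (not necessarily convex); its vertices are the points of its topological boundary near which the boundary is not a straight line. A polygon $P$ has denominator $d$ if $d$ is the least positive integer such that all vertices of $dP$ are integral. $\mathrm{ehr}_P(t)=|tP\cap\mathbb Z^2|$ is its Ehrhart function. $G=GL_2(\mathbb Z)\ltimes\mathbb Z^2$ acts on $\mathbb R^2$ by $x\mapsto Ux+v$; the maps obtained are called $G$-maps. A triangulation of $P$ is a finite set $\mathcal T$ of rational open simplices (points, open segments, open triangles) whose disjoint union is $P$. A rational discrete equidecomposability relation $\mathcal F:(P,\mathcal T_1)\to(Q,\mathcal T_2)$ is a bijection $P\to Q$ whose restriction to each open simplex of $\mathcal T_1$ is a $G$-map onto an open simplex of $\mathcal T_2$. Let $\mathcal L_d=\frac1d\mathbb Z\times\frac1d\mathbb Z$. A nondegenerate segment or triangle is $d$-minimal if it meets $\mathcal L_d$ exactly in its vertices; a $d$-minimal triangulation is a triangulation all of whose two-dimensional simplices are $d$-minimal triangles. An oriented $d$-minimal segment from $p=(\frac wd,\frac xd)$ to $q=(\frac yd,\frac zd)$ has weight $wz-yx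 \bmod d$. The Weight $\mathbf W_d(E)$ of a $d$-minimal segment $E$ is its weight up to sign, together with its $G$-equivalence class. $\mathbf W_d(P)$ is the multiset of the Weights of the $d$-minimal segments that make up the boundary of the denominator $d$ polygon $P$. The weight $W_d(T)$ of a $d$-minimal triangle $T$ is the multiset of the weights of its three edges, oriented counterclockwise. A pseudo-flip replaces, in a multiset $\tau$ of weights of $d$-minimal triangles, two members $\omega_1,\omega_2$, which are the weights of two adjacent $d$-minimal triangles forming a parallelogram, by the weights $\omega_1',\omega_2'$ of the two triangles that arise when the diagonal of this parallelogram is exchanged. For a denominator $d$ polygon $P$ and a positive integer $d'$ divisible by $d$, $\mathcal D_{d'}(P)$ is the set of all multisets that can be obtained by finitely many pseudo-flips from the multiset $\{W_{d'}(T)\}$ of the weights of the triangles $T$ of a $d'$-minimal triangulation of $P$ (it does not depend on the choice of the triangulation). Theorem. Let $P$ and $Q$ be polygons of denominator $d$. There exists a rational discrete equidecomposability relation $\mathcal F:(P,\mathcal T_1)\to(Q,\mathcal T_2)$ for some triangulation $\mathcal T_1$ of $P$ and some triangulation $\mathcal T_2$ of $Q$ if and only if all of the following hold: 1. $\mathrm{ehr}_P=\mathrm{ehr}_Q$;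 2. $\mathbf W_d(P)=\mathbf W_d(Q)$; 3. $\mathcal D_{d'}(P)=\mathcal D_{d'}(Q)$ for some positive integer $d'$ divisible by $d$. -/

import Mathlib

open Set Topology

namespace DiscreteEquidecomp

noncomputable section

/-- The plane `ℝ²`. -/
abbrev Plane : Type := Fin 2 → ℝ

/-! ### The affine unimodular group -/

/-- Elements of `G = GL₂(ℤ) ⋉ ℤ²`. -/
structure GMap where
  /-- the linear part `U` -/
  lin : Matrix.GeneralLinearGroup (Fin 2) ℤ
  /-- the translation part `v` -/
  trans : Fin 2 → ℤ

/-- An element of `G` acts on the plane by `x ↦ U x + v`. -/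
instance : CoeFun GMap (fun _ => Plane → Plane) where
  coe g x := ((g.lin : Matrix (Fin 2) (Fin 2) ℤ).map (fun n : ℤ => (n : ℝ))).mulVec x +
    fun i => (g.trans i : ℝ)

/-! ### Lattices, simplices, minimal edges and triangles

A simplex is given by the finite set of its vertices: an edge has two of them, a facet three. -/

/-- The lattice `(1/d)ℤ × (1/d)ℤ`. -/
def lattice (d : ℕ) : Set Plane := {x | ∀ i, ∃ n : ℤ, x i = (n : ℝ) / (d : ℝ)}

/-- `s` is the vertex set of a (nonempty, nondegenerate) simplex. -/
def IsSimplex (s : Finset Plane) : Prop :=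
  s.Nonempty ∧ AffineIndependent ℝ (fun p : s => (p : Plane))

/-- All vertices of `s` have rational coordinates. -/
def IsRational (s : Finset Plane) : Prop := ∀ p ∈ s, ∀ i, ∃ q : ℚ, p i = (q : ℝ)

/-- The open simplex with vertex set `s`. The closed one is `convexHull ℝ s`. -/
def openSimplex (s : Finset Plane) : Set Plane :=
  {x | ∃ w : Plane → ℝ, (∀ p ∈ s, 0 < w p) ∧ ∑ p ∈ s, w p = 1 ∧ ∑ p ∈ s, w p • p = x}

/-- A `d`-minimal simplex: it meets the lattice exactly in its vertices. -/
def IsMinimal (d : ℕ) (s : Finset Plane) : Prop :=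
  IsSimplex s ∧ convexHull ℝ (s : Set Plane) ∩ lattice d = (s : Set Plane)

/-- `d`-minimal segments. -/
def IsMinimalEdge (d : ℕ) (e : Finset Plane) : Prop := e.card = 2 ∧ IsMinimal d e

/-- `d`-minimal triangles. -/
def IsMinimalTriangle (d : ℕ) (t : Finset Plane) : Prop := t.card = 3 ∧ IsMinimal d t

/-! ### Polygons -/

/-- A (not necessarily convex) polygon: a nonempty finite union of nondegenerate closed
triangles. -/
def IsPolygon (P : Set Plane) : Prop :=
  ∃ K : Finset (Finset Plane), K.Nonempty ∧ (∀ t ∈ K, t.card = 3 ∧ IsSimplex t) ∧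
    P = ⋃ t ∈ K, convexHull ℝ (t : Set Plane)

/-- The vertices (corners) of a polygon: the boundary points near which the boundary is not a
straight line. -/
def IsVertex (P : Set Plane) (v : Plane) : Prop :=
  v ∈ frontier P ∧
    ¬ ∃ u : Plane, u ≠ 0 ∧ (frontier P : Set Plane) =ᶠ[𝓝 v] {x | ∃ t : ℝ, x = v + t • u}

/-- `d` is the least positive integer for which all vertices of `d P` are integral. -/
def HasDenominator (P : Set Plane) (d : ℕ) : Prop :=
  IsLeast {n : ℕ | 0 < n ∧ ∀ v, IsVertex P v → v ∈ lattice n} d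

open scoped Pointwise in
/-- The Ehrhart function `t ↦ |tP ∩ ℤ²|`. -/
def ehr (P : Set Plane) (t : ℕ) : ℕ :=
  {z : Fin 2 → ℤ | (fun i => (z i : ℝ)) ∈ (t : ℝ) • P}.ncard

/-! ### Triangulations and equidecomposability -/

/-- `T` is a triangulation of `P`: a finite set of rational simplices whose open simplices
partition `P`. -/
def IsTriangulation (P : Set Plane) (T : Finset (Finset Plane)) : Prop :=
  (∀ s ∈ T, IsSimplex s ∧ IsRational s) ∧
    (T : Set (Finset Plane)).PairwiseDisjoint openSimplex ∧
    ⋃ s ∈ T, openSimplex s = P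

/-- The facets (triangles) of a triangulation. -/
def facets (T : Finset (Finset Plane)) : Finset (Finset Plane) := T.filter (fun s => s.card = 3)

/-- A `d`-minimal triangulation: all facets are `d`-minimal triangles. -/
def IsMinimalTriangulation (d : ℕ) (P : Set Plane) (T : Finset (Finset Plane)) : Prop :=
  IsTriangulation P T ∧ ∀ t ∈ facets T, IsMinimalTriangle d t

/-- `F : (P, T₁) → (Q, T₂)` is a rational (finite) discrete equidecomposability relation: a
bijection `P → Q` which on each open simplex of `T₁` is a `G`-map onto an open simplex
of `T₂`. -/
def IsEquidecompRel (P : Set Plane) (T₁ : Finset (Finset Plane))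
    (Q : Set Plane) (T₂ : Finset (Finset Plane)) (F : Plane → Plane) : Prop :=
  IsTriangulation P T₁ ∧ IsTriangulation Q T₂ ∧ BijOn F P Q ∧
    ∀ s ∈ T₁, ∃ g : GMap, EqOn F g (openSimplex s) ∧ s.image g ∈ T₂

/-! ### Weights -/

/-- The integer `d x`, for `x ∈ (1/d)ℤ`. -/
def scaled (d : ℕ) (x : ℝ) : ℤ := ⌊(d : ℝ) * x⌋

/-- The weight of the oriented edge `p → q`: the determinant of the matrix with columns
`d p`, `d q`, modulo `d`. -/
def orientedWeight (d : ℕ) (p q : Plane) : ZMod d :=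
  ((scaled d (p 0) * scaled d (q 1) - scaled d (q 0) * scaled d (p 1) : ℤ) : ZMod d)

/-- The weight `±i` of an unoriented edge, as the set of the weights of its orientations. -/
def unorientedWeight (d : ℕ) (e : Finset Plane) : Set (ZMod d) :=
  {w | ∃ p ∈ e, ∃ q ∈ e, p ≠ q ∧ w = orientedWeight d p q}

/-- The set of images of a simplex under `G`: its `G`-equivalence class. -/
def gClass (s : Finset Plane) : Set (Finset Plane) := range fun g : GMap => s.image g

/-- The Weight of a `d`-minimal edge: its weight `±i`, together with the label of its
`G`-equivalence class, for which the class itself is taken. -/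
def edgeWeight (d : ℕ) (e : Finset Plane) : Set (ZMod d) × Set (Finset Plane) :=
  (unorientedWeight d e, gClass e)

/-- The Weight of a polygon: the multiset of the Weights of the (finitely many) `d`-minimal edges
that make up its boundary. -/
def polygonWeight (d : ℕ) (P : Set Plane) : Multiset (Set (ZMod d) × Set (Finset Plane)) :=
  ∑ᶠ e ∈ {e : Finset Plane | IsMinimalEdge d e ∧ convexHull ℝ (e : Set Plane) ⊆ frontier P},
    {edgeWeight d e}

/-- Twice the signed area of the triangle `p q r`; positive iff `p, q, r` are in
counterclockwise order. -/
def signedArea (p q r : Plane) : ℝ :=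
  (q 0 - p 0) * (r 1 - p 1) - (r 0 - p 0) * (q 1 - p 1)

open scoped Classical in
/-- The counterclockwise oriented edges of a triangle: those which have the third vertex to their
left. -/
def ccwEdges (t : Finset Plane) : Finset (Plane × Plane) :=
  (t ×ˢ t).filter fun e => ∃ r ∈ t, 0 < signedArea e.1 e.2 r

/-- The weight of a `d`-minimal triangle: the multiset of the weights of its counterclockwise
oriented edges. -/
def triangleWeight (d : ℕ) (t : Finset Plane) : Multiset (ZMod d) :=
  (ccwEdges t).val.map fun e => orientedWeight d e.1 e.2

/-! ### The pseudo-flip dynamical system -/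

/-- The multiset of the weights of the facets of a `d`-minimal triangulation. -/
def pseudoTriangulation (d : ℕ) (T : Finset (Finset Plane)) : Multiset (Multiset (ZMod d)) :=
  (facets T).val.map (triangleWeight d)

/-- A pseudo-flip: two members `ω₁, ω₂` of `τ`, which are the weights of `d`-minimal triangles
`a b c` and `b c e` forming a parallelogram with diagonal `b c`, are replaced by the weights of the
triangles `a b e` and `a c e` that arise when the diagonal is exchanged. -/
def PseudoFlip (d : ℕ) (τ τ' : Multiset (Multiset (ZMod d))) : Prop :=
  ∃ a b c e : Plane, a + e = b + c ∧
    IsMinimalTriangle d {a, b, c} ∧ IsMinimalTriangle d {b, c, e} ∧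
    ∃ ρ : Multiset (Multiset (ZMod d)),
      τ = {triangleWeight d {a, b, c}, triangleWeight d {b, c, e}} + ρ ∧
      τ' = {triangleWeight d {a, b, e}, triangleWeight d {a, c, e}} + ρ

/-- All multisets of weights that arise by finitely many pseudo-flips from the multiset of weights
of a `d`-minimal triangulation of `P`. -/
def dynSystem (d : ℕ) (P : Set Plane) : Set (Multiset (Multiset (ZMod d))) :=
  {τ | ∃ T, IsMinimalTriangulation d P T ∧
    Relation.ReflTransGen (PseudoFlip d) (pseudoTriangulation d T) τ}

end

end DiscreteEquidecomp

open DiscreteEquidecomp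

/-! Everything is reduced to multisets of `G`-classes of simplices in tilings by `N`-minimal
triangles, for a suitable multiple `N` of the denominators that occur. Two triangulations with the
same multiset of classes yield an equidecomposability relation by gluing `G`-maps
(`exists_equidecompRel`), and conversely a relation forces these multisets to agree
(`IsEquidecompRel.classes_eq`).

The geometric engine is `exists_insert_edges`: flips can force any finite family of pairwise
noncrossing minimal segments into a minimal tiling. For one segment, take a convex height that is a
natural number at every lattice point and zero only at the two ends. Flips that lower the total
height terminate. When none is left, the piecewise affine interpolation of the height is convex
along the segment, hence nonpositive on it, and this forces the segment to be an edge. Forcing all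
edges of a second tiling gives `flip_connected`, so that `dynSystem` is the pseudo-flip orbit of any
single tiling (`mem_dynSystem`). Forcing segments into the standard tiling of a large box gives
minimal tilings of polygons and triangles, and common refinements of rational dissections.

Sufficiency: the weight of a minimal triangle determines its `G`-class
(`gEquiv_of_triangleWeight_eq`), so each pseudo-flip is realized by a scissors congruence, up to
replacing triangles by equivalent ones. Scissors congruence is transitive because of common
refinements. Equal dynamical systems therefore give tilings of `P` and `Q` with equivalent
triangles. Twice the edges of a tiling are the sides of its triangles together with the boundary
edges, so equal Weights match the edges (`classes_edges_eq`). The vertices are all lattice points of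
level `N`, and the class of such a point is given by its exact denominator, so equal Ehrhart
functions match them (`classes_latticeIn_eq`).

Necessity: `G`-maps preserve every lattice, which gives the Ehrhart functions. The same double
count, carried out in an arbitrary triangulation, gives the classes of the boundary edges at a fine
level (`IsTriangulation.classes_boundary`), and the end pieces of the coarse boundary edges recover
the classes at level `d` (`IsPolygon.classes_eq_of_mul_dvd`). Cutting corresponding triangles in
corresponding ways gives tilings with equal weights, hence equal orbits. -/

namespace DiscreteEquidecomp

noncomputable section

/-! ### The group of `G`-maps -/

/-- The closed simplex with vertex set `s`. -/
abbrev hull (s : Finset Plane) : Set Plane := convexHull ℝ (s : Set Plane)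

theorem plane_ext {x y : Plane} (h0 : x 0 = y 0) (h1 : x 1 = y 1) : x = y :=
  funext (Fin.forall_fin_two.2 ⟨h0, h1⟩)

/-- The action of a `G`-map on the plane. -/
def GMap.act (g : GMap) (x : Plane) : Plane :=
  ![(g.lin.1 0 0 : ℝ) * x 0 + (g.lin.1 0 1 : ℝ) * x 1 + g.trans 0,
    (g.lin.1 1 0 : ℝ) * x 0 + (g.lin.1 1 1 : ℝ) * x 1 + g.trans 1]

theorem GMap.act_zero (g : GMap) (x : Plane) :
    g.act x 0 = (g.lin.1 0 0 : ℝ) * x 0 + (g.lin.1 0 1 : ℝ) * x 1 + g.trans 0 := rfl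

theorem GMap.act_one (g : GMap) (x : Plane) :
    g.act x 1 = (g.lin.1 1 0 : ℝ) * x 0 + (g.lin.1 1 1 : ℝ) * x 1 + g.trans 1 := rfl

/-- The explicit coordinates of `act` suit `ring` and `linear_combination`; the matrix form of the
coercion is translated only where the given definitions require it. -/
theorem GMap.coe_eq_act (g : GMap) : (g : Plane → Plane) = g.act := by
  funext x
  apply plane_ext
  · simp [GMap.act_zero]
  · simp [GMap.act_one]

/-- The determinant of the linear part. -/
def GMap.det (g : GMap) : ℤ := g.lin.1 0 0 * g.lin.1 1 1 - g.lin.1 0 1 * g.lin.1 1 0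

theorem GMap.det_eq (g : GMap) : g.det = 1 ∨ g.det = -1 := by
  have h : IsUnit (g.lin.1.det) := (Matrix.isUnit_iff_isUnit_det _).1 g.lin.isUnit
  rw [Matrix.det_fin_two] at h
  exact Int.isUnit_iff.1 h

/-- The `G`-map with given coefficients. -/
def GMap.ofCoeffs (a b c d v w : ℤ) (h : a * d - b * c = 1 ∨ a * d - b * c = -1) : GMap where
  lin := ((Matrix.isUnit_iff_isUnit_det !![a, b; c, d]).2 (by
    rw [Matrix.det_fin_two]; exact Int.isUnit_iff.2 (by simpa using h))).unit
  trans := ![v, w]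

theorem GMap.ofCoeffs_zero (a b c d v w : ℤ) (h) (x : Plane) :
    (GMap.ofCoeffs a b c d v w h).act x 0 = a * x 0 + b * x 1 + v := by
  rw [GMap.act_zero]; simp [GMap.ofCoeffs]

theorem GMap.ofCoeffs_one (a b c d v w : ℤ) (h) (x : Plane) :
    (GMap.ofCoeffs a b c d v w h).act x 1 = c * x 0 + d * x 1 + w := by
  rw [GMap.act_one]; simp [GMap.ofCoeffs]

theorem GMap.exists_id : ∃ e : GMap, ∀ x : Plane, e.act x = x :=
  ⟨GMap.ofCoeffs 1 0 0 1 0 0 (by norm_num), fun x => plane_ext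
    (by rw [GMap.ofCoeffs_zero]; simp) (by rw [GMap.ofCoeffs_one]; simp)⟩

theorem GMap.exists_comp (g h : GMap) : ∃ k : GMap, ∀ x : Plane, k.act x = g.act (h.act x) := by
  refine ⟨⟨g.lin * h.lin, fun i => (g.lin.1.mulVec h.trans) i + g.trans i⟩, fun x => ?_⟩
  apply plane_ext
  · rw [GMap.act_zero, GMap.act_zero, GMap.act_zero, GMap.act_one]
    simp [Matrix.mul_apply, Matrix.mulVec, dotProduct, Fin.sum_univ_two]
    ring
  · rw [GMap.act_one, GMap.act_one, GMap.act_zero, GMap.act_one]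
    simp [Matrix.mul_apply, Matrix.mulVec, dotProduct, Fin.sum_univ_two]
    ring

theorem GMap.exists_inv (g : GMap) :
    ∃ k : GMap, (∀ x : Plane, k.act (g.act x) = x) ∧ ∀ x : Plane, g.act (k.act x) = x := by
  have hd := g.det_eq
  have hd2 : (g.det : ℝ) * g.det = 1 := by rcases hd with h | h <;> simp [h]
  have hdd : (g.det : ℝ) = g.lin.1 0 0 * g.lin.1 1 1 - g.lin.1 0 1 * g.lin.1 1 0 := by
    simp [GMap.det]
  -- The inverse linear part is the adjugate divided by the determinant, and dividing by `±1` is the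
  -- same as multiplying by it.
  refine ⟨GMap.ofCoeffs (g.det * g.lin.1 1 1) (-(g.det * g.lin.1 0 1)) (-(g.det * g.lin.1 1 0))
    (g.det * g.lin.1 0 0) (-(g.det * (g.lin.1 1 1 * g.trans 0 - g.lin.1 0 1 * g.trans 1)))
    (-(g.det * (-g.lin.1 1 0 * g.trans 0 + g.lin.1 0 0 * g.trans 1))) ?_, ?_, ?_⟩
  · have : g.det * g.lin.1 1 1 * (g.det * g.lin.1 0 0) - -(g.det * g.lin.1 0 1) * -(g.det * g.lin.1 1 0)
        = g.det * g.det * g.det := by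
      conv_rhs => rw [mul_assoc]; arg 2; arg 2; rw [GMap.det]
      ring
    rw [this]; rcases hd with h | h <;> simp [h]
  · intro x
    apply plane_ext
    · rw [GMap.ofCoeffs_zero, GMap.act_zero, GMap.act_one]
      push_cast
      linear_combination (x 0) * hd2 - (g.det * x 0 : ℝ) * hdd
    · rw [GMap.ofCoeffs_one, GMap.act_zero, GMap.act_one]
      push_cast
      linear_combination (x 1) * hd2 - (g.det * x 1 : ℝ) * hdd
  · intro x
    apply plane_ext
    · rw [GMap.act_zero, GMap.ofCoeffs_zero, GMap.ofCoeffs_one]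
      push_cast
      linear_combination (x 0 - g.trans 0) * hd2 - (g.det * (x 0 - g.trans 0) : ℝ) * hdd
    · rw [GMap.act_one, GMap.ofCoeffs_zero, GMap.ofCoeffs_one]
      push_cast
      linear_combination (x 1 - g.trans 1) * hd2 - (g.det * (x 1 - g.trans 1) : ℝ) * hdd

theorem GMap.injective (g : GMap) : Function.Injective g.act := by
  obtain ⟨k, hk, -⟩ := g.exists_inv
  exact Function.LeftInverse.injective hk

theorem GMap.surjective (g : GMap) : Function.Surjective g.act := by
  obtain ⟨k, -, hk⟩ := g.exists_inv
  exact Function.RightInverse.surjective hk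

/-- A `G`-map as an affine equivalence of the plane. -/
def GMap.affineEquiv (g : GMap) : Plane ≃ᵃ[ℝ] Plane :=
  AffineEquiv.ofBijective (φ := { toFun := g.act
                                  linear := Matrix.mulVecLin (g.lin.1.map (fun n : ℤ => (n : ℝ)))
                                  map_vadd' := fun p v => by
                                    simp only [← GMap.coe_eq_act]
                                    simp [Matrix.mulVec_add, add_assoc] })
    ⟨g.injective, g.surjective⟩

theorem GMap.sum_comb (g : GMap) (s : Finset Plane) (w : Plane → ℝ) (h : ∑ p ∈ s, w p = 1) :
    g.act (∑ p ∈ s, w p • p) = ∑ p ∈ s, w p • g.act p := by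
  apply plane_ext
  · rw [GMap.act_zero]
    simp only [Finset.sum_apply, Pi.smul_apply, smul_eq_mul, GMap.act_zero, Finset.mul_sum]
    simp only [mul_add, Finset.sum_add_distrib, ← Finset.sum_mul, h, one_mul]
    congr 2 <;> exact Finset.sum_congr rfl fun p _ => by ring
  · rw [GMap.act_one]
    simp only [Finset.sum_apply, Pi.smul_apply, smul_eq_mul, GMap.act_one, Finset.mul_sum]
    simp only [mul_add, Finset.sum_add_distrib, ← Finset.sum_mul, h, one_mul]
    congr 2 <;> exact Finset.sum_congr rfl fun p _ => by ring

theorem GMap.continuous (g : GMap) : Continuous g.act := by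
  refine continuous_pi (Fin.forall_fin_two.2 ⟨?_, ?_⟩)
  · simp only [GMap.act_zero]; fun_prop
  · simp only [GMap.act_one]; fun_prop

theorem GMap.card_image (g : GMap) (s : Finset Plane) : (s.image g.act).card = s.card :=
  Finset.card_image_of_injective _ g.injective

theorem GMap.hull_image (g : GMap) (s : Finset Plane) : hull (s.image g.act) = g.act '' hull s := by
  have := (g.affineEquiv.toAffineMap).image_convexHull (s : Set Plane)
  rw [hull, Finset.coe_image]
  exact this.symm

theorem GMap.openSimplex_image_subset (g : GMap) (s : Finset Plane) :
    g.act '' openSimplex s ⊆ openSimplex (s.image g.act) := by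
  obtain ⟨k, hk, hk'⟩ := g.exists_inv
  rintro _ ⟨x, ⟨w, hw, h1, rfl⟩, rfl⟩
  refine ⟨fun p => w (k.act p), ?_, ?_, ?_⟩
  · intro p hp
    obtain ⟨q, hq, rfl⟩ := Finset.mem_image.1 hp
    change 0 < w (k.act (g.act q))
    rw [hk]; exact hw q hq
  · rw [Finset.sum_image g.injective.injOn]; simpa only [hk] using h1
  · rw [Finset.sum_image g.injective.injOn, g.sum_comb s w h1]; simp only [hk]

theorem GMap.image_image_inv {g k : GMap} (hk : ∀ x : Plane, k.act (g.act x) = x) (s : Finset Plane) :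
    (s.image g.act).image k.act = s := by
  rw [Finset.image_image]
  rw [show k.act ∘ g.act = id from funext hk, Finset.image_id]

theorem GMap.openSimplex_image (g : GMap) (s : Finset Plane) :
    openSimplex (s.image g.act) = g.act '' openSimplex s := by
  refine Subset.antisymm ?_ (g.openSimplex_image_subset s)
  obtain ⟨k, hk, hk'⟩ := g.exists_inv
  intro y hy
  have := k.openSimplex_image_subset (s.image g.act) ⟨y, hy, rfl⟩
  rw [GMap.image_image_inv hk] at this
  exact ⟨_, this, hk' y⟩

theorem GMap.isSimplex_image (g : GMap) {s : Finset Plane} (h : IsSimplex s) :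
    IsSimplex (s.image g.act) := by
  refine ⟨h.1.image _, ?_⟩
  have h2 := (g.affineEquiv.affineIndependent_set_of_eq_iff (s := (s : Set Plane))).2 h.2
  have e : g.affineEquiv '' (s : Set Plane) = ((s.image g.act : Finset Plane) : Set Plane) := by
    rw [Finset.coe_image]; rfl
  rw [e] at h2
  exact h2

theorem GMap.mem_lattice (g : GMap) {d : ℕ} (hd : 0 < d) {x : Plane} (hx : x ∈ lattice d) :
    g.act x ∈ lattice d := by
  have hd' : (d : ℝ) ≠ 0 := by positivity
  obtain ⟨m, hm⟩ := hx 0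
  obtain ⟨n, hn⟩ := hx 1
  refine Fin.forall_fin_two.2 ⟨?_, ?_⟩
  · refine ⟨g.lin.1 0 0 * m + g.lin.1 0 1 * n + d * g.trans 0, ?_⟩
    rw [GMap.act_zero, hm, hn]; push_cast; field_simp
  · refine ⟨g.lin.1 1 0 * m + g.lin.1 1 1 * n + d * g.trans 1, ?_⟩
    rw [GMap.act_one, hm, hn]; push_cast; field_simp

theorem GMap.mem_lattice_iff (g : GMap) {d : ℕ} (hd : 0 < d) {x : Plane} :
    g.act x ∈ lattice d ↔ x ∈ lattice d := by
  refine ⟨fun h => ?_, g.mem_lattice hd⟩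
  obtain ⟨k, hk, -⟩ := g.exists_inv
  simpa only [hk] using k.mem_lattice hd h

theorem GMap.isMinimal_image (g : GMap) {d : ℕ} (hd : 0 < d) {s : Finset Plane}
    (h : IsMinimal d s) : IsMinimal d (s.image g.act) := by
  refine ⟨g.isSimplex_image h.1, ?_⟩
  change hull (s.image g.act) ∩ _ = _
  rw [g.hull_image, Finset.coe_image]
  ext y
  constructor
  · rintro ⟨⟨x, hx, rfl⟩, hy⟩
    exact ⟨x, h.2 ▸ (⟨hx, (g.mem_lattice_iff hd).1 hy⟩ : x ∈ hull s ∩ lattice d), rfl⟩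
  · rintro ⟨x, hx, rfl⟩
    have hx' : x ∈ hull s ∩ lattice d := h.2.symm ▸ hx
    exact ⟨⟨x, hx'.1, rfl⟩, g.mem_lattice hd hx'.2⟩

theorem GMap.isMinimalTriangle_image (g : GMap) {d : ℕ} (hd : 0 < d) {s : Finset Plane}
    (h : IsMinimalTriangle d s) : IsMinimalTriangle d (s.image g.act) :=
  ⟨(g.card_image s).trans h.1, g.isMinimal_image hd h.2⟩

theorem GMap.isMinimalEdge_image (g : GMap) {d : ℕ} (hd : 0 < d) {s : Finset Plane}
    (h : IsMinimalEdge d s) : IsMinimalEdge d (s.image g.act) :=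
  ⟨(g.card_image s).trans h.1, g.isMinimal_image hd h.2⟩

/-- Two simplices are equivalent if some `G`-map carries one to the other. -/
def GEquiv (s t : Finset Plane) : Prop := ∃ g : GMap, s.image g.act = t

theorem GEquiv.refl (s : Finset Plane) : GEquiv s s := by
  obtain ⟨e, he⟩ := GMap.exists_id
  refine ⟨e, ?_⟩
  rw [show e.act = id from funext he, Finset.image_id]

theorem GEquiv.symm {s t : Finset Plane} (h : GEquiv s t) : GEquiv t s := by
  obtain ⟨g, rfl⟩ := h
  obtain ⟨k, hk, -⟩ := g.exists_inv
  exact ⟨k, GMap.image_image_inv hk s⟩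

theorem GEquiv.trans {s t u : Finset Plane} (h : GEquiv s t) (h' : GEquiv t u) : GEquiv s u := by
  obtain ⟨g, rfl⟩ := h
  obtain ⟨k, rfl⟩ := h'
  obtain ⟨l, hl⟩ := k.exists_comp g
  refine ⟨l, ?_⟩
  rw [Finset.image_image]
  congr 1
  exact funext hl

theorem mem_gClass {s t : Finset Plane} : t ∈ gClass s ↔ GEquiv s t := by
  simp only [gClass, GMap.coe_eq_act, mem_range, GEquiv]

/-- Classes are orbits. Matching simplices up to `G` thereby becomes an equality of multisets of
sets, which can be summed and cancelled. -/
theorem gClass_eq_iff {s t : Finset Plane} : gClass s = gClass t ↔ GEquiv s t := by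
  constructor
  · intro h
    rw [← mem_gClass, h, mem_gClass]
    exact GEquiv.refl t
  · intro h
    ext u
    rw [mem_gClass, mem_gClass]
    exact ⟨fun hu => h.symm.trans hu, fun hu => h.trans hu⟩

/-! ### Simplices -/

/-- The weights are functions on the whole plane, so that weights on a face and on the ambient
simplex can be compared without changing the index type. -/
theorem isSimplex_iff {s : Finset Plane} : IsSimplex s ↔ s.Nonempty ∧
    ∀ w : Plane → ℝ, ∑ p ∈ s, w p = 0 → ∑ p ∈ s, w p • p = 0 → ∀ p ∈ s, w p = 0 := by
  refine and_congr_right fun _ => ?_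
  rw [affineIndependent_iff_of_fintype]
  constructor
  · intro h w h0 h1 p hp
    refine h (fun q => w q) ?_ ?_ ⟨p, hp⟩
    · rw [← h0]; exact Finset.sum_coe_sort s w
    · rw [Finset.weightedVSub_eq_linear_combination _
        (by rw [← h0]; exact Finset.sum_coe_sort s w), ← h1]
      exact Finset.sum_coe_sort s fun p => w p • p
  · intro h w h0 h1 i
    classical
    obtain ⟨W, hW⟩ : ∃ W : Plane → ℝ, ∀ q : s, W q = w q :=
      ⟨fun p => if hp : p ∈ s then w ⟨p, hp⟩ else 0, fun q => by simp⟩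
    rw [Finset.weightedVSub_eq_linear_combination _ h0] at h1
    rw [← hW i]
    refine h W ?_ ?_ _ i.2
    · rw [← Finset.sum_coe_sort, Finset.sum_congr rfl fun q _ => hW q, h0]
    · rw [← Finset.sum_coe_sort, ← h1]
      exact Finset.sum_congr rfl fun q _ => by rw [hW q]

theorem IsSimplex.weights_unique {s : Finset Plane} (h : IsSimplex s) {w w' : Plane → ℝ}
    (h1 : ∑ p ∈ s, w p = 1) (h1' : ∑ p ∈ s, w' p = 1)
    (e : ∑ p ∈ s, w p • p = ∑ p ∈ s, w' p • p) : ∀ p ∈ s, w p = w' p := by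
  intro p hp
  have := (isSimplex_iff.1 h).2 (fun p => w p - w' p)
    (by rw [Finset.sum_sub_distrib, h1, h1', sub_self])
    (by simp only [sub_smul, Finset.sum_sub_distrib, e, sub_self]) p hp
  linarith

theorem mem_hull_iff {s : Finset Plane} {x : Plane} : x ∈ hull s ↔
    ∃ w : Plane → ℝ, (∀ p ∈ s, 0 ≤ w p) ∧ ∑ p ∈ s, w p = 1 ∧ ∑ p ∈ s, w p • p = x :=
  Finset.mem_convexHull'

theorem openSimplex_subset_hull (s : Finset Plane) : openSimplex s ⊆ hull s := by
  rintro x ⟨w, hw, h⟩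
  exact mem_hull_iff.2 ⟨w, fun p hp => (hw p hp).le, h⟩

theorem hull_mono {s t : Finset Plane} (h : s ⊆ t) : hull s ⊆ hull t :=
  convexHull_mono (Finset.coe_subset.2 h)

theorem mem_hull_of_mem {s : Finset Plane} {p : Plane} (h : p ∈ s) : p ∈ hull s :=
  subset_convexHull ℝ _ h

theorem isCompact_hull (s : Finset Plane) : IsCompact (hull s) :=
  s.finite_toSet.isCompact_convexHull ℝ

theorem isClosed_hull (s : Finset Plane) : IsClosed (hull s) := (isCompact_hull s).isClosed

theorem exists_face {s : Finset Plane} {x : Plane} (hx : x ∈ hull s) :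
    ∃ f ⊆ s, f.Nonempty ∧ x ∈ openSimplex f := by
  classical
  obtain ⟨w, hw, h1, rfl⟩ := mem_hull_iff.1 hx
  have hz : ∀ p ∈ s, p ∉ s.filter (fun p => 0 < w p) → w p = 0 := by
    intro p hp hn
    by_contra h0
    exact hn (Finset.mem_filter.2 ⟨hp, lt_of_le_of_ne (hw p hp) (Ne.symm h0)⟩)
  have h1' : ∑ p ∈ s.filter (fun p => 0 < w p), w p = 1 := by
    rw [← h1]
    exact Finset.sum_subset (Finset.filter_subset _ _) fun p hp hn => hz p hp hn
  refine ⟨s.filter fun p => 0 < w p, Finset.filter_subset _ _, ?_, w, ?_, h1', ?_⟩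
  · by_contra hne
    rw [Finset.not_nonempty_iff_eq_empty] at hne
    rw [hne] at h1'; simp at h1'
  · intro p hp; exact (Finset.mem_filter.1 hp).2
  · refine Finset.sum_subset (Finset.filter_subset _ _) fun p hp hn => ?_
    rw [hz p hp hn, zero_smul]

theorem IsSimplex.subset {s f : Finset Plane} (h : IsSimplex s) (hf : f ⊆ s) (hn : f.Nonempty) :
    IsSimplex f := by
  classical
  refine isSimplex_iff.2 ⟨hn, fun w h0 h1 p hp => ?_⟩
  have := (isSimplex_iff.1 h).2 (fun p => if p ∈ f then w p else 0)
    (by rw [Finset.sum_ite_mem, Finset.inter_eq_right.2 hf, h0])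
    (by
      simp only [ite_smul, zero_smul]
      rw [Finset.sum_ite_mem, Finset.inter_eq_right.2 hf, h1]) p (hf hp)
  simpa [hp] using this

/-- Extended by zero to `s`, the two weight functions of `x` agree by uniqueness; a vertex of
positive weight must therefore occur in `f'`. -/
theorem IsSimplex.face_weights {s f f' : Finset Plane} (h : IsSimplex s) (hf : f ⊆ s) (hf' : f' ⊆ s)
    {x : Plane} (hx : x ∈ openSimplex f) (hx' : x ∈ hull f') : f ⊆ f' := by
  classical
  obtain ⟨w, hw, h1, rfl⟩ := hx
  obtain ⟨w', hw', h1', e⟩ := mem_hull_iff.1 hx'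
  intro p hp
  by_contra hn
  have := h.weights_unique (w := fun p => if p ∈ f then w p else 0)
    (w' := fun p => if p ∈ f' then w' p else 0)
    (by rw [← h1, Finset.sum_ite_mem, Finset.inter_eq_right.2 hf])
    (by rw [← h1', Finset.sum_ite_mem, Finset.inter_eq_right.2 hf'])
    (by
      simp only [ite_smul, zero_smul]
      rw [Finset.sum_ite_mem, Finset.inter_eq_right.2 hf, Finset.sum_ite_mem,
        Finset.inter_eq_right.2 hf', e]) p (hf hp)
  simp only [hp, hn, if_true, if_false] at this
  exact absurd this (hw p hp).ne'

theorem IsSimplex.face_eq {s f f' : Finset Plane} (h : IsSimplex s) (hf : f ⊆ s) (hf' : f' ⊆ s)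
    {x : Plane} (hx : x ∈ openSimplex f) (hx' : x ∈ openSimplex f') : f = f' :=
  Finset.Subset.antisymm (h.face_weights hf hf' hx (openSimplex_subset_hull _ hx'))
    (h.face_weights hf' hf hx' (openSimplex_subset_hull _ hx))

theorem openSimplex_nonempty {s : Finset Plane} (h : s.Nonempty) : (openSimplex s).Nonempty := by
  have hc : (0 : ℝ) < s.card := by exact_mod_cast h.card_pos
  refine ⟨_, fun _ => (s.card : ℝ)⁻¹, fun _ _ => inv_pos.2 hc, ?_, rfl⟩
  rw [Finset.sum_const, nsmul_eq_mul, mul_inv_cancel₀ hc.ne']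

theorem comb_mem_openSimplex {s : Finset Plane} {x c : Plane} (hc : c ∈ openSimplex s)
    (hx : x ∈ hull s) {r : ℝ} (hr : 0 < r) (hr1 : r ≤ 1) :
    r • c + (1 - r) • x ∈ openSimplex s := by
  obtain ⟨w, hw, h1, rfl⟩ := hc
  obtain ⟨w', hw', h1', rfl⟩ := mem_hull_iff.1 hx
  refine ⟨fun p => r * w p + (1 - r) * w' p, fun p hp => ?_, ?_, ?_⟩
  · have := mul_pos hr (hw p hp)
    have := mul_nonneg (sub_nonneg.2 hr1) (hw' p hp)
    linarith
  · rw [Finset.sum_add_distrib, ← Finset.mul_sum, ← Finset.mul_sum, h1, h1']; ring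
  · simp only [add_smul, Finset.sum_add_distrib, mul_smul, Finset.smul_sum]

theorem convex_openSimplex (s : Finset Plane) : Convex ℝ (openSimplex s) := by
  intro x hx y hy a b ha hb hab
  rcases ha.eq_or_lt with rfl | ha
  · rw [zero_add] at hab; subst hab; simpa using hy
  · rw [show b = 1 - a by linarith]
    exact comb_mem_openSimplex hx (openSimplex_subset_hull _ hy) ha (by linarith)

theorem isPreconnected_openSimplex (s : Finset Plane) : IsPreconnected (openSimplex s) :=
  (convex_openSimplex s).isPreconnected

theorem hull_subset_closure {s : Finset Plane} (h : s.Nonempty) :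
    hull s ⊆ closure (openSimplex s) := by
  intro x hx
  obtain ⟨c, hc⟩ := openSimplex_nonempty h
  have ht : Filter.Tendsto (fun r : ℝ => r • c + (1 - r) • x) (𝓝[>] 0) (𝓝 x) := by
    have : Continuous fun r : ℝ => r • c + (1 - r) • x := by fun_prop
    have h2 := this.tendsto 0
    simp only [zero_smul, sub_zero, one_smul, zero_add] at h2
    exact h2.mono_left nhdsWithin_le_nhds
  refine mem_closure_of_tendsto ht ?_
  filter_upwards [Ioo_mem_nhdsGT (zero_lt_one' ℝ)] with r hr
  exact comb_mem_openSimplex hc hx hr.1 hr.2.le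

theorem closure_openSimplex {s : Finset Plane} (h : s.Nonempty) :
    closure (openSimplex s) = hull s :=
  Subset.antisymm (closure_minimal (openSimplex_subset_hull s) (isClosed_hull s))
    (hull_subset_closure h)

/-- This moves a point of a closed simplex to a nearby one in general position. -/
theorem meets_openSimplex {s : Finset Plane} {V : Set Plane} (hV : IsOpen V) {x : Plane}
    (hx : x ∈ hull s) (hxV : x ∈ V) : (V ∩ openSimplex s).Nonempty := by
  have hn : s.Nonempty := by
    rw [Finset.nonempty_iff_ne_empty]; rintro rfl; simp [hull] at hx
  exact mem_closure_iff.1 (hull_subset_closure hn hx) V hV hxV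

theorem openSimplex_singleton (p : Plane) : openSimplex {p} = {p} := by
  ext x
  simp only [openSimplex, Finset.sum_singleton, Finset.mem_singleton, forall_eq, mem_ofPred_eq,
    mem_singleton_iff]
  constructor
  · rintro ⟨w, -, h, rfl⟩; rw [h, one_smul]
  · rintro rfl; exact ⟨fun _ => 1, one_pos, rfl, one_smul _ _⟩

theorem exists_weights_pair {p q : Plane} (h : p ≠ q) (α β : ℝ) :
    ∃ w : Plane → ℝ, w p = α ∧ w q = β := by
  classical
  exact ⟨fun x => if x = p then α else β, by simp, by simp [h.symm]⟩

theorem exists_weights_triple {a b c : Plane} (hab : a ≠ b) (hac : a ≠ c) (hbc : b ≠ c)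
    (α β γ : ℝ) : ∃ w : Plane → ℝ, w a = α ∧ w b = β ∧ w c = γ := by
  classical
  exact ⟨fun x => if x = a then α else if x = b then β else γ, by simp, by simp [hab.symm],
    by simp [hac.symm, hbc.symm]⟩

theorem sum_triple {M : Type*} [AddCommMonoid M] {a b c : Plane} (hab : a ≠ b) (hac : a ≠ c)
    (hbc : b ≠ c) (f : Plane → M) : ∑ p ∈ ({a, b, c} : Finset Plane), f p = f a + f b + f c := by
  rw [Finset.sum_insert (by simp [hab, hac]), Finset.sum_pair hbc, add_assoc]

theorem mem_openSimplex_pair {p q x : Plane} (h : p ≠ q) : x ∈ openSimplex {p, q} ↔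
    ∃ r : ℝ, 0 < r ∧ r < 1 ∧ x = p + r • (q - p) := by
  constructor
  · rintro ⟨w, hw, h1, rfl⟩
    rw [Finset.sum_pair h] at h1 ⊢
    have hp := hw p (by simp)
    have hq := hw q (by simp)
    refine ⟨w q, hq, by linarith, ?_⟩
    rw [show w p = 1 - w q by linarith]; module
  · rintro ⟨r, h0, h1, rfl⟩
    obtain ⟨w, hp, hq⟩ := exists_weights_pair h (1 - r) r
    refine ⟨w, ?_, ?_, ?_⟩
    · intro x hx
      rcases Finset.mem_insert.1 hx with rfl | hx
      · rw [hp]; linarith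
      · rw [Finset.mem_singleton.1 hx, hq]; exact h0
    · rw [Finset.sum_pair h, hp, hq]; ring
    · rw [Finset.sum_pair h, hp, hq]; module

theorem mem_hull_pair {p q x : Plane} : x ∈ hull {p, q} ↔
    ∃ r : ℝ, 0 ≤ r ∧ r ≤ 1 ∧ x = p + r • (q - p) := by
  rw [hull, Finset.coe_pair, convexHull_pair, segment_eq_image']
  simp only [mem_image, mem_Icc, and_assoc]
  exact exists_congr fun r => by simp only [eq_comm]

theorem mem_openSimplex_triple {a b c x : Plane} (hab : a ≠ b) (hac : a ≠ c) (hbc : b ≠ c) :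
    x ∈ openSimplex {a, b, c} ↔ ∃ α β γ : ℝ, 0 < α ∧ 0 < β ∧ 0 < γ ∧ α + β + γ = 1 ∧
      x = α • a + β • b + γ • c := by
  constructor
  · rintro ⟨w, hw, h1, rfl⟩
    rw [sum_triple hab hac hbc] at h1 ⊢
    exact ⟨w a, w b, w c, hw _ (by simp), hw _ (by simp), hw _ (by simp), h1, rfl⟩
  · rintro ⟨α, β, γ, h0, h1, h2, h3, rfl⟩
    obtain ⟨w, ha, hb, hc⟩ := exists_weights_triple hab hac hbc α β γ
    refine ⟨w, ?_, ?_, ?_⟩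
    · intro p hp
      simp only [Finset.mem_insert, Finset.mem_singleton] at hp
      rcases hp with rfl | rfl | rfl
      · rwa [ha]
      · rwa [hb]
      · rwa [hc]
    · rw [sum_triple hab hac hbc, ha, hb, hc, h3]
    · rw [sum_triple hab hac hbc, ha, hb, hc]

theorem mem_hull_triple {a b c x : Plane} (hab : a ≠ b) (hac : a ≠ c) (hbc : b ≠ c) :
    x ∈ hull {a, b, c} ↔ ∃ α β γ : ℝ, 0 ≤ α ∧ 0 ≤ β ∧ 0 ≤ γ ∧ α + β + γ = 1 ∧
      x = α • a + β • b + γ • c := by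
  rw [mem_hull_iff]
  constructor
  · rintro ⟨w, hw, h1, rfl⟩
    rw [sum_triple hab hac hbc] at h1 ⊢
    exact ⟨w a, w b, w c, hw _ (by simp), hw _ (by simp), hw _ (by simp), h1, rfl⟩
  · rintro ⟨α, β, γ, h0, h1, h2, h3, rfl⟩
    obtain ⟨w, ha, hb, hc⟩ := exists_weights_triple hab hac hbc α β γ
    refine ⟨w, ?_, ?_, ?_⟩
    · intro p hp
      simp only [Finset.mem_insert, Finset.mem_singleton] at hp
      rcases hp with rfl | rfl | rfl
      · rwa [ha]
      · rwa [hb]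
      · rwa [hc]
    · rw [sum_triple hab hac hbc, ha, hb, hc, h3]
    · rw [sum_triple hab hac hbc, ha, hb, hc]

/-! ### Triangles -/

theorem ne_of_signedArea_ne_zero {a b c : Plane} (h : signedArea a b c ≠ 0) :
    a ≠ b ∧ a ≠ c ∧ b ≠ c := by
  refine ⟨?_, ?_, ?_⟩ <;> rintro rfl <;> apply h <;> rw [signedArea] <;> ring

theorem signedArea_comb (a b c : Plane) {α β γ : ℝ} (h : α + β + γ = 1) :
    signedArea (α • a + β • b + γ • c) b c = α * signedArea a b c ∧
    signedArea a (α • a + β • b + γ • c) c = β * signedArea a b c ∧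
    signedArea a b (α • a + β • b + γ • c) = γ * signedArea a b c := by
  obtain rfl : α = 1 - β - γ := by linarith
  simp only [signedArea, Pi.add_apply, Pi.smul_apply, smul_eq_mul]
  refine ⟨?_, ?_, ?_⟩ <;> ring

/-- Barycentric coordinates are ratios of signed areas, so membership in a triangle becomes three
sign conditions that do not depend on its orientation. -/
theorem eq_comb_signedArea {a b c : Plane} (h : signedArea a b c ≠ 0) (x : Plane) :
    signedArea x b c / signedArea a b c + signedArea a x c / signedArea a b c +
      signedArea a b x / signedArea a b c = 1 ∧
    x = (signedArea x b c / signedArea a b c) • a + (signedArea a x c / signedArea a b c) • b +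
      (signedArea a b x / signedArea a b c) • c := by
  constructor
  · rw [← add_div, ← add_div, div_eq_one_iff_eq h]; simp only [signedArea]; ring
  · apply plane_ext
    · simp only [Pi.add_apply, Pi.smul_apply, smul_eq_mul]
      field_simp
      simp only [signedArea]; ring
    · simp only [Pi.add_apply, Pi.smul_apply, smul_eq_mul]
      field_simp
      simp only [signedArea]; ring

theorem isSimplex_triple {a b c : Plane} (h : signedArea a b c ≠ 0) : IsSimplex {a, b, c} := by
  obtain ⟨hab, hac, hbc⟩ := ne_of_signedArea_ne_zero h
  refine isSimplex_iff.2 ⟨by simp, fun w h0 h1 => ?_⟩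
  rw [sum_triple hab hac hbc] at h0 h1
  have e0 := congrFun h1 0
  have e1 := congrFun h1 1
  simp only [Pi.add_apply, Pi.smul_apply, smul_eq_mul, Pi.zero_apply] at e0 e1
  have ka : w a * signedArea a b c = 0 := by
    simp only [signedArea]
    linear_combination (b 0 * c 1 - b 1 * c 0) * h0 + (b 1 - c 1) * e0 + (c 0 - b 0) * e1
  have kb : w b * signedArea a b c = 0 := by
    simp only [signedArea]
    linear_combination (c 0 * a 1 - c 1 * a 0) * h0 + (c 1 - a 1) * e0 + (a 0 - c 0) * e1
  have kc : w c * signedArea a b c = 0 := by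
    simp only [signedArea]
    linear_combination (a 0 * b 1 - a 1 * b 0) * h0 + (a 1 - b 1) * e0 + (b 0 - a 0) * e1
  intro p hp
  simp only [Finset.mem_insert, Finset.mem_singleton] at hp
  rcases hp with rfl | rfl | rfl
  · exact (mul_eq_zero.1 ka).resolve_right h
  · exact (mul_eq_zero.1 kb).resolve_right h
  · exact (mul_eq_zero.1 kc).resolve_right h

theorem card_triple {a b c : Plane} (h : signedArea a b c ≠ 0) :
    ({a, b, c} : Finset Plane).card = 3 := by
  obtain ⟨hab, hac, hbc⟩ := ne_of_signedArea_ne_zero h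
  exact Finset.card_eq_three.2 ⟨a, b, c, hab, hac, hbc, rfl⟩

theorem exists_smul_of_cross {u v : Plane} (hu : u ≠ 0) (h : u 0 * v 1 - u 1 * v 0 = 0) :
    ∃ t : ℝ, v = t • u := by
  have hn : 0 < u 0 * u 0 + u 1 * u 1 := by
    rcases eq_or_ne (u 0) 0 with h0 | h0
    · have h1 : u 1 ≠ 0 := fun h1 => hu (plane_ext h0 h1)
      have := mul_self_pos.2 h1
      nlinarith [mul_self_nonneg (u 0)]
    · have := mul_self_pos.2 h0
      nlinarith [mul_self_nonneg (u 1)]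
  -- The coefficient of the orthogonal projection of `v` to the line of `u`.
  refine ⟨(v 0 * u 0 + v 1 * u 1) / (u 0 * u 0 + u 1 * u 1), plane_ext ?_ ?_⟩
  · rw [Pi.smul_apply, smul_eq_mul, div_mul_eq_mul_div, eq_div_iff hn.ne']; linear_combination -(u 1) * h
  · rw [Pi.smul_apply, smul_eq_mul, div_mul_eq_mul_div, eq_div_iff hn.ne']; linear_combination (u 0) * h

theorem signedArea_ne_zero {a b c : Plane} (hab : a ≠ b) (hac : a ≠ c) (hbc : b ≠ c)
    (h : IsSimplex {a, b, c}) : signedArea a b c ≠ 0 := by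
  intro h0
  obtain ⟨t, ht⟩ := exists_smul_of_cross (u := b - a) (v := c - a) (sub_ne_zero.2 hab.symm) (by
    simp only [signedArea] at h0
    simp only [Pi.sub_apply]
    linarith)
  obtain ⟨w, ha, hb, hc⟩ := exists_weights_triple hab hac hbc (t - 1) (-t) 1
  have := (isSimplex_iff.1 h).2 w (by rw [sum_triple hab hac hbc, ha, hb, hc]; ring)
    (by
      rw [sum_triple hab hac hbc, ha, hb, hc]
      have : c = a + t • (b - a) := by rw [← ht]; abel
      rw [this]; module) c (by simp)
  rw [hc] at this
  exact one_ne_zero this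

theorem exists_triple {t : Finset Plane} (hc : t.card = 3) (h : IsSimplex t) :
    ∃ a b c, t = {a, b, c} ∧ signedArea a b c ≠ 0 := by
  obtain ⟨a, b, c, hab, hac, hbc, rfl⟩ := Finset.card_eq_three.1 hc
  exact ⟨a, b, c, rfl, signedArea_ne_zero hab hac hbc h⟩

theorem mem_openSimplex_iff_signedArea {a b c : Plane} (h : signedArea a b c ≠ 0) (x : Plane) :
    x ∈ openSimplex {a, b, c} ↔ 0 < signedArea x b c / signedArea a b c ∧
      0 < signedArea a x c / signedArea a b c ∧ 0 < signedArea a b x / signedArea a b c := by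
  obtain ⟨hab, hac, hbc⟩ := ne_of_signedArea_ne_zero h
  rw [mem_openSimplex_triple hab hac hbc]
  constructor
  · rintro ⟨α, β, γ, h0, h1, h2, h3, rfl⟩
    obtain ⟨e1, e2, e3⟩ := signedArea_comb a b c h3
    rw [e1, e2, e3, mul_div_assoc, mul_div_assoc, mul_div_assoc, div_self h]
    simp only [mul_one]
    exact ⟨h0, h1, h2⟩
  · rintro ⟨h0, h1, h2⟩
    exact ⟨_, _, _, h0, h1, h2, eq_comb_signedArea h x⟩

theorem mem_hull_iff_signedArea {a b c : Plane} (h : signedArea a b c ≠ 0) (x : Plane) :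
    x ∈ hull {a, b, c} ↔ 0 ≤ signedArea x b c / signedArea a b c ∧
      0 ≤ signedArea a x c / signedArea a b c ∧ 0 ≤ signedArea a b x / signedArea a b c := by
  obtain ⟨hab, hac, hbc⟩ := ne_of_signedArea_ne_zero h
  rw [mem_hull_triple hab hac hbc]
  constructor
  · rintro ⟨α, β, γ, h0, h1, h2, h3, rfl⟩
    obtain ⟨e1, e2, e3⟩ := signedArea_comb a b c h3
    rw [e1, e2, e3, mul_div_assoc, mul_div_assoc, mul_div_assoc, div_self h]
    simp only [mul_one]
    exact ⟨h0, h1, h2⟩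
  · rintro ⟨h0, h1, h2⟩
    exact ⟨_, _, _, h0, h1, h2, eq_comb_signedArea h x⟩

theorem isOpen_openSimplex {t : Finset Plane} (hc : t.card = 3) (h : IsSimplex t) :
    IsOpen (openSimplex t) := by
  obtain ⟨a, b, c, rfl, hD⟩ := exists_triple hc h
  have : openSimplex {a, b, c} = {x | 0 < signedArea x b c / signedArea a b c} ∩
      ({x | 0 < signedArea a x c / signedArea a b c} ∩
        {x | 0 < signedArea a b x / signedArea a b c}) := by
    ext x; exact mem_openSimplex_iff_signedArea hD x
  rw [this]
  simp only [signedArea]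
  refine (isOpen_lt ?_ ?_).inter ((isOpen_lt ?_ ?_).inter (isOpen_lt ?_ ?_)) <;> fun_prop

theorem openSimplex_subset_interior {t : Finset Plane} (hc : t.card = 3) (h : IsSimplex t) :
    openSimplex t ⊆ interior (hull t) :=
  interior_maximal (openSimplex_subset_hull t) (isOpen_openSimplex hc h)

theorem exists_edge_of_notMem {t : Finset Plane} (hc : t.card = 3) {x : Plane} (hx : x ∈ hull t)
    (hn : x ∉ openSimplex t) : ∃ e ⊆ t, e.card = 2 ∧ x ∈ hull e := by
  obtain ⟨f, hf, hfn, hxf⟩ := exists_face hx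
  have hlt : f.card < 3 := by
    rw [← hc]
    refine Finset.card_lt_card (Finset.ssubset_iff_subset_ne.2 ⟨hf, ?_⟩)
    rintro rfl; exact hn hxf
  obtain ⟨e, he, het, hec⟩ := Finset.exists_subsuperset_card_eq hf (n := 2) (by omega) (by omega)
  exact ⟨e, het, hec, hull_mono he (openSimplex_subset_hull _ hxf)⟩

theorem frontier_hull_subset {t : Finset Plane} (hc : t.card = 3) (h : IsSimplex t) {x : Plane}
    (hx : x ∈ frontier (hull t)) : ∃ e ⊆ t, e.card = 2 ∧ x ∈ hull e := by
  refine exists_edge_of_notMem hc ((isClosed_hull t).frontier_subset hx) fun h' => ?_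
  exact hx.2 (openSimplex_subset_interior hc h h')

/-! ### Lattices and minimal simplices -/

theorem mem_lattice_iff {d : ℕ} (hd : 0 < d) {x : Plane} :
    x ∈ lattice d ↔ ∃ m n : ℤ, d * x 0 = m ∧ d * x 1 = n := by
  have hd' : (d : ℝ) ≠ 0 := by positivity
  have h : ∀ i, (∃ n : ℤ, x i = (n : ℝ) / d) ↔ ∃ n : ℤ, d * x i = n := fun i =>
    exists_congr fun n => by rw [eq_div_iff hd', mul_comm]
  simp only [lattice, mem_ofPred_eq, Fin.forall_fin_two, h]
  constructor
  · rintro ⟨⟨m, hm⟩, n, hn⟩; exact ⟨m, n, hm, hn⟩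
  · rintro ⟨m, n, hm, hn⟩; exact ⟨⟨m, hm⟩, n, hn⟩

theorem lattice_mono {d N : ℕ} (hN : 0 < N) (h : d ∣ N) : lattice d ⊆ lattice N := by
  obtain ⟨m, rfl⟩ := h
  have hd : 0 < d := Nat.pos_of_mul_pos_right hN
  intro x hx
  obtain ⟨u, v, hu, hv⟩ := (mem_lattice_iff hd).1 hx
  exact (mem_lattice_iff hN).2 ⟨m * u, m * v, by push_cast; rw [← hu]; ring,
    by push_cast; rw [← hv]; ring⟩

theorem lattice_comb {d : ℕ} (hd : 0 < d) {a b c : Plane} (ha : a ∈ lattice d) (hb : b ∈ lattice d)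
    (hc : c ∈ lattice d) (m : ℤ) : a + (m : ℝ) • (b - c) ∈ lattice d := by
  obtain ⟨a0, a1, ha0, ha1⟩ := (mem_lattice_iff hd).1 ha
  obtain ⟨b0, b1, hb0, hb1⟩ := (mem_lattice_iff hd).1 hb
  obtain ⟨c0, c1, hc0, hc1⟩ := (mem_lattice_iff hd).1 hc
  refine (mem_lattice_iff hd).2 ⟨a0 + m * (b0 - c0), a1 + m * (b1 - c1), ?_, ?_⟩ <;> push_cast <;>
    simp only [Pi.add_apply, Pi.smul_apply, Pi.sub_apply, smul_eq_mul]
  · rw [← ha0, ← hb0, ← hc0]; ring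
  · rw [← ha1, ← hb1, ← hc1]; ring

theorem exists_int_signedArea {d : ℕ} (hd : 0 < d) {a b c : Plane} (ha : a ∈ lattice d)
    (hb : b ∈ lattice d) (hc : c ∈ lattice d) : ∃ n : ℤ, (d : ℝ) ^ 2 * signedArea a b c = n := by
  obtain ⟨a0, a1, ha0, ha1⟩ := (mem_lattice_iff hd).1 ha
  obtain ⟨b0, b1, hb0, hb1⟩ := (mem_lattice_iff hd).1 hb
  obtain ⟨c0, c1, hc0, hc1⟩ := (mem_lattice_iff hd).1 hc
  refine ⟨(b0 - a0) * (c1 - a1) - (c0 - a0) * (b1 - a1), ?_⟩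
  push_cast
  rw [← ha0, ← ha1, ← hb0, ← hb1, ← hc0, ← hc1, signedArea]; ring

theorem IsMinimal.mem_lattice {d : ℕ} {s : Finset Plane} (h : IsMinimal d s) {p : Plane}
    (hp : p ∈ s) : p ∈ lattice d := by
  have : p ∈ convexHull ℝ (s : Set Plane) ∩ lattice d := h.2.symm ▸ hp
  exact this.2

theorem IsMinimal.mem_of_mem_hull {d : ℕ} {s : Finset Plane} (h : IsMinimal d s) {p : Plane}
    (hp : p ∈ hull s) (hl : p ∈ lattice d) : p ∈ s := by
  have : p ∈ (s : Set Plane) := h.2 ▸ ⟨hp, hl⟩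
  exact this

/-- A lattice point of the face is a vertex of `t`, and a vertex lying in the hull of a face belongs
to that face. -/
theorem IsMinimal.face {d : ℕ} {t f : Finset Plane} (h : IsMinimal d t) (hf : f ⊆ t)
    (hn : f.Nonempty) : IsMinimal d f := by
  refine ⟨h.1.subset hf hn, Subset.antisymm ?_ fun p hp => ?_⟩
  · rintro x ⟨hx, hl⟩
    have hxt := h.mem_of_mem_hull (hull_mono hf hx) hl
    have := h.1.face_weights (Finset.singleton_subset_iff.2 hxt) hf
      (by rw [openSimplex_singleton]; rfl) hx
    exact Finset.singleton_subset_iff.1 this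
  · exact ⟨mem_hull_of_mem hp, h.mem_lattice (hf hp)⟩

/-- For area `±1` in units of the lattice, lattice points have integral barycentric coordinates.
Nonnegative integers with sum `1` describe a vertex. -/
theorem isMinimalTriangle_of_signedArea {d : ℕ} (hd : 0 < d) {a b c : Plane} (ha : a ∈ lattice d)
    (hb : b ∈ lattice d) (hc : c ∈ lattice d)
    (h : (d : ℝ) ^ 2 * signedArea a b c = 1 ∨ (d : ℝ) ^ 2 * signedArea a b c = -1) :
    IsMinimalTriangle d {a, b, c} := by
  have hD : signedArea a b c ≠ 0 := by
    intro h0; rw [h0] at h; norm_num at h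
  have hd' : (d : ℝ) ^ 2 ≠ 0 := by positivity
  refine ⟨card_triple hD, isSimplex_triple hD, Subset.antisymm ?_ ?_⟩
  · rintro x ⟨hx, hl⟩
    have key : ∀ s : ℝ, (∃ n : ℤ, (d : ℝ) ^ 2 * s = n) → ∃ n : ℤ, s / signedArea a b c = n := by
      rintro s ⟨n, hn⟩
      have e : s / signedArea a b c = ((d : ℝ) ^ 2 * s) / ((d : ℝ) ^ 2 * signedArea a b c) := by
        field_simp
      rcases h with h | h
      · exact ⟨n, by rw [e, h, hn, div_one]⟩
      · exact ⟨-n, by rw [e, h, hn]; push_cast; ring⟩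
    obtain ⟨k, hk⟩ := key _ (exists_int_signedArea hd hl hb hc)
    obtain ⟨l, hl'⟩ := key _ (exists_int_signedArea hd ha hl hc)
    obtain ⟨m, hm⟩ := key _ (exists_int_signedArea hd ha hb hl)
    obtain ⟨h0, h1, h2⟩ := (mem_hull_iff_signedArea hD x).1 hx
    obtain ⟨e1, e2⟩ := eq_comb_signedArea hD x
    rw [hk, hl', hm] at e1 e2
    rw [hk] at h0; rw [hl'] at h1; rw [hm] at h2
    norm_cast at h0 h1 h2 e1
    have : (k = 1 ∧ l = 0 ∧ m = 0) ∨ (k = 0 ∧ l = 1 ∧ m = 0) ∨ (k = 0 ∧ l = 0 ∧ m = 1) := by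
      omega
    rcases this with ⟨rfl, rfl, rfl⟩ | ⟨rfl, rfl, rfl⟩ | ⟨rfl, rfl, rfl⟩ <;> simp [e2]
  · intro p hp
    refine ⟨mem_hull_of_mem hp, ?_⟩
    simp only [Finset.coe_insert, Finset.coe_singleton, mem_insert_iff, mem_singleton_iff] at hp
    rcases hp with rfl | rfl | rfl <;> assumption

/-- Subtracting integral multiples of the edge vectors moves any lattice point into the
parallelogram spanned by the triangle. Each half of the parallelogram contains no lattice points
except vertices, so the edge vectors form a basis of the lattice and the determinant is a unit. -/
theorem signedArea_of_isMinimalTriangle {d : ℕ} (hd : 0 < d) {a b c : Plane}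
    (hD : signedArea a b c ≠ 0) (h : IsMinimal d {a, b, c}) :
    (d : ℝ) ^ 2 * signedArea a b c = 1 ∨ (d : ℝ) ^ 2 * signedArea a b c = -1 := by
  obtain ⟨hab, hac, hbc⟩ := ne_of_signedArea_ne_zero hD
  have hd' : (d : ℝ) ≠ 0 := by positivity
  have ha := h.mem_lattice (p := a) (by simp)
  have hb := h.mem_lattice (p := b) (by simp)
  have hc := h.mem_lattice (p := c) (by simp)
  have uniq : ∀ β γ : ℝ, 0 ≤ β → 0 ≤ γ → β + γ ≤ 1 → a + β • (b - a) + γ • (c - a) ∈ lattice d →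
      (β = 0 ∧ γ = 0) ∨ (β = 1 ∧ γ = 0) ∨ (β = 0 ∧ γ = 1) := by
    intro β γ h0 h1 h2 hl
    have e : a + β • (b - a) + γ • (c - a) = (1 - β - γ) • a + β • b + γ • c := by module
    have hs : (1 - β - γ) + β + γ = 1 := by ring
    have hm := h.mem_of_mem_hull ((mem_hull_triple hab hac hbc).2
      ⟨1 - β - γ, β, γ, by linarith, h0, h1, hs, e⟩) hl
    rw [e] at hm
    obtain ⟨-, e2, e3⟩ := signedArea_comb a b c hs
    simp only [Finset.mem_insert, Finset.mem_singleton] at hm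
    rcases hm with hm | hm | hm <;> rw [hm] at e2 e3
    · left
      constructor
      · apply mul_right_cancel₀ hD; rw [← e2, signedArea]; ring
      · apply mul_right_cancel₀ hD; rw [← e3, signedArea]; ring
    · right; left
      constructor
      · apply mul_right_cancel₀ hD; rw [← e2, one_mul]
      · apply mul_right_cancel₀ hD; rw [← e3, signedArea]; ring
    · right; right
      constructor
      · apply mul_right_cancel₀ hD; rw [← e2, signedArea]; ring
      · apply mul_right_cancel₀ hD; rw [← e3, one_mul]
  have integral : ∀ x ∈ lattice d, (∃ m : ℤ, signedArea a x c / signedArea a b c = m) ∧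
      ∃ n : ℤ, signedArea a b x / signedArea a b c = n := by
    intro x hx
    obtain ⟨e1, e2⟩ := eq_comb_signedArea hD x
    set β := signedArea a x c / signedArea a b c
    set γ := signedArea a b x / signedArea a b c
    have hα : signedArea x b c / signedArea a b c = 1 - β - γ := by linarith
    rw [hα] at e2
    have hy : a + Int.fract β • (b - a) + Int.fract γ • (c - a) ∈ lattice d := by
      have := lattice_comb hd (lattice_comb hd hx hb ha (-⌊β⌋)) hc ha (-⌊γ⌋)
      convert this using 1
      rw [← Int.self_sub_floor, ← Int.self_sub_floor]
      conv_rhs => rw [e2]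
      push_cast
      module
    have f0 := Int.fract_nonneg β
    have f1 := Int.fract_lt_one β
    have g0 := Int.fract_nonneg γ
    have g1 := Int.fract_lt_one γ
    have hz : Int.fract β = 0 ∧ Int.fract γ = 0 := by
      rcases le_or_gt (Int.fract β + Int.fract γ) 1 with hle | hgt
      · rcases uniq _ _ f0 g0 hle hy with h | h | h
        · exact h
        · linarith
        · linarith
      -- In the far half of the parallelogram, the point reflection `y ↦ b + c - y` leads back to
      -- the triangle.
      · have hy' : a + (1 - Int.fract β) • (b - a) + (1 - Int.fract γ) • (c - a) ∈ lattice d := by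
          have := lattice_comb hd hb hc (hy) 1
          convert this using 1
          push_cast
          module
        rcases uniq _ _ (by linarith) (by linarith) (by linarith) hy' with h | h | h
        · linarith
        · constructor <;> linarith
        · constructor <;> linarith
    refine ⟨⟨⌊β⌋, ?_⟩, ⌊γ⌋, ?_⟩
    · have := Int.self_sub_floor β; rw [hz.1] at this; linarith
    · have := Int.self_sub_floor γ; rw [hz.2] at this; linarith
  obtain ⟨a0, a1, ha0, ha1⟩ := (mem_lattice_iff hd).1 ha
  -- The coordinates of the two unit steps of the lattice form an integral matrix. Its determinant
  -- is the inverse of `d ^ 2 * signedArea a b c`, which is an integer as well.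
  obtain ⟨⟨m, hm⟩, n, hn⟩ := integral ![a 0 + 1 / d, a 1] ((mem_lattice_iff hd).2
    ⟨a0 + 1, a1, by push_cast; rw [← ha0]; simp; field_simp, by simpa using ha1⟩)
  obtain ⟨⟨m', hm'⟩, n', hn'⟩ := integral ![a 0, a 1 + 1 / d] ((mem_lattice_iff hd).2
    ⟨a0, a1 + 1, by simpa using ha0, by push_cast; rw [← ha1]; simp; field_simp⟩)
  obtain ⟨k, hk⟩ := exists_int_signedArea hd ha hb hc
  have hprod : ((m * n' - m' * n : ℤ) : ℝ) * k = 1 := by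
    push_cast
    rw [← hm, ← hn, ← hm', ← hn', ← hk]
    simp only [div_mul_div_comm, ← sub_div]
    rw [div_mul_eq_mul_div, div_eq_one_iff_eq (mul_ne_zero hD hD)]
    simp only [signedArea, Matrix.cons_val_zero, Matrix.cons_val_one]
    field_simp
    ring
  norm_cast at hprod
  rw [hk]
  rcases Int.isUnit_iff.1 (IsUnit.of_mul_eq_one_right _ hprod) with h | h
  · left; rw [h]; norm_num
  · right; rw [h]; norm_num

/-! ### Segments -/

/-- The determinant of two vectors of the plane. -/
def cross (u v : Plane) : ℝ := u 0 * v 1 - u 1 * v 0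

theorem exists_pair {e : Finset Plane} (h : e.card = 2) : ∃ p q, p ≠ q ∧ e = {p, q} :=
  Finset.card_eq_two.1 h

theorem isSimplex_pair {p q : Plane} (h : p ≠ q) : IsSimplex {p, q} := by
  refine isSimplex_iff.2 ⟨by simp, fun w h0 h1 => ?_⟩
  rw [Finset.sum_pair h] at h0 h1
  have hp : w p = -w q := by linarith
  rw [hp] at h1
  have h2 : w q • (q - p) = 0 := by rw [← h1]; module
  have hq : w q = 0 := (smul_eq_zero.1 h2).resolve_right (sub_ne_zero.2 h.symm)
  intro x hx
  rcases Finset.mem_insert.1 hx with rfl | hx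
  · rw [hp, hq, neg_zero]
  · rw [Finset.mem_singleton.1 hx, hq]

theorem cross_eq_zero_of_two_points {p q u v x y : Plane} (hxy : x ≠ y) (hx : x ∈ hull {p, q})
    (hy : y ∈ hull {p, q}) (hx' : x ∈ hull {u, v}) (hy' : y ∈ hull {u, v}) :
    cross (q - p) (v - u) = 0 := by
  obtain ⟨r, -, -, hr⟩ := mem_hull_pair.1 hx
  obtain ⟨s, -, -, hs⟩ := mem_hull_pair.1 hy
  obtain ⟨r', -, -, hr'⟩ := mem_hull_pair.1 hx'
  obtain ⟨s', -, -, hs'⟩ := mem_hull_pair.1 hy'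
  have e1 : x - y = (r - s) • (q - p) := by rw [hr, hs]; module
  have e2 : x - y = (r' - s') • (v - u) := by rw [hr', hs']; module
  have h1 : r - s ≠ 0 := fun h => hxy (sub_eq_zero.1 (by rw [e1, h, zero_smul]))
  have h2 : r' - s' ≠ 0 := fun h => hxy (sub_eq_zero.1 (by rw [e2, h, zero_smul]))
  have : (r - s) * (r' - s') * cross (q - p) (v - u) = cross (x - y) (x - y) := by
    nth_rw 1 [e1]; rw [e2]; simp only [cross, Pi.smul_apply, smul_eq_mul]; ring
  have h3 : cross (x - y) (x - y) = 0 := by simp only [cross]; ring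
  rw [h3] at this
  exact (mul_eq_zero.1 this).resolve_left (mul_ne_zero h1 h2)

/-- Both segments lie on one line. The lattice points `u` and `v` cannot lie in the open minimal
segment, so in the parameter of `u v` this segment never passes `0` or `1`; as it starts from a
point of `[0, 1]`, it stays inside. -/
theorem openSimplex_subset_of_parallel {d : ℕ} {p q u v x : Plane} (hpq : p ≠ q)
    (hmin : IsMinimal d {p, q}) (huv : u ≠ v) (hu : u ∈ lattice d) (hv : v ∈ lattice d)
    (hx : x ∈ openSimplex {p, q}) (hx' : x ∈ hull {u, v}) (hpar : cross (q - p) (v - u) = 0) :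
    openSimplex {p, q} ⊆ openSimplex {u, v} := by
  have hend : ∀ z ∈ lattice d, z ∉ openSimplex {p, q} := by
    intro z hz hzo
    have hzm := hmin.mem_of_mem_hull (openSimplex_subset_hull _ hzo) hz
    have h1 := hmin.1.face_eq (Finset.singleton_subset_iff.2 hzm) Finset.Subset.rfl
      (by rw [openSimplex_singleton]; rfl) hzo
    have := Finset.card_pair hpq
    rw [← h1] at this
    simp at this
  obtain ⟨κ, hκ⟩ := exists_smul_of_cross (u := v - u) (v := q - p) (sub_ne_zero.2 huv.symm) (by
    simp only [cross] at hpar; linarith)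
  have hκ0 : κ ≠ 0 := by
    rintro rfl; rw [zero_smul] at hκ; exact hpq (sub_eq_zero.1 hκ).symm
  obtain ⟨r, hr0, hr1, hr⟩ := (mem_openSimplex_pair hpq).1 hx
  obtain ⟨s, hs0, hs1, hs⟩ := mem_hull_pair.1 hx'
  have hp : p = u + (s - r * κ) • (v - u) := by
    have : p = x - r • (q - p) := by rw [hr]; abel
    rw [this, hs, hκ]; module
  have hline : ∀ ρ : ℝ, p + ρ • (q - p) = u + (s + (ρ - r) * κ) • (v - u) := by
    intro ρ; rw [hκ]; nth_rw 1 [hp]; module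
  have hmem : ∀ ρ : ℝ, 0 < ρ → ρ < 1 → s + (ρ - r) * κ ≠ 0 ∧ s + (ρ - r) * κ ≠ 1 := by
    intro ρ h0 h1
    constructor
    · intro h
      refine hend u hu ((mem_openSimplex_pair hpq).2 ⟨ρ, h0, h1, ?_⟩)
      rw [hline, h]; simp
    · intro h
      refine hend v hv ((mem_openSimplex_pair hpq).2 ⟨ρ, h0, h1, ?_⟩)
      rw [hline, h]; simp
  intro y hy
  obtain ⟨ρ, h0, h1, rfl⟩ := (mem_openSimplex_pair hpq).1 hy
  rw [hline]
  refine (mem_openSimplex_pair huv).2 ⟨_, ?_, ?_, rfl⟩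
  · by_contra hle
    push Not at hle
    -- The parameter `r - s / κ` is where the line passes through `u`; it lies between `ρ` and `r`.
    have hz : s + ((r - s / κ) - r) * κ = 0 := by field_simp; ring
    refine (hmem (r - s / κ) ?_ ?_).1 hz
    · rcases lt_or_gt_of_ne hκ0 with hk | hk
      · have : s / κ ≤ 0 := div_nonpos_of_nonneg_of_nonpos hs0 hk.le
        linarith
      · have : r - s / κ ≥ ρ := by
          rw [ge_iff_le, le_sub_iff_add_le, ← le_sub_iff_add_le', div_le_iff₀ hk]; linarith
        linarith
    · rcases lt_or_gt_of_ne hκ0 with hk | hk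
      · have : r - s / κ ≤ ρ := by
          rw [sub_le_iff_le_add, ← sub_le_iff_le_add', le_div_iff_of_neg hk]; linarith
        linarith
      · have : 0 ≤ s / κ := div_nonneg hs0 hk.le
        linarith
  · by_contra hle
    push Not at hle
    -- The analogous parameter for `v`.
    have hz : s + ((r + (1 - s) / κ) - r) * κ = 1 := by field_simp; ring
    refine (hmem (r + (1 - s) / κ) ?_ ?_).2 hz
    · rcases lt_or_gt_of_ne hκ0 with hk | hk
      · have : ρ ≤ r + (1 - s) / κ := by
          rw [← sub_le_iff_le_add', le_div_iff_of_neg hk]; linarith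
        linarith
      · have : 0 ≤ (1 - s) / κ := div_nonneg (by linarith) hk.le
        linarith
    · rcases lt_or_gt_of_ne hκ0 with hk | hk
      · have : (1 - s) / κ ≤ 0 := div_nonpos_of_nonneg_of_nonpos (by linarith) hk.le
        linarith
      · have : r + (1 - s) / κ ≤ ρ := by
          rw [← le_sub_iff_add_le', div_le_iff₀ hk]; linarith
        linarith

theorem IsMinimal.notMem_openSimplex {d : ℕ} {s : Finset Plane} (h : IsMinimal d s)
    (hc : 2 ≤ s.card) {z : Plane} (hz : z ∈ lattice d) : z ∉ openSimplex s := by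
  intro hzo
  have hzm := h.mem_of_mem_hull (openSimplex_subset_hull _ hzo) hz
  have h1 := h.1.face_eq (Finset.singleton_subset_iff.2 hzm) Finset.Subset.rfl
    (by rw [openSimplex_singleton]; rfl) hzo
  rw [← h1] at hc
  simp at hc

theorem IsMinimalEdge.eq_of_parallel {d : ℕ} {p q u v x : Plane}
    (h : IsMinimalEdge d {p, q}) (h' : IsMinimalEdge d {u, v}) (hx : x ∈ openSimplex {p, q})
    (hx' : x ∈ hull {u, v}) (hpar : cross (q - p) (v - u) = 0) :
    ({p, q} : Finset Plane) = {u, v} := by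
  have hpq : p ≠ q := by rintro rfl; simpa using h.1
  have huv : u ≠ v := by rintro rfl; simpa using h'.1
  have hsub := openSimplex_subset_of_parallel hpq h.2 huv (h'.2.mem_lattice (by simp))
    (h'.2.mem_lattice (by simp)) hx hx' hpar
  have hsub' : hull {p, q} ⊆ hull {u, v} := by
    rw [← closure_openSimplex h.2.1.1, ← closure_openSimplex h'.2.1.1]
    exact closure_mono hsub
  refine Finset.eq_of_subset_of_card_le (fun z hz => ?_) (by rw [h.1, h'.1])
  exact h'.2.mem_of_mem_hull (hsub' (mem_hull_of_mem hz)) (h.2.mem_lattice hz)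

/-- The sign of `cross (c - b) u / signedArea a b c` tells whether `u` points from the side `b c`
towards `a`. The other two barycentric coordinates are positive at `x` and remain so for small
steps. -/
theorem eventually_mem_triangle {a b c x u : Plane} (hD : signedArea a b c ≠ 0)
    (hx : x ∈ openSimplex {b, c}) (hu : 0 < cross (c - b) u / signedArea a b c) :
    ∀ᶠ ε in 𝓝[>] (0 : ℝ), x + ε • u ∈ openSimplex {a, b, c} := by
  obtain ⟨-, -, hbc⟩ := ne_of_signedArea_ne_zero hD
  obtain ⟨r, h0, h1, rfl⟩ := (mem_openSimplex_pair hbc).1 hx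
  set D := signedArea a b c with hDdef
  have e1 : ∀ ε : ℝ, signedArea (b + r • (c - b) + ε • u) b c = ε * cross (c - b) u := by
    intro ε
    simp only [signedArea, cross, Pi.add_apply, Pi.smul_apply, Pi.sub_apply, smul_eq_mul]; ring
  have e2 : ∀ ε : ℝ, signedArea a (b + r • (c - b) + ε • u) c =
      (1 - r) * D + ε * cross u (c - a) := by
    intro ε
    rw [hDdef]
    simp only [signedArea, cross, Pi.add_apply, Pi.smul_apply, Pi.sub_apply, smul_eq_mul]; ring
  have e3 : ∀ ε : ℝ, signedArea a b (b + r • (c - b) + ε • u) =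
      r * D + ε * cross (b - a) u := by
    intro ε
    rw [hDdef]
    simp only [signedArea, cross, Pi.add_apply, Pi.smul_apply, Pi.sub_apply, smul_eq_mul]; ring
  have t2 : ∀ᶠ ε in 𝓝 (0 : ℝ), 0 < ((1 - r) * D + ε * cross u (c - a)) / D := by
    have : ContinuousAt (fun ε : ℝ => ((1 - r) * D + ε * cross u (c - a)) / D) 0 := by fun_prop
    refine this.eventually (lt_mem_nhds ?_)
    beta_reduce
    rw [zero_mul, add_zero, mul_div_cancel_right₀ _ hD]; linarith
  have t3 : ∀ᶠ ε in 𝓝 (0 : ℝ), 0 < (r * D + ε * cross (b - a) u) / D := by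
    have : ContinuousAt (fun ε : ℝ => (r * D + ε * cross (b - a) u) / D) 0 := by fun_prop
    refine this.eventually (lt_mem_nhds ?_)
    beta_reduce
    rw [zero_mul, add_zero, mul_div_cancel_right₀ _ hD]; linarith
  filter_upwards [self_mem_nhdsWithin, t2.filter_mono nhdsWithin_le_nhds,
    t3.filter_mono nhdsWithin_le_nhds] with ε he h2 h3
  rw [mem_openSimplex_iff_signedArea hD, e1, e2, e3]
  refine ⟨?_, h2, h3⟩
  rw [mul_div_assoc]
  exact mul_pos he hu

theorem notMem_triangle {a b c x u : Plane} (hD : signedArea a b c ≠ 0)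
    (hx : x ∈ openSimplex {b, c}) (hu : cross (c - b) u / signedArea a b c < 0) {ε : ℝ}
    (hε : 0 < ε) : x + ε • u ∉ hull {a, b, c} := by
  obtain ⟨-, -, hbc⟩ := ne_of_signedArea_ne_zero hD
  obtain ⟨r, h0, h1, rfl⟩ := (mem_openSimplex_pair hbc).1 hx
  intro h
  have h2 := ((mem_hull_iff_signedArea hD _).1 h).1
  have e1 : signedArea (b + r • (c - b) + ε • u) b c = ε * cross (c - b) u := by
    simp only [signedArea, cross, Pi.add_apply, Pi.smul_apply, Pi.sub_apply, smul_eq_mul]; ring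
  rw [e1, mul_div_assoc] at h2
  have := mul_neg_of_pos_of_neg hε hu
  linarith

theorem eventually_mem_pair {p q x : Plane} (hpq : p ≠ q) (hx : x ∈ openSimplex {p, q}) (κ : ℝ) :
    ∀ᶠ ε in 𝓝[>] (0 : ℝ), x + ε • (κ • (q - p)) ∈ openSimplex {p, q} := by
  obtain ⟨r, h0, h1, rfl⟩ := (mem_openSimplex_pair hpq).1 hx
  have : ContinuousAt (fun ε : ℝ => r + ε * κ) 0 := by fun_prop
  have h2 := this.eventually (Ioo_mem_nhds (a := 0) (b := 1) (by simpa using h0) (by simpa using h1))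
  filter_upwards [h2.filter_mono nhdsWithin_le_nhds] with ε he
  exact (mem_openSimplex_pair hpq).2 ⟨r + ε * κ, he.1, he.2, by module⟩

theorem exists_apex {t e : Finset Plane} (ht : t.card = 3) (hs : IsSimplex t) (he : e ⊆ t)
    (hc : e.card = 2) : ∃ a b c, t = {a, b, c} ∧ e = {b, c} ∧ signedArea a b c ≠ 0 := by
  obtain ⟨b, c, hbc, rfl⟩ := exists_pair hc
  obtain ⟨a, hat, ha⟩ := Finset.exists_mem_notMem_of_card_lt_card (s := {b, c}) (t := t) (by omega)
  have e1 : t = {a, b, c} := by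
    symm
    apply Finset.eq_of_subset_of_card_le
    · exact Finset.insert_subset hat he
    · rw [Finset.card_insert_of_notMem ha, hc, ht]
  simp only [Finset.mem_insert, Finset.mem_singleton, not_or] at ha
  exact ⟨a, b, c, e1, rfl, signedArea_ne_zero ha.1 ha.2 hbc (e1 ▸ hs)⟩

theorem notMem_hull_of_disjoint {t t' : Finset Plane} (ht : t.card = 3) (hs : IsSimplex t)
    (h : Disjoint (openSimplex t) (openSimplex t')) {x : Plane} (hx : x ∈ openSimplex t) :
    x ∉ hull t' := by
  intro hx'
  obtain ⟨y, hy, hy'⟩ := meets_openSimplex (isOpen_openSimplex ht hs) hx' hx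
  exact disjoint_left.1 h hy hy'

/-- If the two edges crossed, a small step along `e'` in the right direction would enter the open
triangle `t` without leaving `t'`. -/
theorem parallel_of_disjoint {t t' e e' : Finset Plane} {p q u v : Plane} (ht : t.card = 3)
    (hs : IsSimplex t) (he : e ⊆ t) (he' : e' ⊆ t')
    (h : Disjoint (openSimplex t) (openSimplex t')) (h1 : e = {p, q}) (hpq : p ≠ q)
    (h2 : e' = {u, v}) (huv : u ≠ v)
    {x : Plane} (hx : x ∈ openSimplex e) (hx' : x ∈ openSimplex e') :
    cross (q - p) (v - u) = 0 := by
  by_contra hne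
  obtain ⟨a, b, c, rfl, e2, hD⟩ := exists_apex ht hs he (by rw [h1]; exact Finset.card_pair hpq)
  have hbc : cross (c - b) (v - u) ≠ 0 := by
    rw [e2] at h1
    have hb : b ∈ ({p, q} : Finset Plane) := h1 ▸ (by simp)
    have hc : c ∈ ({p, q} : Finset Plane) := h1 ▸ (by simp)
    obtain ⟨-, -, hbc⟩ := ne_of_signedArea_ne_zero hD
    simp only [Finset.mem_insert, Finset.mem_singleton] at hb hc
    rcases hb with rfl | rfl <;> rcases hc with rfl | rfl
    · exact absurd rfl hbc
    · exact hne
    · intro h0; apply hne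
      simp only [cross, Pi.sub_apply] at h0 ⊢; linarith
    · exact absurd rfl hbc
  rw [e2] at hx
  rw [h2] at hx'
  -- This factor turns the quotient into the square of `cross (c - b) (v - u)`.
  obtain ⟨κ, hκ⟩ : ∃ κ : ℝ, 0 < cross (c - b) (κ • (v - u)) / signedArea a b c := by
    refine ⟨cross (c - b) (v - u) * signedArea a b c, ?_⟩
    have : cross (c - b) ((cross (c - b) (v - u) * signedArea a b c) • (v - u)) /
        signedArea a b c = cross (c - b) (v - u) ^ 2 := by
      rw [div_eq_iff hD]
      simp only [cross, Pi.smul_apply, smul_eq_mul]; ring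
    rw [this]; positivity
  obtain ⟨ε, h3, h4⟩ := ((eventually_mem_triangle hD hx hκ).and
    (eventually_mem_pair huv hx' κ)).exists
  exact notMem_hull_of_disjoint ht hs h h3
    (hull_mono he' (h2 ▸ openSimplex_subset_hull _ h4))

theorem openSimplex_empty : openSimplex ∅ = ∅ := by
  ext x; simp [openSimplex]

theorem nonempty_of_mem_openSimplex {s : Finset Plane} {x : Plane} (h : x ∈ openSimplex s) :
    s.Nonempty := by
  rw [Finset.nonempty_iff_ne_empty]; rintro rfl; rw [openSimplex_empty] at h; exact h

/-- Two minimal triangles without common interior points meet face to face. -/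
theorem face_eq_of_minimal {d : ℕ} {t t' f f' : Finset Plane} (ht : IsMinimalTriangle d t)
    (ht' : IsMinimalTriangle d t') (h : t = t' ∨ Disjoint (openSimplex t) (openSimplex t'))
    (hf : f ⊆ t) (hf' : f' ⊆ t') {x : Plane} (hx : x ∈ openSimplex f) (hx' : x ∈ openSimplex f') :
    f = f' := by
  rcases h with rfl | h
  · exact ht.2.1.face_eq hf hf' hx hx'
  have hn := nonempty_of_mem_openSimplex hx
  have hn' := nonempty_of_mem_openSimplex hx'
  have hfc : f.card ≤ 3 := ht.1 ▸ Finset.card_le_card hf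
  have hfc' : f'.card ≤ 3 := ht'.1 ▸ Finset.card_le_card hf'
  have hp := hn.card_pos
  have hp' := hn'.card_pos
  have hm := ht.2.face hf hn
  have hm' := ht'.2.face hf' hn'
  by_cases h3 : f.card = 3
  · obtain rfl := Finset.eq_of_subset_of_card_le hf (by rw [ht.1, h3])
    exact absurd (hull_mono hf' (openSimplex_subset_hull _ hx'))
      (notMem_hull_of_disjoint ht.1 ht.2.1 h hx)
  by_cases h3' : f'.card = 3
  · obtain rfl := Finset.eq_of_subset_of_card_le hf' (by rw [ht'.1, h3'])
    exact absurd (hull_mono hf (openSimplex_subset_hull _ hx))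
      (notMem_hull_of_disjoint ht'.1 ht'.2.1 h.symm hx')
  -- A vertex is a lattice point, and minimality makes a lattice point in the hull of the other
  -- triangle a vertex of that triangle too.
  by_cases h1 : f.card = 1
  · obtain ⟨p, rfl⟩ := Finset.card_eq_one.1 h1
    have hxp := hx
    rw [openSimplex_singleton] at hxp
    obtain rfl : x = p := hxp
    have := ht'.2.mem_of_mem_hull (hull_mono hf' (openSimplex_subset_hull _ hx'))
      (hm.mem_lattice (Finset.mem_singleton_self _))
    exact ht'.2.1.face_eq (Finset.singleton_subset_iff.2 this) hf' hx hx'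
  by_cases h1' : f'.card = 1
  · obtain ⟨p, rfl⟩ := Finset.card_eq_one.1 h1'
    have hxp := hx'
    rw [openSimplex_singleton] at hxp
    obtain rfl : x = p := hxp
    have := ht.2.mem_of_mem_hull (hull_mono hf (openSimplex_subset_hull _ hx))
      (hm'.mem_lattice (Finset.mem_singleton_self _))
    exact ht.2.1.face_eq hf (Finset.singleton_subset_iff.2 this) hx hx'
  have h2 : f.card = 2 := by omega
  have h2' : f'.card = 2 := by omega
  obtain ⟨p, q, hpq, rfl⟩ := exists_pair h2
  obtain ⟨u, v, huv, rfl⟩ := exists_pair h2'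
  exact IsMinimalEdge.eq_of_parallel ⟨h2, hm⟩ ⟨h2', hm'⟩ hx (openSimplex_subset_hull _ hx')
    (parallel_of_disjoint ht.1 ht.2.1 hf hf' h rfl hpq rfl huv hx hx')

/-! ### Dissections and flips -/

/-- A dissection of `R` into triangles. -/
def IsDissection (R : Set Plane) (T : Finset (Finset Plane)) : Prop :=
  (∀ t ∈ T, t.card = 3 ∧ IsSimplex t) ∧ (T : Set (Finset Plane)).PairwiseDisjoint openSimplex ∧
    ⋃ t ∈ T, hull t = R

/-- A dissection of `R` into `N`-minimal triangles. -/
def IsTiling (N : ℕ) (R : Set Plane) (T : Finset (Finset Plane)) : Prop :=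
  IsDissection R T ∧ ∀ t ∈ T, IsMinimalTriangle N t

/-- The edges of the triangles of `T`. -/
def edges (T : Finset (Finset Plane)) : Finset (Finset Plane) :=
  T.biUnion fun t => t.powersetCard 2

theorem mem_edges {T : Finset (Finset Plane)} {e : Finset Plane} :
    e ∈ edges T ↔ ∃ t ∈ T, e ⊆ t ∧ e.card = 2 := by
  simp [edges, Finset.mem_powersetCard]

theorem IsDissection.mem_iff {R : Set Plane} {T : Finset (Finset Plane)} (h : IsDissection R T)
    {x : Plane} : x ∈ R ↔ ∃ t ∈ T, x ∈ hull t := by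
  rw [← h.2.2]; simp

theorem IsDissection.eq_or_disjoint {R : Set Plane} {T : Finset (Finset Plane)}
    (h : IsDissection R T) {t t' : Finset Plane} (ht : t ∈ T) (ht' : t' ∈ T) :
    t = t' ∨ Disjoint (openSimplex t) (openSimplex t') := by
  by_cases e : t = t'
  · exact Or.inl e
  · exact Or.inr (h.2.1 ht ht' e)

theorem IsTiling.face_eq {N : ℕ} {R : Set Plane} {T : Finset (Finset Plane)} (h : IsTiling N R T)
    {t t' f f' : Finset Plane} (ht : t ∈ T) (ht' : t' ∈ T) (hf : f ⊆ t) (hf' : f' ⊆ t') {x : Plane}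
    (hx : x ∈ openSimplex f) (hx' : x ∈ openSimplex f') : f = f' :=
  face_eq_of_minimal (h.2 t ht) (h.2 t' ht') (h.1.eq_or_disjoint ht ht') hf hf' hx hx'

theorem IsTiling.isMinimalEdge {N : ℕ} {R : Set Plane} {T : Finset (Finset Plane)}
    (h : IsTiling N R T) {e : Finset Plane} (he : e ∈ edges T) : IsMinimalEdge N e := by
  obtain ⟨t, ht, het, hc⟩ := mem_edges.1 he
  exact ⟨hc, (h.2 t ht).2.face het (Finset.card_pos.1 (by omega))⟩

/-- Since `b + c = a + e`, the smaller of the weights at `b` and `c` can be moved to both `a` and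
`e`. What is left uses only one of `b` and `c`. -/
theorem parallelogram_subset {a b c e : Plane} (h : a + e = b + c) (hab : a ≠ b) (hac : a ≠ c)
    (hbc : b ≠ c) (hbe : b ≠ e) (hce : c ≠ e) (hae : a ≠ e) :
    hull {a, b, c} ∪ hull {b, c, e} ⊆ hull {a, b, e} ∪ hull {a, c, e} := by
  have hc : c = a + e - b := by rw [h]; abel
  have hb : b = a + e - c := by rw [h]; abel
  rintro x (hx | hx)
  · obtain ⟨α, β, γ, h0, h1, h2, h3, rfl⟩ := (mem_hull_triple hab hac hbc).1 hx
    rcases le_total γ β with hle | hle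
    · left
      refine (mem_hull_triple hab hae hbe).2 ⟨α + γ, β - γ, γ, by linarith, by linarith, h2,
        by linarith, ?_⟩
      rw [hc]; module
    · right
      refine (mem_hull_triple hac hae hce).2 ⟨α + β, γ - β, β, by linarith, by linarith, h1,
        by linarith, ?_⟩
      nth_rw 1 [hb]; module
  · obtain ⟨β, γ, ε, h0, h1, h2, h3, rfl⟩ := (mem_hull_triple hbc hbe hce).1 hx
    rcases le_total γ β with hle | hle
    · left
      refine (mem_hull_triple hab hae hbe).2 ⟨γ, β - γ, ε + γ, by linarith, by linarith,
        by linarith, by linarith, ?_⟩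
      rw [hc]; module
    · right
      refine (mem_hull_triple hac hae hce).2 ⟨β, γ - β, ε + β, by linarith, by linarith,
        by linarith, by linarith, ?_⟩
      nth_rw 1 [hb]; module

theorem parallelogram_signedArea {a b c e : Plane} (h : a + e = b + c) :
    signedArea b c e = -signedArea a b c ∧ signedArea a b e = signedArea a b c ∧
      signedArea a c e = -signedArea a b c := by
  have he : e = b + c - a := by rw [← h]; abel
  subst he
  simp only [signedArea, Pi.sub_apply, Pi.add_apply]
  refine ⟨?_, ?_, ?_⟩ <;> ring

theorem parallelogram_ne {a b c e : Plane} (h : a + e = b + c) (hD : signedArea a b c ≠ 0) :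
    a ≠ b ∧ a ≠ c ∧ b ≠ c ∧ b ≠ e ∧ c ≠ e ∧ a ≠ e := by
  obtain ⟨h1, h2, h3⟩ := parallelogram_signedArea h
  obtain ⟨hab, hac, hbc⟩ := ne_of_signedArea_ne_zero hD
  obtain ⟨-, hae, hbe⟩ := ne_of_signedArea_ne_zero (h2 ▸ hD)
  obtain ⟨-, -, hce⟩ := ne_of_signedArea_ne_zero (a := a) (b := c) (c := e)
    (by rw [h3]; exact neg_ne_zero.2 hD)
  exact ⟨hab, hac, hbc, hbe, hce, hae⟩

theorem parallelogram_hull {a b c e : Plane} (h : a + e = b + c) (hD : signedArea a b c ≠ 0) :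
    hull {a, b, c} ∪ hull {b, c, e} = hull {a, b, e} ∪ hull {a, c, e} := by
  obtain ⟨hab, hac, hbc, hbe, hce, hae⟩ := parallelogram_ne h hD
  refine Subset.antisymm (parallelogram_subset h hab hac hbc hbe hce hae) ?_
  have := parallelogram_subset h.symm hab.symm hbe hae hac hce.symm hbc
  rw [Finset.insert_comm b a {e}, Finset.insert_comm b a {c}] at this
  rw [show ({a, c, e} : Finset Plane) = {a, e, c} by rw [Finset.pair_comm],
    show ({b, c, e} : Finset Plane) = {b, e, c} by rw [Finset.pair_comm]]
  exact this

theorem parallelogram_disjoint {a b c e : Plane} (h : a + e = b + c)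
    (hD : signedArea a b c ≠ 0) : Disjoint (openSimplex {a, b, e}) (openSimplex {a, c, e}) := by
  obtain ⟨hab, hac, hbc, hbe, hce, hae⟩ := parallelogram_ne h hD
  obtain ⟨h1, h2, h3⟩ := parallelogram_signedArea h
  rw [disjoint_left]
  intro x hx hx'
  obtain ⟨α, β, γ, -, hβ, -, hs, rfl⟩ := (mem_openSimplex_triple hab hae hbe).1 hx
  obtain ⟨α', β', γ', -, hβ', -, hs', e'⟩ := (mem_openSimplex_triple hac hae hce).1 hx'
  have e1 := (signedArea_comb a b e hs).2.1
  have e2 := (signedArea_comb a c e hs').2.1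
  rw [e', e2, h2, h3] at e1
  have : (β + β') * signedArea a b c = 0 := by linarith
  rcases mul_eq_zero.1 this with h | h
  · linarith
  · exact hD h

/-- The triangulation that arises by exchanging the diagonal of a parallelogram. -/
def IsFlip (T T' : Finset (Finset Plane)) (a b c e : Plane) : Prop :=
  a + e = b + c ∧ {a, b, c} ∈ T ∧ {b, c, e} ∈ T ∧
    T' = insert {a, b, e} (insert {a, c, e} ((T.erase {a, b, c}).erase {b, c, e}))

theorem isMinimalTriangle_iff {N : ℕ} (hN : 0 < N) {a b c : Plane}
    (hD : signedArea a b c ≠ 0) : IsMinimalTriangle N {a, b, c} ↔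
      a ∈ lattice N ∧ b ∈ lattice N ∧ c ∈ lattice N ∧
        ((N : ℝ) ^ 2 * signedArea a b c = 1 ∨ (N : ℝ) ^ 2 * signedArea a b c = -1) :=
  ⟨fun h => ⟨h.2.mem_lattice (by simp), h.2.mem_lattice (by simp), h.2.mem_lattice (by simp),
    signedArea_of_isMinimalTriangle hN hD h.2⟩,
    fun h => isMinimalTriangle_of_signedArea hN h.1 h.2.1 h.2.2.1 h.2.2.2⟩

theorem IsMinimalTriangle.ne {N : ℕ} {a b c : Plane} (h : IsMinimalTriangle N {a, b, c}) :
    a ≠ b ∧ a ≠ c ∧ b ≠ c := by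
  refine ⟨?_, ?_, ?_⟩ <;> rintro rfl
  · have h1 := h.1
    rw [Finset.insert_eq_of_mem (by simp)] at h1
    have := Finset.card_le_two (a := a) (b := c); omega
  · have h1 := h.1
    rw [Finset.insert_eq_of_mem (by simp)] at h1
    have := Finset.card_le_two (a := b) (b := a); omega
  · have h1 := h.1
    rw [Finset.pair_eq_singleton] at h1
    have := Finset.card_le_two (a := a) (b := b); omega

theorem IsMinimalTriangle.signedArea_ne_zero {N : ℕ} {a b c : Plane}
    (h : IsMinimalTriangle N {a, b, c}) : signedArea a b c ≠ 0 :=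
  DiscreteEquidecomp.signedArea_ne_zero h.ne.1 h.ne.2.1 h.ne.2.2 h.2.1

theorem flip_minimal {N : ℕ} (hN : 0 < N) {a b c e : Plane} (h : a + e = b + c)
    (h1 : IsMinimalTriangle N {a, b, c}) (h2 : IsMinimalTriangle N {b, c, e}) :
    IsMinimalTriangle N {a, b, e} ∧ IsMinimalTriangle N {a, c, e} := by
  have hD := h1.signedArea_ne_zero
  obtain ⟨s1, s2, s3⟩ := parallelogram_signedArea h
  obtain ⟨ha, hb, hc, hs⟩ := (isMinimalTriangle_iff hN hD).1 h1
  have he := h2.2.mem_lattice (p := e) (by simp)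
  refine ⟨isMinimalTriangle_of_signedArea hN ha hb he (by rwa [s2]),
    isMinimalTriangle_of_signedArea hN ha hc he ?_⟩
  rw [s3]
  rcases hs with hs | hs
  · right; linarith
  · left; linarith

/-- The old and the new pair fill the same parallelogram, so the new triangles are disjoint from the
rest `S`. The nonmembership clauses allow sums and multisets over `T` and `T'` to be split as two
triangles plus `S`. -/
theorem IsFlip.decomp {N : ℕ} (hN : 0 < N) {R : Set Plane} {T T' : Finset (Finset Plane)}
    {a b c e : Plane} (hT : IsTiling N R T) (h : IsFlip T T' a b c e) :
    IsTiling N R T' ∧ ∃ S : Finset (Finset Plane),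
      T = insert {a, b, c} (insert {b, c, e} S) ∧ {a, b, c} ∉ insert {b, c, e} S ∧
      {b, c, e} ∉ S ∧ T' = insert {a, b, e} (insert {a, c, e} S) ∧
      {a, b, e} ∉ insert {a, c, e} S ∧ {a, c, e} ∉ S := by
  obtain ⟨hs, h1, h2, rfl⟩ := h
  have m1 := hT.2 _ h1
  have m2 := hT.2 _ h2
  obtain ⟨m3, m4⟩ := flip_minimal hN hs m1 m2
  have hD := m1.signedArea_ne_zero
  obtain ⟨hab, hac, hbc, hbe, hce, hae⟩ := parallelogram_ne hs hD
  have hU := parallelogram_hull hs hD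
  have hdis := parallelogram_disjoint hs hD
  set S := (T.erase {a, b, c}).erase {b, c, e} with hS
  have hne : ({a, b, c} : Finset Plane) ≠ {b, c, e} := by
    intro he
    have : a ∈ ({b, c, e} : Finset Plane) := he ▸ (by simp)
    simp [hab, hac, hae] at this
  have hST : ∀ t ∈ S, t ∈ T ∧ t ≠ {a, b, c} ∧ t ≠ {b, c, e} := by
    intro t ht
    rw [hS, Finset.mem_erase, Finset.mem_erase] at ht
    exact ⟨ht.2.2, ht.2.1, ht.1⟩
  have hnew : ∀ n : Finset Plane, IsMinimalTriangle N n →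
      hull n ⊆ hull {a, b, c} ∪ hull {b, c, e} →
      ∀ t ∈ S, Disjoint (openSimplex n) (openSimplex t) := by
    intro n hn hsub t ht
    obtain ⟨htT, hta, htb⟩ := hST t ht
    rw [disjoint_right]
    intro x hx hx'
    rcases hsub (openSimplex_subset_hull _ hx') with h | h
    · exact notMem_hull_of_disjoint (hT.2 t htT).1 (hT.2 t htT).2.1 (hT.1.2.1 htT h1 hta) hx h
    · exact notMem_hull_of_disjoint (hT.2 t htT).1 (hT.2 t htT).2.1 (hT.1.2.1 htT h2 htb) hx h
  have d3 := hnew _ m3 (hU ▸ subset_union_left)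
  have d4 := hnew _ m4 (hU ▸ subset_union_right)
  have hself : ∀ n : Finset Plane, IsMinimalTriangle N n →
      ¬ Disjoint (openSimplex n) (openSimplex n) := by
    intro n hn hd
    obtain ⟨x, hx⟩ := openSimplex_nonempty hn.2.1.1
    exact disjoint_left.1 hd hx hx
  have n3 : ({a, b, e} : Finset Plane) ∉ insert {a, c, e} S := by
    rw [Finset.mem_insert, not_or]
    exact ⟨fun he => hself _ m3 (by nth_rw 2 [he]; exact hdis), fun hm => hself _ m3 (d3 _ hm)⟩
  have n4 : ({a, c, e} : Finset Plane) ∉ S := fun hm => hself _ m4 (d4 _ hm)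
  have hTS : T = insert {a, b, c} (insert {b, c, e} S) := by
    rw [hS, Finset.insert_erase (Finset.mem_erase.2 ⟨hne.symm, h2⟩), Finset.insert_erase h1]
  have hmin : ∀ t ∈ insert {a, b, e} (insert {a, c, e} S), IsMinimalTriangle N t := by
    intro t ht
    rw [Finset.mem_insert, Finset.mem_insert] at ht
    rcases ht with rfl | rfl | ht
    · exact m3
    · exact m4
    · exact hT.2 t (hST t ht).1
  refine ⟨⟨⟨fun t ht => ⟨(hmin t ht).1, (hmin t ht).2.1⟩, ?_, ?_⟩, hmin⟩, S, hTS, ?_, ?_, rfl,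
    n3, n4⟩
  · rw [Finset.coe_insert, Finset.coe_insert]
    refine (PairwiseDisjoint.insert (PairwiseDisjoint.insert ?_ ?_) ?_)
    · exact hT.1.2.1.subset fun t ht => (hST t ht).1
    · intro t ht _; exact d4 t ht
    · intro t ht _
      rcases ht with rfl | ht
      · exact hdis
      · exact d3 t ht
  · rw [← hT.1.2.2]
    conv_rhs => rw [hTS]
    rw [Finset.set_biUnion_insert, Finset.set_biUnion_insert, Finset.set_biUnion_insert,
      Finset.set_biUnion_insert, ← union_assoc, ← union_assoc, hU]
  · rw [Finset.mem_insert, not_or]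
    refine ⟨hne, fun hm => (hST _ hm).2.1 rfl⟩
  · intro hm; exact (hST _ hm).2.2 rfl

/-- Apart from the diagonal `b c`, the edges of the two old triangles are sides of the parallelogram
and survive in the new ones. -/
theorem IsFlip.edges_subset {T T' : Finset (Finset Plane)} {a b c e : Plane}
    (h : IsFlip T T' a b c e) {f : Finset Plane} (hf : f ∈ edges T) (hne : f ≠ {b, c}) :
    f ∈ edges T' := by
  obtain ⟨hs, h1, h2, rfl⟩ := h
  obtain ⟨t, ht, hft, hc⟩ := mem_edges.1 hf
  have key : ∀ x y z : Plane, f ⊆ {x, y, z} → f = {x, y} ∨ f = {x, z} ∨ f = {y, z} := by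
    intro x y z hxyz
    obtain ⟨u, v, huv, rfl⟩ := exists_pair hc
    have hu : u ∈ ({x, y, z} : Finset Plane) := hxyz (by simp)
    have hv : v ∈ ({x, y, z} : Finset Plane) := hxyz (by simp)
    simp only [Finset.mem_insert, Finset.mem_singleton] at hu hv
    rcases hu with rfl | rfl | rfl <;> rcases hv with rfl | rfl | rfl <;>
      simp_all [Finset.pair_comm]
  have hin : ∀ n : Finset Plane, n = {a, b, e} ∨ n = {a, c, e} → f ⊆ n →
      f ∈ edges (insert {a, b, e} (insert {a, c, e} ((T.erase {a, b, c}).erase {b, c, e}))) := by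
    intro n hn hfn
    refine mem_edges.2 ⟨n, ?_, hfn, hc⟩
    rcases hn with rfl | rfl <;> simp
  by_cases e1 : t = {a, b, c}
  · rw [e1] at hft
    rcases key _ _ _ hft with h | h | h
    · exact hin _ (Or.inl rfl) (by rw [h]; intro x; simp; tauto)
    · exact hin _ (Or.inr rfl) (by rw [h]; intro x; simp; tauto)
    · exact absurd h hne
  by_cases e2 : t = {b, c, e}
  · rw [e2] at hft
    rcases key _ _ _ hft with h | h | h
    · exact absurd h hne
    · exact hin _ (Or.inl rfl) (by rw [h]; intro x; simp; tauto)
    · exact hin _ (Or.inr rfl) (by rw [h]; intro x; simp; tauto)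
  refine mem_edges.2 ⟨t, ?_, hft, hc⟩
  simp [e1, e2, ht]

/-! ### Forcing an edge by flips -/

/-- Coordinates of the plane adapted to a minimal segment. -/
theorem exists_coordinates {N : ℕ} (hN : 0 < N) {p q : Plane} (h : IsMinimalEdge N {p, q}) :
    ∃ i j : Plane → ℝ,
      (∀ x y : Plane, ∀ r : ℝ, i (x + r • (y - x)) = i x + r * (i y - i x) ∧
        j (x + r • (y - x)) = j x + r * (j y - j x)) ∧
      (∀ x ∈ lattice N, (∃ m : ℤ, i x = m) ∧ ∃ n : ℤ, j x = n) ∧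
      (∀ x, j x = 0 → i x = 0 → x = p) ∧ (∀ x, j x = 0 → i x = 1 → x = q) ∧
      i p = 0 ∧ j p = 0 ∧ i q = 1 ∧ j q = 0 := by
  have hN' : (N : ℝ) ≠ 0 := by positivity
  have hpq : p ≠ q := by rintro rfl; simpa using h.1
  have hp := h.2.mem_lattice (p := p) (by simp)
  have hq := h.2.mem_lattice (p := q) (by simp)
  obtain ⟨p0, p1, hp0, hp1⟩ := (mem_lattice_iff hN).1 hp
  obtain ⟨q0, q1, hq0, hq1⟩ := (mem_lattice_iff hN).1 hq
  -- A common factor `g > 1` would make `p + (q - p) / g` a lattice point inside the segment.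
  have hcop : IsCoprime (q0 - p0) (q1 - p1) := by
    rw [Int.isCoprime_iff_gcd_eq_one]
    by_contra hg
    set g := Int.gcd (q0 - p0) (q1 - p1) with hgdef
    have hg0 : g ≠ 0 := by
      intro h0
      rw [hgdef, Int.gcd_eq_zero_iff] at h0
      apply hpq
      apply plane_ext
      · apply mul_left_cancel₀ hN'; rw [hp0, hq0]; exact_mod_cast (by omega : p0 = q0)
      · apply mul_left_cancel₀ hN'; rw [hp1, hq1]; exact_mod_cast (by omega : p1 = q1)
    have hg1 : 1 < g := by omega
    obtain ⟨u, hu⟩ := Int.gcd_dvd_left (q0 - p0) (q1 - p1)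
    obtain ⟨v, hv⟩ := Int.gcd_dvd_right (q0 - p0) (q1 - p1)
    rw [← hgdef] at hu hv
    have hgr : (g : ℝ) ≠ 0 := by exact_mod_cast hg0
    have hgr1 : (1 : ℝ) < g := by exact_mod_cast hg1
    have hu' : (N : ℝ) * q 0 - N * p 0 = g * u := by rw [hq0, hp0]; exact_mod_cast hu
    have hv' : (N : ℝ) * q 1 - N * p 1 = g * v := by rw [hq1, hp1]; exact_mod_cast hv
    refine h.2.notMem_openSimplex h.1.ge (z := p + (1 / (g : ℝ)) • (q - p)) ?_
      ((mem_openSimplex_pair hpq).2 ⟨_, by positivity, by rw [div_lt_one (by linarith)]; exact hgr1,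
        rfl⟩)
    refine (mem_lattice_iff hN).2 ⟨p0 + u, p1 + v, ?_, ?_⟩
    · simp only [Pi.add_apply, Pi.smul_apply, Pi.sub_apply, smul_eq_mul]
      push_cast; rw [← hp0]; field_simp; linear_combination hu'
    · simp only [Pi.add_apply, Pi.smul_apply, Pi.sub_apply, smul_eq_mul]
      push_cast; rw [← hp1]; field_simp; linear_combination hv'
  -- The Bézout coefficients define `i`, with value `1` at `q`; `j` is the determinant with `q - p`.
  -- Together they are a unimodular change of coordinates with `p` at `(0, 0)` and `q` at `(1, 0)`.
  obtain ⟨m, n, hmn⟩ := hcop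
  have hmn' : (m : ℝ) * (N * q 0 - N * p 0) + n * (N * q 1 - N * p 1) = 1 := by
    rw [hp0, hp1, hq0, hq1]; exact_mod_cast hmn
  refine ⟨fun x => m * (N * x 0 - N * p 0) + n * (N * x 1 - N * p 1),
    fun x => (N * q 0 - N * p 0) * (N * x 1 - N * p 1) - (N * q 1 - N * p 1) * (N * x 0 - N * p 0),
    ?_, ?_, ?_, ?_, ?_, ?_, ?_, ?_⟩
  · intro x y r
    simp only [Pi.add_apply, Pi.smul_apply, Pi.sub_apply, smul_eq_mul]
    constructor <;> ring
  · intro x hx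
    obtain ⟨x0, x1, hx0, hx1⟩ := (mem_lattice_iff hN).1 hx
    refine ⟨⟨m * (x0 - p0) + n * (x1 - p1), ?_⟩,
      ⟨(q0 - p0) * (x1 - p1) - (q1 - p1) * (x0 - p0), ?_⟩⟩
    · push_cast; rw [← hx0, ← hx1, ← hp0, ← hp1]
    · push_cast; rw [← hx0, ← hx1, ← hp0, ← hp1, ← hq0, ← hq1]
  · intro x hj hi
    simp only at hj hi
    apply plane_ext <;> apply mul_left_cancel₀ hN'
    · linear_combination (N * q 0 - N * p 0) * hi - n * hj - (N * x 0 - N * p 0) * hmn'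
    · linear_combination (N * q 1 - N * p 1) * hi + m * hj - (N * x 1 - N * p 1) * hmn'
  · intro x hj hi
    simp only at hj hi
    apply plane_ext <;> apply mul_left_cancel₀ hN'
    · linear_combination (N * q 0 - N * p 0) * hi - n * hj - (N * x 0 - N * p 0) * hmn'
    · linear_combination (N * q 1 - N * p 1) * hi + m * hj - (N * x 1 - N * p 1) * hmn'
  · simp
  · simp
  · exact hmn'
  · simp only; ring

/-- A convex height function, integral and nonnegative on the lattice, that vanishes exactly at the
two lattice points `p` and `q`. -/
theorem exists_height {N : ℕ} (hN : 0 < N) {p q : Plane} (h : IsMinimalEdge N {p, q}) :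
    ∃ h : Plane → ℝ, ConvexOn ℝ univ h ∧ (∀ x ∈ lattice N, ∃ n : ℕ, h x = n) ∧
      h p = 0 ∧ h q = 0 ∧ ∀ x ∈ lattice N, h x = 0 → x = p ∨ x = q := by
  obtain ⟨i, j, haff, hint, h0, h1, ip, jp, iq, jq⟩ := exists_coordinates hN h
  have hval : ∀ x ∈ lattice N, ∃ m n : ℤ, i x = m ∧ j x = n ∧ 0 ≤ m * (m - 1) := by
    intro x hx
    obtain ⟨⟨m, hm⟩, n, hn⟩ := hint x hx
    refine ⟨m, n, hm, hn, ?_⟩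
    rcases le_or_gt m 0 with h | h
    · exact mul_nonneg_of_nonpos_of_nonpos h (by omega)
    · exact mul_nonneg h.le (by omega)
  -- At integers `i * (i - 1)` is nonnegative and vanishes only at `0` and `1`; between them it is
  -- negative, but no lattice point is concerned.
  refine ⟨fun x => i x * (i x - 1) + j x ^ 2, ⟨convex_univ, ?_⟩, ?_, ?_, ?_, ?_⟩
  · intro x _ y _ α β hα hβ hαβ
    obtain rfl : α = 1 - β := by linarith
    have e : (1 - β) • x + β • y = x + β • (y - x) := by module
    rw [e]
    simp only [(haff x y β).1, (haff x y β).2, smul_eq_mul]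
    -- This is exactly the gap in the convexity inequality.
    have hp : 0 ≤ (1 - β) * β * ((i y - i x) ^ 2 + (j y - j x) ^ 2) := by positivity
    nlinarith [hp]
  · intro x hx
    obtain ⟨m, n, hm, hn, hnn⟩ := hval x hx
    refine ⟨(m * (m - 1) + n ^ 2).toNat, ?_⟩
    have : (0 : ℤ) ≤ m * (m - 1) + n ^ 2 := by positivity
    have h2 : (((m * (m - 1) + n ^ 2).toNat : ℤ) : ℝ) = ((m * (m - 1) + n ^ 2 : ℤ) : ℝ) := by
      rw [Int.toNat_of_nonneg this]
    rw [Int.cast_natCast] at h2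
    rw [h2]; simp only [hm, hn]; push_cast; ring
  · simp [ip, jp]
  · simp [iq, jq]
  · intro x hx hz
    obtain ⟨m, n, hm, hn, hnn⟩ := hval x hx
    simp only [hm, hn] at hz
    norm_cast at hz
    have hn0 : n ^ 2 = 0 := by
      have := sq_nonneg n
      linarith
    have hn0' : n = 0 := by simpa using hn0
    have hm0 : m * (m - 1) = 0 := by
      linarith
    rcases mul_eq_zero.1 hm0 with h | h
    · left; exact h0 x (by rw [hn, hn0']; simp) (by rw [hm, h]; simp)
    · right; exact h1 x (by rw [hn, hn0']; simp) (by rw [hm, show m = 1 by omega]; simp)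

/-- Here `c` is a convex combination of `b` and the midpoint of `a` and `e`. It covers the pairs of
triangles along an edge that form no parallelogram, where convexity of `h` replaces the absence of
flips. -/
theorem convexOn_three {h : Plane → ℝ} (hh : ConvexOn ℝ univ h) {a b c e : Plane} {κ : ℝ}
    (hκ : 2 ≤ κ) (hc : κ • c = a + e + (κ - 2) • b) :
    κ * h c ≤ h a + h e + (κ - 2) * h b := by
  have hκ0 : κ ≠ 0 := by linarith
  have hκp : 0 < κ := by linarith
  have e1 : c = (2 / κ) • ((1 / 2 : ℝ) • a + (1 / 2 : ℝ) • e) + ((κ - 2) / κ) • b := by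
    have : c = κ⁻¹ • (κ • c) := by rw [smul_smul, inv_mul_cancel₀ hκ0, one_smul]
    rw [this, hc]
    simp only [smul_add, smul_smul]
    congr 1
    · congr 2 <;> field_simp
    · congr 1; field_simp
  have s1 := hh.2 (mem_univ ((1 / 2 : ℝ) • a + (1 / 2 : ℝ) • e)) (mem_univ b)
    (show 0 ≤ 2 / κ by positivity) (show 0 ≤ (κ - 2) / κ from div_nonneg (by linarith) hκp.le)
    (by field_simp; ring)
  have s2 := hh.2 (mem_univ a) (mem_univ e) (show (0 : ℝ) ≤ 1 / 2 by norm_num)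
    (show (0 : ℝ) ≤ 1 / 2 by norm_num) (by norm_num)
  rw [← e1] at s1
  simp only [smul_eq_mul] at s1 s2
  have s3 := mul_le_mul_of_nonneg_left s1 hκp.le
  have s4 : κ * (2 / κ * h ((1 / 2 : ℝ) • a + (1 / 2 : ℝ) • e) + (κ - 2) / κ * h b) =
      2 * h ((1 / 2 : ℝ) • a + (1 / 2 : ℝ) • e) + (κ - 2) * h b := by field_simp
  rw [s4] at s3
  linarith

/-- Two minimal triangles on the two sides of a common edge. -/
theorem exists_opposite {N : ℕ} (hN : 0 < N) {a b c e : Plane} (h : IsMinimalTriangle N {a, b, c})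
    (h' : IsMinimalTriangle N {e, b, c})
    (hopp : signedArea a b c * signedArea e b c < 0) :
    ∃ κ : ℤ, a + e = (2 - κ : ℝ) • b + (κ : ℝ) • c := by
  have hD := h.signedArea_ne_zero
  have hD' := h'.signedArea_ne_zero
  obtain ⟨ha, hb, hc, hs⟩ := (isMinimalTriangle_iff hN hD).1 h
  obtain ⟨he, -, -, hs'⟩ := (isMinimalTriangle_iff hN hD').1 h'
  have hN' : (0 : ℝ) < (N : ℝ) ^ 2 := by positivity
  -- Both areas are `±1` in lattice units and of opposite sign. Hence `a + e - 2 b` is parallel to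
  -- `c - b`.
  have hsum : signedArea a b c + signedArea e b c = 0 := by
    have hneg : ((N : ℝ) ^ 2 * signedArea a b c) * ((N : ℝ) ^ 2 * signedArea e b c) < 0 := by
      have := mul_neg_of_pos_of_neg (mul_pos hN' hN') hopp
      linarith
    have : (N : ℝ) ^ 2 * (signedArea a b c + signedArea e b c) = 0 := by
      rcases hs with hs | hs <;> rcases hs' with hs' | hs' <;> rw [hs, hs'] at hneg <;>
        norm_num at hneg <;> linarith
    exact (mul_eq_zero.1 this).resolve_left hN'.ne'
  obtain ⟨t, ht⟩ := exists_smul_of_cross (u := c - b) (v := a + e - b - b)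
    (sub_ne_zero.2 h.ne.2.2.symm) (by
      simp only [signedArea] at hsum
      simp only [Pi.sub_apply, Pi.add_apply]
      linarith)
  -- The area of the lattice triangle `a`, `b`, `a + e - b` is `t` times that of `a b c`, which
  -- makes `t` an integer.
  have hy : a + (1 : ℤ) • (e - b) ∈ lattice N := by
    have := lattice_comb hN ha he hb 1
    simpa using this
  obtain ⟨n, hn⟩ := exists_int_signedArea hN ha hb hy
  have hn' : signedArea a b (a + (1 : ℤ) • (e - b)) = t * signedArea a b c := by
    have : a + (1 : ℤ) • (e - b) = b + t • (c - b) := by rw [← ht, one_smul]; abel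
    rw [this]
    simp only [signedArea, Pi.add_apply, Pi.smul_apply, Pi.sub_apply, smul_eq_mul]; ring
  have ht' : ∃ κ : ℤ, t = κ := by
    rw [hn'] at hn
    rcases hs with hs | hs
    · exact ⟨n, by rw [← hn]; linear_combination -t * hs⟩
    · exact ⟨-n, by push_cast; rw [← hn]; linear_combination t * hs⟩
  obtain ⟨κ, rfl⟩ := ht'
  refine ⟨κ, ?_⟩
  have : a + e = (κ : ℝ) • (c - b) + b + b := by rw [← ht]; abel
  rw [this]; module

/-- An affine function with prescribed values at the vertices of a triangle. -/
theorem exists_interpolation {t : Finset Plane} (hc : t.card = 3) (hs : IsSimplex t)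
    (h : Plane → ℝ) : ∃ A : Plane → ℝ, (∃ k0 k1 k2 : ℝ, ∀ x, A x = k0 + k1 * x 0 + k2 * x 1) ∧
      ∀ p ∈ t, A p = h p := by
  obtain ⟨a, b, c, rfl, hD⟩ := exists_triple hc hs
  refine ⟨fun x => (signedArea x b c * h a + signedArea a x c * h b + signedArea a b x * h c) /
    signedArea a b c, ⟨((b 0 * c 1 - c 0 * b 1) * h a + (c 0 * a 1 - a 0 * c 1) * h b +
      (a 0 * b 1 - b 0 * a 1) * h c) / signedArea a b c,
      ((b 1 - c 1) * h a + (c 1 - a 1) * h b + (a 1 - b 1) * h c) / signedArea a b c,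
      ((c 0 - b 0) * h a + (a 0 - c 0) * h b + (b 0 - a 0) * h c) / signedArea a b c, ?_⟩, ?_⟩
  · intro x
    rw [div_mul_eq_mul_div, div_mul_eq_mul_div, ← add_div, ← add_div]
    simp only [signedArea]; ring
  · intro p hp
    simp only [Finset.mem_insert, Finset.mem_singleton] at hp
    rw [div_eq_iff hD]
    rcases hp with rfl | rfl | rfl <;> simp only [signedArea] <;> ring

theorem affine_sum {A : Plane → ℝ} (hA : ∃ k0 k1 k2 : ℝ, ∀ x, A x = k0 + k1 * x 0 + k2 * x 1)
    (s : Finset Plane) (w : Plane → ℝ) (h : ∑ p ∈ s, w p = 1) :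
    A (∑ p ∈ s, w p • p) = ∑ p ∈ s, w p * A p := by
  obtain ⟨k0, k1, k2, hk⟩ := hA
  simp only [hk, Finset.sum_apply, Pi.smul_apply, smul_eq_mul, mul_add, Finset.sum_add_distrib]
  rw [← Finset.sum_mul, h, one_mul, Finset.mul_sum, Finset.mul_sum]
  congr 2
  · exact Finset.sum_congr rfl fun p _ => by ring
  · exact funext fun p => by ring

theorem exists_third {t : Finset Plane} (ht : t.card = 3) (hs : IsSimplex t) {b c : Plane}
    (hbc : b ≠ c) (h : {b, c} ⊆ t) : ∃ a, t = {a, b, c} ∧ signedArea a b c ≠ 0 := by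
  obtain ⟨a, hat, ha⟩ := Finset.exists_mem_notMem_of_card_lt_card (s := {b, c}) (t := t)
    (by rw [Finset.card_pair hbc]; omega)
  have e1 : t = {a, b, c} := by
    symm
    apply Finset.eq_of_subset_of_card_le
    · exact Finset.insert_subset hat h
    · rw [Finset.card_insert_of_notMem ha, Finset.card_pair hbc, ht]
  simp only [Finset.mem_insert, Finset.mem_singleton, not_or] at ha
  exact ⟨a, e1, signedArea_ne_zero ha.1 ha.2 hbc (e1 ▸ hs)⟩

/-- The interpolation of `h` on the triangles of `T` is convex across the edges outside `E`. -/
def LocallyConvex (T E : Finset (Finset Plane)) (h : Plane → ℝ) : Prop :=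
  ∀ a b c e : Plane, {a, b, c} ∈ T → {e, b, c} ∈ T → {b, c} ∉ E →
    signedArea a b c * signedArea e b c < 0 →
    ∃ κ : ℝ, a + e = (2 - κ) • b + κ • c ∧ (2 - κ) * h b + κ * h c ≤ h a + h e

theorem locallyConvex_of_no_flip {N : ℕ} (hN : 0 < N) {R : Set Plane}
    {T E : Finset (Finset Plane)} (hT : IsTiling N R T) {h : Plane → ℝ} (hh : ConvexOn ℝ univ h)
    (hno : ∀ a b c e T', IsFlip T T' a b c e → {b, c} ∉ E → h b + h c ≤ h a + h e) :
    LocallyConvex T E h := by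
  intro a b c e h1 h2 hE hopp
  obtain ⟨κ, hκ⟩ := exists_opposite hN (hT.2 _ h1) (hT.2 _ h2) hopp
  refine ⟨κ, hκ, ?_⟩
  -- The value `1` is the parallelogram, where a flip is available; in the other two cases convexity
  -- of `h` suffices, with `b` and `c` exchanged in the last.
  have htri : κ = 1 ∨ 2 ≤ κ ∨ κ ≤ 0 := by omega
  rcases htri with rfl | h2κ | h0κ
  · have e1 : a + e = b + c := by rw [hκ]; push_cast; module
    have e2 : ({e, b, c} : Finset Plane) = {b, c, e} := by
      ext x; simp only [Finset.mem_insert, Finset.mem_singleton]; tauto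
    have := hno a b c e _ ⟨e1, h1, e2 ▸ h2, rfl⟩ hE
    push_cast; linarith
  · have h2r : (2 : ℝ) ≤ κ := by exact_mod_cast h2κ
    have := convexOn_three hh (a := a) (b := b) (c := c) (e := e) h2r (by rw [hκ]; module)
    linarith
  · have h2r : (2 : ℝ) ≤ 2 - κ := by
      have : (κ : ℝ) ≤ 0 := by exact_mod_cast h0κ
      linarith
    have := convexOn_three hh (a := a) (b := c) (c := b) (e := e) h2r (by rw [hκ]; module)
    linarith

/-- One of the finitely many tiles contains `x + ε • u` for arbitrarily small `ε`. It contains `x`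
because it is closed, and a whole initial piece because it is convex. -/
theorem exists_common_tile {T : Finset (Finset Plane)} {x u : Plane} {R : Set Plane}
    (hT : IsDissection R T) (h : ∀ᶠ ε in 𝓝[>] (0 : ℝ), x + ε • u ∈ R) :
    ∃ t ∈ T, x ∈ hull t ∧ ∀ᶠ ε in 𝓝[>] (0 : ℝ), x + ε • u ∈ hull t := by
  have hfr : ∃ t ∈ T, ∃ᶠ ε in 𝓝[>] (0 : ℝ), x + ε • u ∈ hull t := by
    by_contra hcon
    push Not at hcon
    have h2 : ∀ᶠ ε in 𝓝[>] (0 : ℝ), ∀ t ∈ T, x + ε • u ∉ hull t :=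
      (Filter.eventually_all_finset T).2 fun t ht => hcon t ht
    obtain ⟨ε, h3, h4⟩ := (h.and h2).exists
    obtain ⟨t, ht, hx⟩ := hT.mem_iff.1 h3
    exact h4 t ht hx
  obtain ⟨t, ht, hf⟩ := hfr
  have hlim : Filter.Tendsto (fun ε : ℝ => x + ε • u) (𝓝[>] 0) (𝓝 x) := by
    have : Continuous fun ε : ℝ => x + ε • u := by fun_prop
    have h2 := this.tendsto 0
    simp only [zero_smul, add_zero] at h2
    exact h2.mono_left nhdsWithin_le_nhds
  have hx : x ∈ hull t := (isClosed_hull t).mem_of_frequently_of_tendsto hf hlim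
  refine ⟨t, ht, hx, ?_⟩
  obtain ⟨ε₀, hm, hpos⟩ := (hf.and_eventually self_mem_nhdsWithin).exists
  filter_upwards [Ioo_mem_nhdsGT hpos] with ε hε
  have hpos' : (0 : ℝ) < ε₀ := hpos
  have := (convex_convexHull ℝ (t : Set Plane)) hx hm (a := 1 - ε / ε₀) (b := ε / ε₀)
    (by rw [sub_nonneg, div_le_one hpos']; exact hε.2.le) (div_nonneg hε.1.le hpos'.le) (by ring)
  convert this using 1
  rw [smul_add, smul_smul, div_mul_cancel₀ _ hpos'.ne']
  module

/-- If the segment is not an edge, it crosses edges of `T` transversally, only edges outside `E`,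
and passes through no vertex in its interior. So the interpolation of `h` is convex along it. It
vanishes at both ends, hence is nonpositive at the midpoint. As `h` is nonnegative at vertices and
zero only at `p` and `q`, the face containing the midpoint has no vertices other than `p` and `q`,
so it is the segment itself. -/
theorem mem_edges_of_locallyConvex {N : ℕ} {R : Set Plane}
    {T E : Finset (Finset Plane)} (hT : IsTiling N R T) {p q : Plane}
    (hs : IsMinimalEdge N {p, q}) (hR : hull {p, q} ⊆ R)
    (hE : ∀ f ∈ E, f = {p, q} ∨ Disjoint (openSimplex f) (openSimplex {p, q}))
    {h : Plane → ℝ} (hnn : ∀ x ∈ lattice N, 0 ≤ h x) (hp0 : h p = 0) (hq0 : h q = 0)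
    (hzero : ∀ x ∈ lattice N, h x = 0 → x = p ∨ x = q) (hlc : LocallyConvex T E h) :
    {p, q} ∈ edges T := by
  by_contra hedge
  have hpq : p ≠ q := by rintro rfl; simpa using hs.1
  have hnoz : ∀ z ∈ lattice N, z ∉ openSimplex {p, q} := fun z hz =>
    hs.2.notMem_openSimplex hs.1.ge hz
  have hex : ∀ t : Finset Plane, ∃ A : Plane → ℝ, t ∈ T →
      (∃ k0 k1 k2 : ℝ, ∀ x, A x = k0 + k1 * x 0 + k2 * x 1) ∧ ∀ v ∈ t, A v = h v := by
    intro t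
    by_cases ht : t ∈ T
    · obtain ⟨A, hA⟩ := exists_interpolation (hT.2 t ht).1 (hT.2 t ht).2.1 h
      exact ⟨A, fun _ => hA⟩
    · exact ⟨0, fun h => absurd h ht⟩
  choose A hA using hex
  have hAl : ∀ t ∈ T, ∀ x u : Plane, A t (x + u) + A t (x - u) = 2 * A t x := by
    intro t ht x u
    obtain ⟨k0, k1, k2, hk⟩ := (hA t ht).1
    rw [hk, hk, hk]; simp only [Pi.add_apply, Pi.sub_apply]; ring
  have hAc : ∀ t ∈ T, Continuous (A t) := by
    intro t ht
    obtain ⟨k0, k1, k2, hk⟩ := (hA t ht).1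
    rw [show A t = fun x => k0 + k1 * x 0 + k2 * x 1 from funext hk]
    fun_prop
  set pt : ℝ → Plane := fun τ => p + τ • (q - p) with hpt
  have hptc : Continuous pt := by rw [hpt]; fun_prop
  have hpts : ∀ τ : ℝ, 0 ≤ τ → τ ≤ 1 → pt τ ∈ hull {p, q} := fun τ h0 h1 =>
    mem_hull_pair.2 ⟨τ, h0, h1, rfl⟩
  have hpto : ∀ τ : ℝ, 0 < τ → τ < 1 → pt τ ∈ openSimplex {p, q} := fun τ h0 h1 =>
    (mem_openSimplex_pair hpq).2 ⟨τ, h0, h1, rfl⟩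
  -- the interpolation is nonpositive along the segment
  have hbound : ∀ δ : ℝ, 0 < δ → ∀ t ∈ T, ∀ τ : ℝ, 0 ≤ τ → τ ≤ 1 → pt τ ∈ hull t →
      A t (pt τ) + δ * τ ^ 2 ≤ δ := by
    -- The term `δ * τ ^ 2` makes convexity strict, so that the maximum over the compact segment
    -- cannot be attained inside; at the ends the value is at most `δ`.
    intro δ hδ
    set V : Set ℝ := ⋃ t ∈ T, (fun τ : ℝ => A t (pt τ) + δ * τ ^ 2) ''
      (Icc 0 1 ∩ pt ⁻¹' hull t) with hV
    have hVc : IsCompact V := by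
      refine T.isCompact_biUnion fun t ht => ?_
      refine (isCompact_Icc.inter_right ((isClosed_hull t).preimage hptc)).image ?_
      have := (hAc t ht).comp hptc
      exact this.add (by fun_prop)
    have hVn : V.Nonempty := by
      obtain ⟨t, ht, hx⟩ := hT.1.mem_iff.1 (hR (hpts 0 le_rfl zero_le_one))
      exact ⟨_, mem_biUnion ht ⟨0, ⟨⟨le_rfl, zero_le_one⟩, hx⟩, rfl⟩⟩
    obtain ⟨M, hM, hMax⟩ := hVc.exists_isGreatest hVn
    have hle : ∀ t ∈ T, ∀ τ : ℝ, 0 ≤ τ → τ ≤ 1 → pt τ ∈ hull t → A t (pt τ) + δ * τ ^ 2 ≤ M :=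
      fun t ht τ h0 h1 hx => hMax (mem_biUnion ht ⟨τ, ⟨⟨h0, h1⟩, hx⟩, rfl⟩)
    suffices hMδ : M ≤ δ from fun t ht τ h0 h1 hx => (hle t ht τ h0 h1 hx).trans hMδ
    obtain ⟨t, ht, τ, ⟨⟨h0, h1⟩, hx⟩, hMeq⟩ := mem_iUnion₂.1 hM
    simp only at hMeq
    have hx' : pt τ ∈ hull t := hx
    have hvert : ∀ v ∈ lattice N, v ∈ hull t → A t v = h v := fun v hv hvt =>
      (hA t ht).2 v ((hT.2 t ht).2.mem_of_mem_hull hvt hv)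
    rcases h0.eq_or_lt with rfl | h0
    · have e0 : pt 0 = p := by simp [hpt]
      rw [e0] at hx' hMeq
      rw [hvert p (hs.2.mem_lattice (by simp)) hx', hp0] at hMeq
      rw [← hMeq]; simp only [ne_eq, OfNat.ofNat_ne_zero, not_false_eq_true, zero_pow, mul_zero,
        add_zero]; exact hδ.le
    rcases h1.eq_or_lt with rfl | h1
    · have e0 : pt 1 = q := by simp [hpt]
      rw [e0] at hx' hMeq
      rw [hvert q (hs.2.mem_lattice (by simp)) hx', hq0] at hMeq
      rw [← hMeq]; simp
    exfalso
    have hxo := hpto τ h0 h1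
    -- a two-sided comparison contradicts maximality
    have hfin : ∀ (σ : ℝ), σ ≠ 0 → ∀ t' ∈ T,
        (∀ᶠ ε in 𝓝[>] (0 : ℝ), pt τ + ε • (σ • (q - p)) ∈ hull t) →
        (∀ᶠ ε in 𝓝[>] (0 : ℝ), pt τ + ε • ((-σ) • (q - p)) ∈ hull t') →
        (∀ y ∈ hull t', A t y ≤ A t' y) → False := by
      intro σ hσ t' ht' ev1 ev2 hcmp
      have ev3 : ∀ᶠ ε in 𝓝[>] (0 : ℝ), 0 ≤ τ + ε * σ ∧ τ + ε * σ ≤ 1 := by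
        have : ContinuousAt (fun ε : ℝ => τ + ε * σ) 0 := by fun_prop
        have h2 := this.eventually (Ioo_mem_nhds (a := 0) (b := 1) (by simpa using h0)
          (by simpa using h1))
        filter_upwards [h2.filter_mono nhdsWithin_le_nhds] with ε he using ⟨he.1.le, he.2.le⟩
      have ev4 : ∀ᶠ ε in 𝓝[>] (0 : ℝ), 0 ≤ τ - ε * σ ∧ τ - ε * σ ≤ 1 := by
        have : ContinuousAt (fun ε : ℝ => τ - ε * σ) 0 := by fun_prop
        have h2 := this.eventually (Ioo_mem_nhds (a := 0) (b := 1) (by simpa using h0)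
          (by simpa using h1))
        filter_upwards [h2.filter_mono nhdsWithin_le_nhds] with ε he using ⟨he.1.le, he.2.le⟩
      obtain ⟨ε, ⟨⟨hε1, hε2⟩, hε3, hε4⟩, hε0⟩ :=
        ((ev1.and ev2).and (ev3.and ev4)).and self_mem_nhdsWithin |>.exists
      have hεpos : (0 : ℝ) < ε := hε0
      have q1 : pt τ + ε • (σ • (q - p)) = pt (τ + ε * σ) := by simp only [hpt]; module
      have q2 : pt τ + ε • ((-σ) • (q - p)) = pt (τ - ε * σ) := by simp only [hpt]; module
      have r1 := hle t ht (τ + ε * σ) hε3.1 hε3.2 (q1 ▸ hε1)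
      have r2 := hle t' ht' (τ - ε * σ) hε4.1 hε4.2 (q2 ▸ hε2)
      have r3 := hcmp _ hε2
      have r4 := hAl t ht (pt τ) (ε • (σ • (q - p)))
      have q2' : pt τ - ε • (σ • (q - p)) = pt (τ - ε * σ) := by simp only [hpt]; module
      rw [q1, q2'] at r4
      rw [q2] at r3
      have : 0 < δ * (ε * σ) ^ 2 := by positivity
      nlinarith
    obtain ⟨f, hft, hfn, hxf⟩ := exists_face hx'
    have hfc : f.card ≤ 3 := (hT.2 t ht).1 ▸ Finset.card_le_card hft
    have hfp := hfn.card_pos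
    have hfcases : f.card = 1 ∨ f.card = 2 ∨ f.card = 3 := by omega
    rcases hfcases with hc | hc | hc
    · obtain ⟨v, rfl⟩ := Finset.card_eq_one.1 hc
      rw [openSimplex_singleton] at hxf
      have hxv : pt τ = v := hxf
      exact hnoz v ((hT.2 t ht).2.mem_lattice (Finset.singleton_subset_iff.1 hft)) (hxv ▸ hxo)
    · obtain ⟨b, c, hbc, rfl⟩ := exists_pair hc
      have hfedge : {b, c} ∈ edges T := mem_edges.2 ⟨t, ht, hft, hc⟩
      have hne : ({b, c} : Finset Plane) ≠ {p, q} := fun he => hedge (he ▸ hfedge)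
      have hfE : ({b, c} : Finset Plane) ∉ E := by
        intro hf
        rcases hE _ hf with h | h
        · exact hne h
        · exact disjoint_left.1 h hxf hxo
      have hcr : cross (c - b) (q - p) ≠ 0 := fun h0 =>
        hne (IsMinimalEdge.eq_of_parallel (hT.isMinimalEdge hfedge) hs hxf
          (openSimplex_subset_hull _ hxo) h0)
      obtain ⟨a, rfl, hD⟩ := exists_third (hT.2 t ht).1 (hT.2 t ht).2.1 hbc hft
      -- The sign of `σ` is chosen so that the step along `σ • (q - p)` enters `t`; the opposite
      -- step leads into a neighbouring tile `t'`.
      set σ := cross (c - b) (q - p) * signedArea a b c with hσdef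
      have hσ0 : σ ≠ 0 := mul_ne_zero hcr hD
      have hcσ : ∀ r : ℝ, cross (c - b) (r • (q - p)) = r * cross (c - b) (q - p) := by
        intro r; simp only [cross, Pi.smul_apply, smul_eq_mul]; ring
      have hpos : 0 < cross (c - b) (σ • (q - p)) / signedArea a b c := by
        have : cross (c - b) (σ • (q - p)) / signedArea a b c = cross (c - b) (q - p) ^ 2 := by
          rw [hcσ, hσdef, div_eq_iff hD]; ring
        rw [this]; positivity
      have ev1 := (eventually_mem_triangle hD hxf hpos).mono fun ε hε =>
        openSimplex_subset_hull _ hε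
      have evR : ∀ᶠ ε in 𝓝[>] (0 : ℝ), pt τ + ε • ((-σ) • (q - p)) ∈ R :=
        (eventually_mem_pair hpq hxo (-σ)).mono fun ε hε => hR (openSimplex_subset_hull _ hε)
      obtain ⟨t', ht', hxt', ev2⟩ := exists_common_tile hT.1 evR
      obtain ⟨f', hft', -, hxf'⟩ := exists_face hxt'
      have hff : f' = {b, c} := hT.face_eq ht' ht hft' hft hxf' hxf
      rw [hff] at hft'
      obtain ⟨e, rfl, hD'⟩ := exists_third (hT.2 t' ht').1 (hT.2 t' ht').2.1 hbc hft'
      -- If `t'` were on the same side of `b c` as `t`, the step along `-σ` would leave it.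
      have hsign : signedArea a b c * signedArea e b c < 0 := by
        by_contra hcon
        have hpos' : 0 < signedArea a b c * signedArea e b c :=
          lt_of_le_of_ne (not_lt.1 hcon) (mul_ne_zero hD hD').symm
        have hneg : cross (c - b) ((-σ) • (q - p)) / signedArea e b c < 0 := by
          have : cross (c - b) ((-σ) • (q - p)) / signedArea e b c =
              -(cross (c - b) (q - p) ^ 2 * (signedArea a b c * signedArea e b c) /
                signedArea e b c ^ 2) := by
            rw [hcσ, hσdef]; field_simp
          rw [this, neg_lt_zero]; positivity
        obtain ⟨ε, hε, hε0⟩ := (ev2.and self_mem_nhdsWithin).exists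
        exact notMem_triangle hD' hxf hneg hε0 hε
      obtain ⟨κ, hκ, hκh⟩ := hlc a b c e ht ht' hfE hsign
      refine hfin σ hσ0 _ ht' ev1 ev2 fun y hy => ?_
      obtain ⟨hea, hec, -⟩ := ne_of_signedArea_ne_zero hD'
      obtain ⟨w, hw, hw1, rfl⟩ := mem_hull_iff.1 hy
      rw [affine_sum (hA _ ht).1 _ _ hw1, affine_sum (hA _ ht').1 _ _ hw1, sum_triple hea hec hbc,
        sum_triple hea hec hbc, (hA _ ht).2 b (by simp), (hA _ ht).2 c (by simp),
        (hA _ ht').2 b (by simp), (hA _ ht').2 c (by simp), (hA _ ht').2 e (by simp)]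
      -- The two interpolations agree at `b` and `c`. Continuing the one on `t` affinely to `e` by
      -- the relation `a + e = (2 - κ) b + κ c` shows that it is at most `h e` there, hence is below
      -- the other on all of `t'`.
      have hAe : A {a, b, c} e = (2 - κ) * h b + κ * h c - h a := by
        obtain ⟨k0, k1, k2, hk⟩ := (hA _ ht).1
        rw [← (hA _ ht).2 a (by simp), ← (hA _ ht).2 b (by simp), ← (hA _ ht).2 c (by simp)]
        have g0 := congrFun hκ 0
        have g1 := congrFun hκ 1
        simp only [Pi.add_apply, Pi.smul_apply, smul_eq_mul] at g0 g1
        simp only [hk]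
        linear_combination k1 * g0 + k2 * g1
      have hwe := hw e (by simp)
      have : w e * A {a, b, c} e ≤ w e * h e := mul_le_mul_of_nonneg_left (by rw [hAe]; linarith) hwe
      linarith
    · obtain rfl := Finset.eq_of_subset_of_card_le hft (by rw [(hT.2 t ht).1, hc])
      have hopen : ∀ σ : ℝ, ∀ᶠ ε in 𝓝[>] (0 : ℝ), pt τ + ε • (σ • (q - p)) ∈ hull f := by
        intro σ
        have : ContinuousAt (fun ε : ℝ => pt τ + ε • (σ • (q - p))) 0 := by fun_prop
        have h2 := this.eventually ((isOpen_openSimplex hc (hT.2 f ht).2.1).mem_nhds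
          (by simpa using hxf))
        exact (h2.filter_mono nhdsWithin_le_nhds).mono fun ε hε => openSimplex_subset_hull _ hε
      exact hfin 1 one_ne_zero f ht (hopen 1) (hopen (-1)) fun y _ => le_rfl
  have hm := hpto (1 / 2) (by norm_num) (by norm_num)
  obtain ⟨t, ht, hmt⟩ := hT.1.mem_iff.1 (hR (openSimplex_subset_hull _ hm))
  -- Let `δ` tend to zero.
  have hle0 : A t (pt (1 / 2)) ≤ 0 := by
    refine le_of_forall_pos_le_add fun δ hδ => ?_
    have := hbound δ hδ t ht (1 / 2) (by norm_num) (by norm_num) hmt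
    nlinarith
  obtain ⟨f, hft, hfn, hmf⟩ := exists_face hmt
  have hfl : ∀ v ∈ f, v ∈ lattice N := fun v hv => (hT.2 t ht).2.mem_lattice (hft hv)
  have hmf' := hmf
  obtain ⟨w, hw, hw1, hwm⟩ := hmf'
  rw [← hwm, affine_sum (hA t ht).1 _ _ hw1] at hle0
  have hterm : ∀ v ∈ f, 0 ≤ w v * A t v := fun v hv => by
    rw [(hA t ht).2 v (hft hv)]
    exact mul_nonneg (hw v hv).le (hnn v (hfl v hv))
  have hsum0 : ∑ v ∈ f, w v * A t v = 0 := le_antisymm hle0 (Finset.sum_nonneg hterm)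
  have hfsub : f ⊆ {p, q} := by
    intro v hv
    have h1 := (Finset.sum_eq_zero_iff_of_nonneg hterm).1 hsum0 v hv
    rw [(hA t ht).2 v (hft hv)] at h1
    have h2 := (mul_eq_zero.1 h1).resolve_left (hw v hv).ne'
    rcases hzero v (hfl v hv) h2 with rfl | rfl <;> simp
  have hfeq : f = {p, q} := hs.2.1.face_eq hfsub Finset.Subset.rfl hmf hm
  exact hedge (mem_edges.2 ⟨t, ht, hfeq ▸ hft, hs.1⟩)

/-- `T'` arises from `T` by exchanging the diagonal of a parallelogram. -/
def FlipRel (T T' : Finset (Finset Plane)) : Prop := ∃ a b c e, IsFlip T T' a b c e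

/-- As long as some diagonal outside `E` is higher than the opposite one, flip it. Only the flipped
diagonal is lost, so `E` stays among the edges, and the total height of all triangle vertices
strictly decreases. -/
theorem exists_insert_edge {N : ℕ} (hN : 0 < N) {R : Set Plane} {p q : Plane}
    (hs : IsMinimalEdge N {p, q}) (hR : hull {p, q} ⊆ R) {E : Finset (Finset Plane)}
    (hE : ∀ f ∈ E, f = {p, q} ∨ Disjoint (openSimplex f) (openSimplex {p, q}))
    {T : Finset (Finset Plane)} (hT : IsTiling N R T) (hET : E ⊆ edges T) :
    ∃ T', Relation.ReflTransGen FlipRel T T' ∧ IsTiling N R T' ∧ E ⊆ edges T' ∧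
      {p, q} ∈ edges T' := by
  obtain ⟨h, hconv, hnat, hp0, hq0, hzero⟩ := exists_height hN hs
  -- The floor turns the heights, which are natural numbers at lattice points, into a measure for
  -- the descent.
  have hfl : ∀ x ∈ lattice N, h x = (⌊h x⌋₊ : ℝ) := by
    intro x hx
    obtain ⟨n, hn⟩ := hnat x hx
    rw [hn, Nat.floor_natCast]
  obtain ⟨n, hn⟩ : ∃ n, ∑ t ∈ T, ∑ v ∈ t, ⌊h v⌋₊ = n := ⟨_, rfl⟩
  induction n using Nat.strong_induction_on generalizing T with
  | _ n ih =>
  by_cases hno : ∀ a b c e T', IsFlip T T' a b c e → {b, c} ∉ E → h b + h c ≤ h a + h e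
  · exact ⟨T, .refl, hT, hET, mem_edges_of_locallyConvex hT hs hR hE
      (fun x hx => by rw [hfl x hx]; positivity) hp0 hq0 hzero
      (locallyConvex_of_no_flip hN hT hconv hno)⟩
  · push Not at hno
    obtain ⟨a, b, c, e, T', hflip, hbcE, hlt⟩ := hno
    obtain ⟨hT', S, hS1, hS2, hS3, hS4, hS5, hS6⟩ := hflip.decomp hN hT
    have hmin := hT.2 _ hflip.2.1
    have hmin' := hT.2 _ hflip.2.2.1
    obtain ⟨hab, hac, hbc, hbe, hce, hae⟩ := parallelogram_ne hflip.1 hmin.signedArea_ne_zero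
    have hlt' : ⌊h a⌋₊ + ⌊h e⌋₊ < ⌊h b⌋₊ + ⌊h c⌋₊ := by
      rw [hfl a (hmin.2.mem_lattice (by simp)), hfl b (hmin.2.mem_lattice (by simp)),
        hfl c (hmin.2.mem_lattice (by simp)), hfl e (hmin'.2.mem_lattice (by simp))] at hlt
      exact_mod_cast hlt
    -- The old pair counts `b` and `c` twice and `a` and `e` once, the new pair the other way round.
    have hdec : ∑ t ∈ T', ∑ v ∈ t, ⌊h v⌋₊ < n := by
      rw [← hn, hS4, hS1, Finset.sum_insert hS5, Finset.sum_insert hS6, Finset.sum_insert hS2,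
        Finset.sum_insert hS3, sum_triple hab hae hbe, sum_triple hac hae hce,
        sum_triple hab hac hbc, sum_triple hbc hbe hce]
      omega
    have hET' : E ⊆ edges T' := fun f hf =>
      hflip.edges_subset (hET hf) fun he => hbcE (he ▸ hf)
    obtain ⟨T'', h1, h2, h3, h4⟩ := ih _ hdec hT' hET' rfl
    exact ⟨T'', .head ⟨a, b, c, e, hflip⟩ h1, h2, h3, h4⟩

/-- Any family of pairwise noncrossing minimal segments can be forced into a tiling by flips. -/
theorem exists_insert_edges {N : ℕ} (hN : 0 < N) {R : Set Plane} {T : Finset (Finset Plane)}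
    (hT : IsTiling N R T) (S : Finset (Finset Plane)) (hS : ∀ s ∈ S, IsMinimalEdge N s)
    (hR : ∀ s ∈ S, hull s ⊆ R)
    (hdis : ∀ s ∈ S, ∀ s' ∈ S, s = s' ∨ Disjoint (openSimplex s) (openSimplex s')) :
    ∃ T', Relation.ReflTransGen FlipRel T T' ∧ IsTiling N R T' ∧ S ⊆ edges T' := by
  induction S using Finset.induction_on with
  | empty => exact ⟨T, .refl, hT, by simp⟩
  | insert s S hsS ih =>
    obtain ⟨T', h1, h2, h3⟩ := ih (fun x hx => hS x (Finset.mem_insert_of_mem hx))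
      (fun x hx => hR x (Finset.mem_insert_of_mem hx))
      (fun x hx y hy => hdis x (Finset.mem_insert_of_mem hx) y (Finset.mem_insert_of_mem hy))
    have hsm := hS s (Finset.mem_insert_self _ _)
    obtain ⟨p, q, hpq, rfl⟩ := exists_pair hsm.1
    obtain ⟨T'', g1, g2, g3, g4⟩ := exists_insert_edge hN hsm (hR _ (Finset.mem_insert_self _ _))
      (fun f hf => hdis f (Finset.mem_insert_of_mem hf) _ (Finset.mem_insert_self _ _)) h2 h3
    exact ⟨T'', h1.trans g1, g2, Finset.insert_subset g4 g3⟩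

/-! ### Flip connectivity -/

theorem IsTiling.disjoint_hull_edge {N : ℕ} {R : Set Plane} {T : Finset (Finset Plane)}
    (hT : IsTiling N R T) {t e : Finset Plane} (ht : t ∈ T) (he : e ∈ edges T) :
    Disjoint (openSimplex t) (hull e) := by
  rw [disjoint_left]
  intro x hx hxe
  obtain ⟨t', ht', het', hc⟩ := mem_edges.1 he
  obtain ⟨f, hf, hfn, hxf⟩ := exists_face hxe
  have := hT.face_eq ht ht' Finset.Subset.rfl (hf.trans het') hx hxf
  have h1 := Finset.card_le_card hf
  have h2 := (hT.2 t ht).1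
  rw [← this, hc] at h1
  omega

theorem subset_of_preconnected_of_frontier {s R : Set Plane} (hs : IsPreconnected s)
    (h : ∀ x ∈ s, x ∉ frontier R) (hm : (s ∩ R).Nonempty) : s ⊆ R := by
  intro x hx
  by_contra hxR
  have hcov : s ⊆ interior R ∪ (closure R)ᶜ := by
    intro y hy
    by_cases hyc : y ∈ closure R
    · left
      by_contra hyi
      exact h y hy ⟨hyc, hyi⟩
    · exact Or.inr hyc
  obtain ⟨y, hy, hyR⟩ := hm
  obtain ⟨z, -, hz1, hz2⟩ := hs _ _ isOpen_interior isClosed_closure.isOpen_compl hcov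
    ⟨y, hy, (hcov hy).resolve_right fun h => h (subset_closure hyR)⟩
    ⟨x, hx, (hcov hx).resolve_left fun h => hxR (interior_subset h)⟩
  exact hz2 (subset_closure (interior_subset hz1))

theorem openSimplex_subset_of_frontier {t : Finset Plane} {R : Set Plane}
    (h : ∀ x ∈ openSimplex t, x ∉ frontier R) (hm : (openSimplex t ∩ R).Nonempty) :
    openSimplex t ⊆ R :=
  subset_of_preconnected_of_frontier (isPreconnected_openSimplex t) h hm

theorem hull_subset_of_openSimplex_subset {t : Finset Plane} (hn : t.Nonempty) {R : Set Plane}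
    (hR : IsClosed R) (h : openSimplex t ⊆ R) : hull t ⊆ R :=
  (hull_subset_closure hn).trans (closure_minimal h hR)

/-- An open triangle of `T` avoids the edges of `T'`, as these are edges of `T`. So it lies within a
single triangle `t'`, and its three vertices, being lattice points of `t'`, are the vertices of
`t'`. -/
theorem IsTiling.eq_of_edges_subset {N : ℕ} {R : Set Plane} {T T' : Finset (Finset Plane)}
    (hT : IsTiling N R T) (hT' : IsTiling N R T') (h : edges T' ⊆ edges T) : T = T' := by
  have key : ∀ t ∈ T, ∀ t' ∈ T', (openSimplex t ∩ openSimplex t').Nonempty → t = t' := by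
    intro t ht t' ht' hm
    have m := hT.2 t ht
    have m' := hT'.2 t' ht'
    have hsub : openSimplex t ⊆ hull t' := by
      refine openSimplex_subset_of_frontier (fun x hx hxf => ?_)
        (hm.mono (inter_subset_inter_right _ (openSimplex_subset_hull t')))
      obtain ⟨e, he, hc, hxe⟩ := frontier_hull_subset m'.1 m'.2.1 hxf
      exact disjoint_left.1 (hT.disjoint_hull_edge ht (h (mem_edges.2 ⟨t', ht', he, hc⟩))) hx hxe
    have hsub' := hull_subset_of_openSimplex_subset m.2.1.1 (isClosed_hull t') hsub
    refine Finset.eq_of_subset_of_card_le (fun v hv => ?_) (by rw [m.1, m'.1])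
    exact m'.2.mem_of_mem_hull (hsub' (mem_hull_of_mem hv)) (m.2.mem_lattice hv)
  have meets : ∀ {A B : Finset (Finset Plane)}, IsTiling N R A → IsTiling N R B → ∀ t ∈ A,
      ∃ t' ∈ B, (openSimplex t ∩ openSimplex t').Nonempty := by
    intro A B hA hB t ht
    obtain ⟨x, hx⟩ := openSimplex_nonempty (hA.2 t ht).2.1.1
    obtain ⟨t', ht', hx'⟩ := hB.1.mem_iff.1
      (hA.1.mem_iff.2 ⟨t, ht, openSimplex_subset_hull _ hx⟩)
    exact ⟨t', ht', meets_openSimplex (isOpen_openSimplex (hA.2 t ht).1 (hA.2 t ht).2.1) hx' hx⟩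
  ext t
  constructor
  · intro ht
    obtain ⟨t', ht', hm⟩ := meets hT hT' t ht
    exact key t ht t' ht' hm ▸ ht'
  · intro ht
    obtain ⟨t', ht', hm⟩ := meets hT' hT t ht
    exact key t' ht' t ht (by rwa [inter_comm]) ▸ ht'

theorem IsTiling.hull_subset {N : ℕ} {R : Set Plane} {T : Finset (Finset Plane)}
    (hT : IsTiling N R T) {t : Finset Plane} (ht : t ∈ T) : hull t ⊆ R := by
  rw [← hT.1.2.2]; exact subset_biUnion_of_mem (u := fun t => hull t) ht

theorem IsTiling.edges_eq_or_disjoint {N : ℕ} {R : Set Plane} {T : Finset (Finset Plane)}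
    (hT : IsTiling N R T) {e e' : Finset Plane} (he : e ∈ edges T) (he' : e' ∈ edges T) :
    e = e' ∨ Disjoint (openSimplex e) (openSimplex e') := by
  obtain ⟨t, ht, het, -⟩ := mem_edges.1 he
  obtain ⟨t', ht', het', -⟩ := mem_edges.1 he'
  by_cases hd : Disjoint (openSimplex e) (openSimplex e')
  · exact Or.inr hd
  · obtain ⟨x, hx, hx'⟩ := not_disjoint_iff.1 hd
    exact Or.inl (hT.face_eq ht ht' het het' hx hx')

/-- Any two minimal tilings of the same region are connected by flips. -/
theorem flip_connected {N : ℕ} (hN : 0 < N) {R : Set Plane} {T T' : Finset (Finset Plane)}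
    (hT : IsTiling N R T) (hT' : IsTiling N R T') : Relation.ReflTransGen FlipRel T T' := by
  obtain ⟨T'', h1, h2, h3⟩ := exists_insert_edges hN hT (edges T') (fun s hs => hT'.isMinimalEdge hs)
    (fun s hs => by
      obtain ⟨t, ht, hst, -⟩ := mem_edges.1 hs
      exact (hull_mono hst).trans (hT'.hull_subset ht))
    (fun s hs s' hs' => hT'.edges_eq_or_disjoint hs hs')
  rwa [h2.eq_of_edges_subset hT' h3] at h1

theorem pseudoFlip_of_flip {N : ℕ} (hN : 0 < N) {R : Set Plane} {T T' : Finset (Finset Plane)}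
    (hT : IsTiling N R T) (h : FlipRel T T') : IsTiling N R T' ∧
      PseudoFlip N (T.val.map (triangleWeight N)) (T'.val.map (triangleWeight N)) := by
  obtain ⟨a, b, c, e, h⟩ := h
  obtain ⟨hT', S, h1, h2, h3, h4, h5, h6⟩ := h.decomp hN hT
  refine ⟨hT', a, b, c, e, h.1, hT.2 _ h.2.1, hT.2 _ h.2.2.1, S.val.map (triangleWeight N), ?_, ?_⟩
  · rw [h1, Finset.insert_val_of_notMem h2, Finset.insert_val_of_notMem h3]
    simp [Multiset.insert_eq_cons]
  · rw [h4, Finset.insert_val_of_notMem h5, Finset.insert_val_of_notMem h6]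
    simp [Multiset.insert_eq_cons]

theorem pseudoFlips_of_tilings {N : ℕ} (hN : 0 < N) {R : Set Plane} {T T' : Finset (Finset Plane)}
    (hT : IsTiling N R T) (hT' : IsTiling N R T') : Relation.ReflTransGen (PseudoFlip N)
      (T.val.map (triangleWeight N)) (T'.val.map (triangleWeight N)) := by
  have h := flip_connected hN hT hT'
  clear hT'
  induction h using Relation.ReflTransGen.head_induction_on with
  | refl => exact .refl
  | head h _ ih =>
    obtain ⟨h1, h2⟩ := pseudoFlip_of_flip hN hT h
    exact .head h2 (ih h1)

/-! ### Existence of minimal tilings -/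

/-- A lattice point. -/
def latticePoint (N : ℕ) (i j : ℤ) : Plane := ![i / N, j / N]

/-- Half of a lattice square: the right triangle with corner `(i, j)` and legs in direction `ε`. -/
def halfSquare (N : ℕ) (i j ε : ℤ) : Finset Plane :=
  {latticePoint N i j, latticePoint N (i + ε) j, latticePoint N i (j + ε)}

theorem latticePoint_mem {N : ℕ} (hN : 0 < N) (i j : ℤ) : latticePoint N i j ∈ lattice N := by
  have hN' : (N : ℝ) ≠ 0 := by positivity
  refine (mem_lattice_iff hN).2 ⟨i, j, ?_, ?_⟩ <;> simp [latticePoint] <;> field_simp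

theorem signedArea_halfSquare {N : ℕ} (i j : ℤ) {ε : ℤ} (hε : ε * ε = 1) :
    signedArea (latticePoint N i j) (latticePoint N (i + ε) j) (latticePoint N i (j + ε)) =
      1 / (N : ℝ) ^ 2 := by
  have : (ε : ℝ) * ε = 1 := by exact_mod_cast hε
  simp only [signedArea, latticePoint, Matrix.cons_val_zero, Matrix.cons_val_one]
  push_cast
  ring_nf
  rw [sq (ε : ℝ), this, one_mul]

theorem halfSquare_coords {N : ℕ} (hN : 0 < N) (i j : ℤ) {ε : ℤ} (hε : ε * ε = 1) (x : Plane) :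
    (x ∈ hull (halfSquare N i j ε) ↔
      0 ≤ ε * (N * x 0 - i) ∧ 0 ≤ ε * (N * x 1 - j) ∧
        ε * (N * x 0 - i) + ε * (N * x 1 - j) ≤ 1) ∧
    (x ∈ openSimplex (halfSquare N i j ε) ↔
      0 < ε * (N * x 0 - i) ∧ 0 < ε * (N * x 1 - j) ∧
        ε * (N * x 0 - i) + ε * (N * x 1 - j) < 1) := by
  have hN' : (N : ℝ) ≠ 0 := by positivity
  have hε' : (ε : ℝ) * ε = 1 := by exact_mod_cast hε
  have hA := signedArea_halfSquare (N := N) i j hε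
  have hD : signedArea (latticePoint N i j) (latticePoint N (i + ε) j)
      (latticePoint N i (j + ε)) ≠ 0 := by rw [hA]; positivity
  have e1 : signedArea x (latticePoint N (i + ε) j) (latticePoint N i (j + ε)) /
      signedArea (latticePoint N i j) (latticePoint N (i + ε) j) (latticePoint N i (j + ε)) =
      1 - (ε * (N * x 0 - i) + ε * (N * x 1 - j)) := by
    rw [hA, div_eq_iff (by positivity)]
    simp only [signedArea, latticePoint, Matrix.cons_val_zero, Matrix.cons_val_one]
    push_cast
    field_simp
    linear_combination hε'
  have e2 : signedArea (latticePoint N i j) x (latticePoint N i (j + ε)) /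
      signedArea (latticePoint N i j) (latticePoint N (i + ε) j) (latticePoint N i (j + ε)) =
      ε * (N * x 0 - i) := by
    rw [hA, div_eq_iff (by positivity)]
    simp only [signedArea, latticePoint, Matrix.cons_val_zero, Matrix.cons_val_one]
    push_cast
    field_simp
    ring
  have e3 : signedArea (latticePoint N i j) (latticePoint N (i + ε) j) x /
      signedArea (latticePoint N i j) (latticePoint N (i + ε) j) (latticePoint N i (j + ε)) =
      ε * (N * x 1 - j) := by
    rw [hA, div_eq_iff (by positivity)]
    simp only [signedArea, latticePoint, Matrix.cons_val_zero, Matrix.cons_val_one]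
    push_cast
    field_simp
    ring
  constructor
  · rw [halfSquare, mem_hull_iff_signedArea hD, e1, e2, e3, sub_nonneg]; tauto
  · rw [halfSquare, mem_openSimplex_iff_signedArea hD, e1, e2, e3, sub_pos]; tauto

/-- The square with corners `(±K / N, ±K / N)`. -/
def box (N : ℕ) (K : ℕ) : Set Plane :=
  {x | ∀ i, -(K : ℝ) ≤ N * x i ∧ N * x i ≤ K}

/-- The standard tiling of a box. -/
def boxTiles (N K : ℕ) : Finset (Finset Plane) :=
  (Finset.Ico (-K : ℤ) K ×ˢ Finset.Ico (-K : ℤ) K).image (fun p => halfSquare N p.1 p.2 1) ∪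
  (Finset.Ico (-K : ℤ) K ×ˢ Finset.Ico (-K : ℤ) K).image
    (fun p => halfSquare N (p.1 + 1) (p.2 + 1) (-1))

theorem mem_boxTiles {N K : ℕ} {t : Finset Plane} : t ∈ boxTiles N K ↔ ∃ i j : ℤ,
    (-(K : ℤ) ≤ i ∧ i < K) ∧ (-(K : ℤ) ≤ j ∧ j < K) ∧
      (t = halfSquare N i j 1 ∨ t = halfSquare N (i + 1) (j + 1) (-1)) := by
  simp only [boxTiles, Finset.mem_union, Finset.mem_image, Finset.mem_product, Finset.mem_Ico,
    Prod.exists]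
  constructor
  · rintro (⟨i, j, ⟨h1, h2⟩, rfl⟩ | ⟨i, j, ⟨h1, h2⟩, rfl⟩)
    · exact ⟨i, j, h1, h2, Or.inl rfl⟩
    · exact ⟨i, j, h1, h2, Or.inr rfl⟩
  · rintro ⟨i, j, h1, h2, rfl | rfl⟩
    · exact Or.inl ⟨i, j, ⟨h1, h2⟩, rfl⟩
    · exact Or.inr ⟨i, j, ⟨h1, h2⟩, rfl⟩

theorem exists_cell {K : ℕ} (hK : 0 < K) {y : ℝ} (h0 : -(K : ℝ) ≤ y) (h1 : y ≤ K) :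
    ∃ i : ℤ, (-(K : ℤ) ≤ i ∧ i < K) ∧ (i : ℝ) ≤ y ∧ y ≤ i + 1 := by
  rcases h1.eq_or_lt with rfl | h1
  -- The right end of the interval belongs to the last cell, which the floor would miss by one.
  · exact ⟨K - 1, by omega, by push_cast; linarith, by push_cast; linarith⟩
  · refine ⟨⌊y⌋, ⟨?_, ?_⟩, Int.floor_le y, (Int.lt_floor_add_one y).le⟩
    · rw [Int.le_floor]; push_cast; exact h0
    · rw [Int.floor_lt]; exact_mod_cast h1

theorem isTiling_box {N K : ℕ} (hN : 0 < N) (hK : 0 < K) :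
    IsTiling N (box N K) (boxTiles N K) := by
  have hN' : (N : ℝ) ≠ 0 := by positivity
  have hmin : ∀ i j ε : ℤ, ε * ε = 1 → IsMinimalTriangle N (halfSquare N i j ε) := by
    intro i j ε hε
    refine isMinimalTriangle_of_signedArea hN (latticePoint_mem hN _ _) (latticePoint_mem hN _ _)
      (latticePoint_mem hN _ _) (Or.inl ?_)
    rw [signedArea_halfSquare i j hε]; field_simp
  have hm : ∀ t ∈ boxTiles N K, IsMinimalTriangle N t := by
    intro t ht
    obtain ⟨i, j, -, -, rfl | rfl⟩ := mem_boxTiles.1 ht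
    · exact hmin _ _ _ rfl
    · exact hmin _ _ _ rfl
  -- The floors of the scaled coordinates and the side of the antidiagonal recover the tile from any
  -- of its interior points.
  have hlow : ∀ (i j : ℤ) (x : Plane), x ∈ openSimplex (halfSquare N i j 1) →
      ⌊N * x 0⌋ = i ∧ ⌊N * x 1⌋ = j ∧ N * x 0 + N * x 1 < i + j + 1 := by
    intro i j x hx
    obtain ⟨h0, h1, h2⟩ := ((halfSquare_coords hN i j (ε := 1) rfl x).2).1 hx
    push_cast at h0 h1 h2
    refine ⟨Int.floor_eq_iff.2 ⟨by linarith, by linarith⟩,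
      Int.floor_eq_iff.2 ⟨by linarith, by linarith⟩, by linarith⟩
  have hup : ∀ (i j : ℤ) (x : Plane), x ∈ openSimplex (halfSquare N (i + 1) (j + 1) (-1)) →
      ⌊N * x 0⌋ = i ∧ ⌊N * x 1⌋ = j ∧ i + j + 1 < N * x 0 + N * x 1 := by
    intro i j x hx
    obtain ⟨h0, h1, h2⟩ := ((halfSquare_coords hN (i + 1) (j + 1) (ε := -1) rfl x).2).1 hx
    push_cast at h0 h1 h2
    refine ⟨Int.floor_eq_iff.2 ⟨by linarith, by linarith⟩,
      Int.floor_eq_iff.2 ⟨by linarith, by linarith⟩, by linarith⟩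
  refine ⟨⟨fun t ht => ⟨(hm t ht).1, (hm t ht).2.1⟩, ?_, ?_⟩, hm⟩
  · intro t ht t' ht' hne
    obtain ⟨i, j, -, -, h⟩ := mem_boxTiles.1 ht
    obtain ⟨i', j', -, -, h'⟩ := mem_boxTiles.1 ht'
    change Disjoint (openSimplex t) (openSimplex t')
    rw [disjoint_left]
    intro x hx hx'
    apply hne
    rcases h with rfl | rfl <;> rcases h' with rfl | rfl
    · obtain ⟨rfl, rfl, -⟩ := hlow _ _ _ hx
      obtain ⟨e1, e2, -⟩ := hlow _ _ _ hx'
      rw [e1, e2]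
    · obtain ⟨rfl, rfl, h3⟩ := hlow _ _ _ hx
      obtain ⟨e1, e2, h4⟩ := hup _ _ _ hx'
      rw [e1, e2] at h3; linarith
    · obtain ⟨rfl, rfl, h3⟩ := hup _ _ _ hx
      obtain ⟨e1, e2, h4⟩ := hlow _ _ _ hx'
      rw [e1, e2] at h3; linarith
    · obtain ⟨rfl, rfl, -⟩ := hup _ _ _ hx
      obtain ⟨e1, e2, -⟩ := hup _ _ _ hx'
      rw [e1, e2]
  · ext x
    simp only [mem_iUnion₂, exists_prop]
    constructor
    · rintro ⟨t, ht, hx⟩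
      obtain ⟨i, j, ⟨hi0, hi1⟩, ⟨hj0, hj1⟩, rfl | rfl⟩ := mem_boxTiles.1 ht
      · obtain ⟨h0, h1, h2⟩ := ((halfSquare_coords hN i j (ε := 1) rfl x).1).1 hx
        push_cast at h0 h1 h2
        have hi0' : -(K : ℝ) ≤ i := by exact_mod_cast hi0
        have hi1' : (i : ℝ) + 1 ≤ K := by exact_mod_cast hi1
        have hj0' : -(K : ℝ) ≤ j := by exact_mod_cast hj0
        have hj1' : (j : ℝ) + 1 ≤ K := by exact_mod_cast hj1
        exact Fin.forall_fin_two.2 ⟨⟨by linarith, by linarith⟩, by linarith, by linarith⟩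
      · obtain ⟨h0, h1, h2⟩ := ((halfSquare_coords hN (i + 1) (j + 1) (ε := -1) rfl x).1).1 hx
        push_cast at h0 h1 h2
        have hi0' : -(K : ℝ) ≤ i := by exact_mod_cast hi0
        have hi1' : (i : ℝ) + 1 ≤ K := by exact_mod_cast hi1
        have hj0' : -(K : ℝ) ≤ j := by exact_mod_cast hj0
        have hj1' : (j : ℝ) + 1 ≤ K := by exact_mod_cast hj1
        exact Fin.forall_fin_two.2 ⟨⟨by linarith, by linarith⟩, by linarith, by linarith⟩
    · intro hx
      obtain ⟨i, hi, hi0, hi1⟩ := exists_cell hK (hx 0).1 (hx 0).2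
      obtain ⟨j, hj, hj0, hj1⟩ := exists_cell hK (hx 1).1 (hx 1).2
      rcases le_total (N * x 0 + N * x 1) (i + j + 1) with h | h
      · refine ⟨_, mem_boxTiles.2 ⟨i, j, hi, hj, Or.inl rfl⟩,
          ((halfSquare_coords hN i j (ε := 1) rfl x).1).2 ?_⟩
        push_cast
        exact ⟨by linarith, by linarith, by linarith⟩
      · refine ⟨_, mem_boxTiles.2 ⟨i, j, hi, hj, Or.inr rfl⟩,
          ((halfSquare_coords hN (i + 1) (j + 1) (ε := -1) rfl x).1).2 ?_⟩
        push_cast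
        exact ⟨by linarith, by linarith, by linarith⟩

theorem exists_box {N : ℕ} (hN : 0 < N) {B : Set Plane} (hB : Bornology.IsBounded B) :
    ∃ K : ℕ, 0 < K ∧ B ⊆ box N K := by
  obtain ⟨C, hC⟩ := hB.exists_norm_le
  obtain ⟨K, hK⟩ := exists_nat_gt (N * C)
  refine ⟨K + 1, by omega, fun x hx i => ?_⟩
  have h1 : |x i| ≤ C := (Real.norm_eq_abs (x i) ▸ norm_le_pi_norm x i).trans (hC x hx)
  have hNr : (0 : ℝ) < N := by exact_mod_cast hN
  have h2 : N * |x i| ≤ N * C := mul_le_mul_of_nonneg_left h1 hNr.le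
  have h3 : |N * x i| ≤ (K + 1 : ℕ) := by
    rw [abs_mul, abs_of_pos hNr]; push_cast; linarith
  exact abs_le.1 h3

/-- The tiles of `T` contained in `R`. -/
def tilesIn (T : Finset (Finset Plane)) (R : Set Plane) : Finset (Finset Plane) :=
  open scoped Classical in T.filter fun t => hull t ⊆ R

theorem mem_tilesIn {T : Finset (Finset Plane)} {R : Set Plane} {t : Finset Plane} :
    t ∈ tilesIn T R ↔ t ∈ T ∧ hull t ⊆ R := by
  classical
  rw [tilesIn, Finset.mem_filter]

/-- Open tiles avoid edges and hence the frontier of `R`, so a tile that meets the interior of `R`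
lies in `R`. These tiles cover the interior, which is dense in `R`. -/
theorem IsTiling.restrict {N : ℕ} {Ω R : Set Plane} {T : Finset (Finset Plane)}
    (hT : IsTiling N Ω T) (hR : R ⊆ Ω) (hcl : IsClosed R) (hreg : R ⊆ closure (interior R))
    (hfr : ∀ x ∈ frontier R, ∃ e ∈ edges T, x ∈ hull e) : IsTiling N R (tilesIn T R) := by
  refine ⟨⟨fun t ht => hT.1.1 t (mem_tilesIn.1 ht).1,
    hT.1.2.1.subset fun t ht => (mem_tilesIn.1 ht).1, Subset.antisymm ?_ ?_⟩,
    fun t ht => hT.2 t (mem_tilesIn.1 ht).1⟩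
  · exact iUnion₂_subset fun t ht => (mem_tilesIn.1 ht).2
  · refine hreg.trans (closure_minimal ?_ ?_)
    · intro x hx
      obtain ⟨t, ht, hxt⟩ := hT.1.mem_iff.1 (hR (interior_subset hx))
      obtain ⟨y, hy, hyt⟩ := meets_openSimplex isOpen_interior hxt hx
      refine mem_biUnion (mem_tilesIn.2 ⟨ht, ?_⟩) hxt
      refine hull_subset_of_openSimplex_subset (hT.2 t ht).2.1.1 hcl
        (openSimplex_subset_of_frontier (fun z hz hzf => ?_) ⟨y, hyt, interior_subset hy⟩)
      obtain ⟨e, he, hze⟩ := hfr z hzf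
      exact disjoint_left.1 (hT.disjoint_hull_edge ht he) hz hze
    · exact (tilesIn T R).finite_toSet.isClosed_biUnion fun t _ => isClosed_hull t

/-! ### Subdividing segments -/

theorem finite_lattice_inter {N : ℕ} (hN : 0 < N) {B : Set Plane} (hB : Bornology.IsBounded B) :
    (lattice N ∩ B).Finite := by
  obtain ⟨K, -, hK⟩ := exists_box hN hB
  have hN' : (N : ℝ) ≠ 0 := by positivity
  refine (((Finset.Icc (-K : ℤ) K) ×ˢ (Finset.Icc (-K : ℤ) K)).image
    fun p => latticePoint N p.1 p.2).finite_toSet.subset ?_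
  rintro x ⟨hx, hxB⟩
  obtain ⟨m, n, hm, hn⟩ := (mem_lattice_iff hN).1 hx
  have h0 := hK hxB 0
  have h1 := hK hxB 1
  rw [hm] at h0
  rw [hn] at h1
  rw [Finset.mem_coe, Finset.mem_image]
  refine ⟨(m, n), ?_, ?_⟩
  · simp only [Finset.mem_product, Finset.mem_Icc]
    exact ⟨⟨by exact_mod_cast h0.1, by exact_mod_cast h0.2⟩, by exact_mod_cast h1.1,
      by exact_mod_cast h1.2⟩
  · apply plane_ext
    · change (m : ℝ) / N = x 0; rw [← hm]; field_simp
    · change (n : ℝ) / N = x 1; rw [← hn]; field_simp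

theorem finite_minimalEdges {N : ℕ} (hN : 0 < N) {B : Set Plane} (hB : Bornology.IsBounded B) :
    {e : Finset Plane | IsMinimalEdge N e ∧ hull e ⊆ B}.Finite := by
  have hF := finite_lattice_inter hN hB
  refine (hF.toFinset.powerset.finite_toSet).subset ?_
  rintro e ⟨he, heB⟩
  rw [Finset.mem_coe, Finset.mem_powerset]
  intro p hp
  rw [hF.mem_toFinset]
  exact ⟨he.2.mem_lattice hp, heB (mem_hull_of_mem hp)⟩

/-- All directions in `e` are parallel to all directions in `e'`. -/
def Par (e e' : Finset Plane) : Prop :=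
  ∀ p ∈ e, ∀ q ∈ e, ∀ u ∈ e', ∀ v ∈ e', cross (q - p) (v - u) = 0

theorem par_pair {p q u v : Plane} (h : cross (q - p) (v - u) = 0) : Par {p, q} {u, v} := by
  have h' : (q 0 - p 0) * (v 1 - u 1) - (q 1 - p 1) * (v 0 - u 0) = 0 := h
  intro a ha b hb c hc d hd
  simp only [Finset.mem_insert, Finset.mem_singleton] at ha hb hc hd
  simp only [cross, Pi.sub_apply]
  rcases ha with rfl | rfl <;> rcases hb with rfl | rfl <;> rcases hc with rfl | rfl <;>
    rcases hd with rfl | rfl <;> linarith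

theorem par_self {e : Finset Plane} (h : e.card = 2) : Par e e := by
  obtain ⟨p, q, -, rfl⟩ := exists_pair h
  exact par_pair (by simp only [cross]; ring)

theorem par_of_subset_hull {e f e' f' : Finset Plane} (he : e.card = 2) (he' : e'.card = 2)
    (h : Par e e') (hf : hull f ⊆ hull e) (hf' : hull f' ⊆ hull e') : Par f f' := by
  obtain ⟨p, q, -, rfl⟩ := exists_pair he
  obtain ⟨u, v, -, rfl⟩ := exists_pair he'
  have h0 := h p (by simp) q (by simp) u (by simp) v (by simp)
  intro a ha b hb c hc d hd
  obtain ⟨r, -, -, rfl⟩ := mem_hull_pair.1 (hf (mem_hull_of_mem ha))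
  obtain ⟨s, -, -, rfl⟩ := mem_hull_pair.1 (hf (mem_hull_of_mem hb))
  obtain ⟨r', -, -, rfl⟩ := mem_hull_pair.1 (hf' (mem_hull_of_mem hc))
  obtain ⟨s', -, -, rfl⟩ := mem_hull_pair.1 (hf' (mem_hull_of_mem hd))
  have : cross (p + s • (q - p) - (p + r • (q - p))) (u + s' • (v - u) - (u + r' • (v - u))) =
      (s - r) * (s' - r') * cross (q - p) (v - u) := by
    simp only [cross, Pi.add_apply, Pi.sub_apply, Pi.smul_apply, smul_eq_mul]; ring
  rw [this, h0, mul_zero]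

theorem par_of_two_points {e e' : Finset Plane} (he : e.card = 2) (he' : e'.card = 2) {x y : Plane}
    (hxy : x ≠ y) (hx : x ∈ hull e) (hy : y ∈ hull e) (hx' : x ∈ hull e') (hy' : y ∈ hull e') :
    Par e e' := by
  obtain ⟨p, q, -, rfl⟩ := exists_pair he
  obtain ⟨u, v, -, rfl⟩ := exists_pair he'
  exact par_pair (cross_eq_zero_of_two_points hxy hx hy hx' hy')

theorem IsMinimalEdge.eq_of_par {N : ℕ} {e e' : Finset Plane} (h : IsMinimalEdge N e)
    (h' : IsMinimalEdge N e') {x : Plane} (hx : x ∈ openSimplex e) (hx' : x ∈ hull e')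
    (hpar : Par e e') : e = e' := by
  obtain ⟨p, q, -, rfl⟩ := exists_pair h.1
  obtain ⟨u, v, -, rfl⟩ := exists_pair h'.1
  exact h.eq_of_parallel h' hx hx' (hpar p (by simp) q (by simp) u (by simp) v (by simp))

theorem IsMinimalEdge.subset_of_par {N : ℕ} {e f : Finset Plane} (h : IsMinimalEdge N e)
    (hf : f.card = 2) (hfl : ∀ p ∈ f, p ∈ lattice N) {x : Plane} (hx : x ∈ openSimplex e)
    (hx' : x ∈ hull f) (hpar : Par e f) : openSimplex e ⊆ openSimplex f := by
  obtain ⟨p, q, hpq, rfl⟩ := exists_pair h.1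
  obtain ⟨u, v, huv, rfl⟩ := exists_pair hf
  exact openSimplex_subset_of_parallel hpq h.2 huv (hfl u (by simp)) (hfl v (by simp)) hx hx'
    (hpar p (by simp) q (by simp) u (by simp) v (by simp))

theorem hull_pair_subset {u v a b : Plane} (ha : a ∈ hull {u, v}) (hb : b ∈ hull {u, v}) :
    hull {a, b} ⊆ hull {u, v} := by
  refine convexHull_min ?_ (convex_convexHull ℝ _)
  intro z hz
  simp only [Finset.coe_insert, Finset.coe_singleton, mem_insert_iff, mem_singleton_iff] at hz
  rcases hz with rfl | rfl <;> assumption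

/-- Every point of a lattice segment lies in a minimal subsegment. -/
theorem exists_minimal_subsegment {N : ℕ} (hN : 0 < N) {u v x : Plane} (huv : u ≠ v)
    (hu : u ∈ lattice N) (hv : v ∈ lattice N) (hx : x ∈ hull {u, v}) :
    ∃ e : Finset Plane, IsMinimalEdge N e ∧ hull e ⊆ hull {u, v} ∧ x ∈ hull e := by
  classical
  have hF := finite_lattice_inter hN (isCompact_hull {u, v}).isBounded
  set F := hF.toFinset with hFdef
  have hFm : ∀ z, z ∈ F ↔ z ∈ lattice N ∧ z ∈ hull {u, v} := fun z => by
    rw [hFdef, hF.mem_toFinset]; rfl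
  -- Among all pairs of lattice points of the segment with `x` between them, take one at least
  -- distance. A further lattice point between `a` and `b` would give a closer pair around `x`.
  obtain ⟨⟨a, b⟩, hab, hmin⟩ := ((F ×ˢ F).filter fun z => z.1 ≠ z.2 ∧ x ∈ hull {z.1, z.2})
    |>.exists_min_image (fun z => dist z.1 z.2) ⟨(u, v), by
      simp only [Finset.mem_filter, Finset.mem_product, hFm]
      exact ⟨⟨⟨hu, mem_hull_of_mem (by simp)⟩, hv, mem_hull_of_mem (by simp)⟩, huv, hx⟩⟩
  simp only [Finset.mem_filter, Finset.mem_product, hFm] at hab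
  obtain ⟨⟨⟨hal, ha⟩, hbl, hb⟩, hne, hxab⟩ := hab
  have hsub := hull_pair_subset ha hb
  have hdist : 0 < dist a b := dist_pos.2 hne
  refine ⟨{a, b}, ⟨Finset.card_pair hne, isSimplex_pair hne, Subset.antisymm ?_ ?_⟩, hsub, hxab⟩
  · rintro c ⟨hc, hcl⟩
    by_contra hcn
    have hca : c ≠ a := fun h => hcn (by rw [h]; simp)
    have hcb : c ≠ b := fun h => hcn (by rw [h]; simp)
    obtain ⟨r, hr0, hr1, rfl⟩ := mem_hull_pair.1 hc
    have hr0' : 0 < r := lt_of_le_of_ne hr0 fun h => hca (by rw [← h]; simp)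
    have hr1' : r < 1 := lt_of_le_of_ne hr1 fun h => hcb (by rw [h]; simp)
    obtain ⟨s, hs0, hs1, rfl⟩ := mem_hull_pair.1 hxab
    rcases le_total s r with hle | hle
    · have h1 := hmin (a, a + r • (b - a)) (by
        simp only [Finset.mem_filter, Finset.mem_product, hFm]
        refine ⟨⟨⟨hal, ha⟩, hcl, hsub hc⟩, hca.symm, mem_hull_pair.2 ⟨s / r, div_nonneg hs0 hr0,
          (div_le_one hr0').2 hle, ?_⟩⟩
        rw [add_sub_cancel_left, smul_smul, div_mul_cancel₀ _ hr0'.ne'])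
      simp only [dist_self_add_right, norm_smul, Real.norm_eq_abs, abs_of_pos hr0'] at h1
      rw [dist_comm, dist_eq_norm] at h1 hdist
      nlinarith
    · have h1 := hmin (a + r • (b - a), b) (by
        simp only [Finset.mem_filter, Finset.mem_product, hFm]
        refine ⟨⟨⟨hcl, hsub hc⟩, hbl, hb⟩, hcb, mem_hull_pair.2 ⟨(s - r) / (1 - r),
          div_nonneg (by linarith) (by linarith), (div_le_one (by linarith)).2 (by linarith), ?_⟩⟩
        have hr : (1 - r) ≠ 0 := by linarith
        have : b - (a + r • (b - a)) = (1 - r) • (b - a) := by module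
        rw [this, smul_smul, div_mul_cancel₀ _ hr]; module)
      have e1 : dist (a + r • (b - a)) b = (1 - r) * dist a b := by
        rw [dist_eq_norm, dist_comm, dist_eq_norm]
        have : a + r • (b - a) - b = -((1 - r) • (b - a)) := by module
        rw [this, norm_neg, norm_smul, Real.norm_eq_abs, abs_of_pos (by linarith)]
      simp only [e1] at h1
      nlinarith
  · intro z hz
    refine ⟨mem_hull_of_mem hz, ?_⟩
    simp only [Finset.coe_insert, Finset.coe_singleton, mem_insert_iff, mem_singleton_iff] at hz
    rcases hz with rfl | rfl <;> assumption

/-- A tiling of a large region that contains given pairwise noncrossing minimal segments. -/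
theorem exists_tiling_containing {N : ℕ} (hN : 0 < N) (S : Finset (Finset Plane))
    (hS : ∀ s ∈ S, IsMinimalEdge N s)
    (hdis : ∀ s ∈ S, ∀ s' ∈ S, s = s' ∨ Disjoint (openSimplex s) (openSimplex s'))
    {B : Set Plane} (hB : Bornology.IsBounded B) :
    ∃ Ω T, IsTiling N Ω T ∧ B ⊆ Ω ∧ S ⊆ edges T := by
  have hb : Bornology.IsBounded (B ∪ ⋃ s ∈ S, hull s) :=
    hB.union ((Bornology.isBounded_biUnion S.finite_toSet).2 fun s _ => (isCompact_hull s).isBounded)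
  obtain ⟨K, hK, hsub⟩ := exists_box hN hb
  obtain ⟨T, -, hT, hST⟩ := exists_insert_edges hN (isTiling_box hN hK) S hS
    (fun s hs => (subset_biUnion_of_mem (u := fun s => hull s) hs).trans
      (subset_union_right.trans hsub)) hdis
  exact ⟨_, T, hT, subset_union_left.trans hsub, hST⟩

/-- The segments of `L` are lattice segments that cross in lattice points only. -/
def LatticeSegments (N : ℕ) (L : Finset (Finset Plane)) : Prop :=
  (∀ f ∈ L, f.card = 2 ∧ ∀ p ∈ f, p ∈ lattice N) ∧
    ∀ f ∈ L, ∀ f' ∈ L, Par f f' ∨ ∀ x ∈ hull f, x ∈ hull f' → x ∈ lattice N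

/-- The minimal pieces of the segments do not cross: overlapping parallel ones coincide, and
nonparallel ones meet in lattice points only, which are never inside a minimal segment. So all of
them can be forced into one tiling. -/
theorem exists_tiling_of_segments {N : ℕ} (hN : 0 < N) {L : Finset (Finset Plane)}
    (hL : LatticeSegments N L) {B : Set Plane} (hB : Bornology.IsBounded B) :
    ∃ Ω T, IsTiling N Ω T ∧ B ⊆ Ω ∧ ∀ f ∈ L, ∀ x ∈ hull f, ∃ e ∈ edges T, x ∈ hull e := by
  have hb : Bornology.IsBounded (⋃ f ∈ L, hull f) :=
    (Bornology.isBounded_biUnion L.finite_toSet).2 fun s _ => (isCompact_hull s).isBounded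
  have hfin : {e : Finset Plane | IsMinimalEdge N e ∧ ∃ f ∈ L, hull e ⊆ hull f}.Finite := by
    refine (finite_minimalEdges hN hb).subset ?_
    rintro e ⟨he, f, hf, hef⟩
    exact ⟨he, hef.trans (subset_biUnion_of_mem (u := fun f => hull f) hf)⟩
  obtain ⟨Ω, T, hT, hBΩ, hS⟩ := exists_tiling_containing hN hfin.toFinset
    (fun s hs => (hfin.mem_toFinset.1 hs).1) (by
      intro s hs s' hs'
      obtain ⟨h1, f, hf, hsf⟩ := hfin.mem_toFinset.1 hs
      obtain ⟨h1', f', hf', hsf'⟩ := hfin.mem_toFinset.1 hs'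
      by_cases hd : Disjoint (openSimplex s) (openSimplex s')
      · exact Or.inr hd
      left
      obtain ⟨x, hx, hx'⟩ := not_disjoint_iff.1 hd
      rcases hL.2 f hf f' hf' with hp | hp
      · exact h1.eq_of_par h1' hx (openSimplex_subset_hull _ hx')
          (par_of_subset_hull (hL.1 f hf).1 (hL.1 f' hf').1 hp hsf hsf')
      · exact absurd hx (h1.2.notMem_openSimplex h1.1.ge (hp x (hsf (openSimplex_subset_hull _ hx))
          (hsf' (openSimplex_subset_hull _ hx'))))) hB
  refine ⟨Ω, T, hT, hBΩ, fun f hf x hx => ?_⟩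
  obtain ⟨hc, hl⟩ := hL.1 f hf
  obtain ⟨u, v, huv, rfl⟩ := exists_pair hc
  obtain ⟨e, he, hef, hxe⟩ := exists_minimal_subsegment hN huv (hl u (by simp)) (hl v (by simp)) hx
  exact ⟨e, hS (hfin.mem_toFinset.2 ⟨he, _, hf, hef⟩), hxe⟩

theorem hull_subset_closure_interior {t : Finset Plane} (hc : t.card = 3) (hs : IsSimplex t) :
    hull t ⊆ closure (interior (hull t)) :=
  (hull_subset_closure hs.1).trans (closure_mono (openSimplex_subset_interior hc hs))

theorem IsTiling.restrict_triangle {N : ℕ} {Ω : Set Plane} {T L : Finset (Finset Plane)}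
    (hT : IsTiling N Ω T) (hL : ∀ f ∈ L, ∀ x ∈ hull f, ∃ e ∈ edges T, x ∈ hull e)
    {t : Finset Plane} (hc : t.card = 3) (hs : IsSimplex t) (ht : hull t ⊆ Ω)
    (htL : ∀ e ⊆ t, e.card = 2 → e ∈ L) : IsTiling N (hull t) (tilesIn T (hull t)) := by
  refine hT.restrict ht (isClosed_hull t) (hull_subset_closure_interior hc hs) fun x hx => ?_
  obtain ⟨e, he, hec, hxe⟩ := frontier_hull_subset hc hs hx
  exact hL e (htL e he hec) x hxe

/-- A triangle with lattice vertices has a minimal tiling. -/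
theorem exists_tiling_triangle {N : ℕ} (hN : 0 < N) {t : Finset Plane} (hc : t.card = 3)
    (hs : IsSimplex t) (hl : ∀ p ∈ t, p ∈ lattice N) : ∃ T, IsTiling N (hull t) T := by
  have hL : LatticeSegments N (t.powersetCard 2) := by
    refine ⟨fun f hf => ?_, fun f hf f' hf' => ?_⟩
    · rw [Finset.mem_powersetCard] at hf
      exact ⟨hf.2, fun p hp => hl p (hf.1 hp)⟩
    · rw [Finset.mem_powersetCard] at hf hf'
      by_cases hff : f = f'
      · left; rw [← hff]; exact par_self hf.2
      right
      intro x hx hx'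
      obtain ⟨g, hg, hgn, hxg⟩ := exists_face hx
      have hg' := hs.face_weights (hg.trans hf.1) hf'.1 hxg hx'
      have h1 : g.card ≠ 2 := fun h => hff ((Finset.eq_of_subset_of_card_le hg (by omega)).symm.trans
        (Finset.eq_of_subset_of_card_le hg' (by omega)))
      have h2 := Finset.card_le_card hg
      have h3 := hgn.card_pos
      obtain ⟨v, rfl⟩ := Finset.card_eq_one.1 (show g.card = 1 by omega)
      rw [openSimplex_singleton] at hxg
      rw [show x = v from hxg]
      exact hl v (hf.1 (Finset.singleton_subset_iff.1 hg))
  obtain ⟨Ω, T, hT, hsub, hcov⟩ := exists_tiling_of_segments hN hL (isCompact_hull t).isBounded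
  exact ⟨_, hT.restrict_triangle hcov hc hs hsub fun e he hec =>
    Finset.mem_powersetCard.2 ⟨he, hec⟩⟩

/-! ### Rational points -/

theorem exists_level_of_rational {x : Plane} (h : ∀ i, ∃ q : ℚ, x i = q) :
    ∃ n : ℕ, 0 < n ∧ x ∈ lattice n := by
  obtain ⟨r, hr⟩ := h 0
  obtain ⟨s, hs⟩ := h 1
  refine ⟨r.den * s.den, Nat.mul_pos r.pos s.pos, (mem_lattice_iff (Nat.mul_pos r.pos s.pos)).2
    ⟨r.num * s.den, s.num * r.den, ?_, ?_⟩⟩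
  · rw [hr]
    have := Rat.mul_den_eq_num r
    have h2 : (r : ℝ) * r.den = r.num := by exact_mod_cast this
    push_cast; rw [← h2]; ring
  · rw [hs]
    have := Rat.mul_den_eq_num s
    have h2 : (s : ℝ) * s.den = s.num := by exact_mod_cast this
    push_cast; rw [← h2]; ring

theorem rational_of_mem_lattice {N : ℕ} {x : Plane} (h : x ∈ lattice N) (i : Fin 2) :
    ∃ q : ℚ, x i = q := by
  obtain ⟨n, hn⟩ := h i
  exact ⟨n / N, by rw [hn]; push_cast; rfl⟩

/-- Each condition holds at all multiples of some level; the product of these levels serves for all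
of them. -/
theorem exists_common_level {ι : Type*} (s : Finset ι) (P : ι → ℕ → Prop)
    (h : ∀ i ∈ s, ∃ n : ℕ, 0 < n ∧ ∀ N, 0 < N → n ∣ N → P i N) :
    ∃ n : ℕ, 0 < n ∧ ∀ N, 0 < N → n ∣ N → ∀ i ∈ s, P i N := by
  choose! f hf hP using h
  refine ⟨∏ i ∈ s, f i, Finset.prod_pos hf, fun N hN hd i hi => hP i hi N hN ?_⟩
  exact (Finset.dvd_prod_of_mem f hi).trans hd

theorem exists_level_of_isRational {s : Finset Plane} (h : IsRational s) :
    ∃ n : ℕ, 0 < n ∧ ∀ N, 0 < N → n ∣ N → ∀ p ∈ s, p ∈ lattice N := by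
  refine exists_common_level s (fun p N => p ∈ lattice N) fun p hp => ?_
  obtain ⟨n, hn, hx⟩ := exists_level_of_rational (h p hp)
  exact ⟨n, hn, fun N hN hd => lattice_mono hN hd hx⟩

/-- Two nonparallel segments have at most one common point, and Cramer's rule shows that it is
rational. -/
theorem exists_crossing_level {f f' : Finset Plane} (hc : f.card = 2) (hc' : f'.card = 2)
    (hr : IsRational f) (hr' : IsRational f') : ∃ n : ℕ, 0 < n ∧ ∀ N, 0 < N → n ∣ N →
      (Par f f' ∨ ∀ x ∈ hull f, x ∈ hull f' → x ∈ lattice N) := by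
  by_cases hp : Par f f'
  · exact ⟨1, one_pos, fun _ _ _ => Or.inl hp⟩
  by_cases hx : ∃ x, x ∈ hull f ∧ x ∈ hull f'
  · obtain ⟨x, hx, hx'⟩ := hx
    have hrat : ∀ i, ∃ q : ℚ, x i = q := by
      obtain ⟨p, q, -, rfl⟩ := exists_pair hc
      obtain ⟨u, v, -, rfl⟩ := exists_pair hc'
      have hcr : cross (q - p) (v - u) ≠ 0 := fun h => hp (par_pair h)
      obtain ⟨r, -, -, e⟩ := mem_hull_pair.1 hx
      obtain ⟨s, -, -, e'⟩ := mem_hull_pair.1 hx'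
      have hrr : r = cross (u - p) (v - u) / cross (q - p) (v - u) := by
        rw [eq_div_iff hcr]
        have g0 := congrFun (e.symm.trans e') 0
        have g1 := congrFun (e.symm.trans e') 1
        simp only [Pi.add_apply, Pi.smul_apply, Pi.sub_apply, smul_eq_mul] at g0 g1
        simp only [cross, Pi.sub_apply]
        linear_combination (v 1 - u 1) * g0 - (v 0 - u 0) * g1
      choose P hP using hr p (by simp)
      choose Q hQ using hr q (by simp)
      choose U hU using hr' u (by simp)
      choose V hV using hr' v (by simp)
      intro i
      refine ⟨P i + ((U 0 - P 0) * (V 1 - U 1) - (U 1 - P 1) * (V 0 - U 0)) /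
        ((Q 0 - P 0) * (V 1 - U 1) - (Q 1 - P 1) * (V 0 - U 0)) * (Q i - P i), ?_⟩
      rw [e, hrr]
      simp only [cross, Pi.add_apply, Pi.smul_apply, Pi.sub_apply, smul_eq_mul, hP, hQ, hU, hV]
      push_cast; rfl
    obtain ⟨n, hn, hxn⟩ := exists_level_of_rational hrat
    refine ⟨n, hn, fun N hN hd => Or.inr fun y hy hy' => ?_⟩
    by_cases hxy : x = y
    · rw [← hxy]; exact lattice_mono hN hd hxn
    · exact absurd (par_of_two_points hc hc' hxy hx hy hx' hy') hp
  · exact ⟨1, one_pos, fun _ _ _ => Or.inr fun x h1 h2 => absurd ⟨x, h1, h2⟩ hx⟩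

theorem exists_segments_level {L : Finset (Finset Plane)}
    (hL : ∀ f ∈ L, f.card = 2 ∧ IsRational f) :
    ∃ n : ℕ, 0 < n ∧ ∀ N, 0 < N → n ∣ N → LatticeSegments N L := by
  obtain ⟨n, hn, h1⟩ := exists_common_level L (fun f N => ∀ p ∈ f, p ∈ lattice N)
    fun f hf => exists_level_of_isRational (hL f hf).2
  obtain ⟨m, hm, h2⟩ := exists_common_level (L ×ˢ L)
    (fun z N => Par z.1 z.2 ∨ ∀ x ∈ hull z.1, x ∈ hull z.2 → x ∈ lattice N) fun z hz => by
      rw [Finset.mem_product] at hz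
      exact exists_crossing_level (hL _ hz.1).1 (hL _ hz.2).1 (hL _ hz.1).2 (hL _ hz.2).2
  refine ⟨n * m, Nat.mul_pos hn hm, fun N hN hd => ⟨fun f hf => ⟨(hL f hf).1, ?_⟩, ?_⟩⟩
  · exact h1 N hN ((Dvd.intro _ rfl).trans hd) f hf
  · intro f hf f' hf'
    exact h2 N hN ((Dvd.intro_left _ rfl).trans hd) (f, f') (Finset.mem_product.2 ⟨hf, hf'⟩)

/-! ### Scissors congruence of multisets of triangles -/

/-- Rational nondegenerate triangles. -/
def IsRatTriangle (t : Finset Plane) : Prop := t.card = 3 ∧ IsSimplex t ∧ IsRational t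

theorem IsMinimalTriangle.isRatTriangle {N : ℕ} {t : Finset Plane} (h : IsMinimalTriangle N t) :
    IsRatTriangle t :=
  ⟨h.1, h.2.1, fun _ hp => rational_of_mem_lattice (h.2.mem_lattice hp)⟩

/-- `X` is the multiset of triangles of a rational dissection of the triangle `t`. -/
def TriangleCut (t : Finset Plane) (X : Multiset (Finset Plane)) : Prop :=
  ∃ T : Finset (Finset Plane), T.val = X ∧ IsDissection (hull t) T ∧ ∀ x ∈ T, IsRatTriangle x

/-- `B` arises from `A` by dissecting each triangle. -/
def Cut (A B : Multiset (Finset Plane)) : Prop :=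
  ∃ C : Multiset (Multiset (Finset Plane)), Multiset.Rel TriangleCut A C ∧ C.join = B

theorem cut_zero_left {B : Multiset (Finset Plane)} : Cut 0 B ↔ B = 0 := by
  constructor
  · rintro ⟨C, hC, rfl⟩
    rw [Multiset.rel_zero_left] at hC
    rw [hC]; rfl
  · rintro rfl
    exact ⟨0, Multiset.Rel.zero, rfl⟩

theorem cut_cons_left {t : Finset Plane} {A B : Multiset (Finset Plane)} :
    Cut (t ::ₘ A) B ↔ ∃ X B', TriangleCut t X ∧ Cut A B' ∧ B = X + B' := by
  constructor
  · rintro ⟨C, hC, rfl⟩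
    obtain ⟨X, C', h1, h2, rfl⟩ := Multiset.rel_cons_left.1 hC
    exact ⟨X, C'.join, h1, ⟨C', h2, rfl⟩, Multiset.join_cons _ _⟩
  · rintro ⟨X, B', h1, ⟨C', h2, rfl⟩, rfl⟩
    exact ⟨X ::ₘ C', Multiset.Rel.cons h1 h2, Multiset.join_cons _ _⟩

theorem Cut.add {A A' B B' : Multiset (Finset Plane)} (h : Cut A A') (h' : Cut B B') :
    Cut (A + B) (A' + B') := by
  induction A using Multiset.induction_on generalizing A' with
  | empty => rw [cut_zero_left.1 h, zero_add, zero_add]; exact h'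
  | cons t A ih =>
    obtain ⟨X, A'', h1, h2, rfl⟩ := cut_cons_left.1 h
    rw [Multiset.cons_add, add_assoc]
    exact cut_cons_left.2 ⟨X, _, h1, ih h2, rfl⟩

theorem Cut.of_add {A B C : Multiset (Finset Plane)} (h : Cut (A + B) C) :
    ∃ C₁ C₂, Cut A C₁ ∧ Cut B C₂ ∧ C = C₁ + C₂ := by
  induction A using Multiset.induction_on generalizing C with
  | empty => exact ⟨0, C, cut_zero_left.2 rfl, by rwa [zero_add] at h, (zero_add C).symm⟩
  | cons t A ih =>
    rw [Multiset.cons_add] at h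
    obtain ⟨X, C', h1, h2, rfl⟩ := cut_cons_left.1 h
    obtain ⟨C₁, C₂, h3, h4, rfl⟩ := ih h2
    exact ⟨X + C₁, C₂, cut_cons_left.2 ⟨X, C₁, h1, h3, rfl⟩, h4, (add_assoc _ _ _).symm⟩

theorem Cut.isRatTriangle {A B : Multiset (Finset Plane)} (h : Cut A B) :
    ∀ t ∈ B, IsRatTriangle t := by
  induction A using Multiset.induction_on generalizing B with
  | empty => rw [cut_zero_left.1 h]; simp
  | cons s A ih =>
    obtain ⟨X, B', ⟨T, rfl, -, hT⟩, h2, rfl⟩ := cut_cons_left.1 h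
    intro t ht
    rcases Multiset.mem_add.1 ht with h | h
    · exact hT t h
    · exact ih h2 t h

theorem Cut.subset {A B : Multiset (Finset Plane)} (h : Cut A B) :
    ∀ x ∈ B, ∃ t ∈ A, hull x ⊆ hull t := by
  induction A using Multiset.induction_on generalizing B with
  | empty => rw [cut_zero_left.1 h]; simp
  | cons s A ih =>
    obtain ⟨X, B', ⟨T, rfl, h1, -⟩, h2, rfl⟩ := cut_cons_left.1 h
    intro x hx
    rcases Multiset.mem_add.1 hx with h | h
    · refine ⟨s, Multiset.mem_cons_self _ _, ?_⟩
      rw [← h1.2.2]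
      exact subset_biUnion_of_mem (u := fun t => hull t) (show x ∈ T from h)
    · obtain ⟨t, ht, hxt⟩ := ih h2 x h
      exact ⟨t, Multiset.mem_cons_of_mem ht, hxt⟩

theorem TriangleCut.refl {t : Finset Plane} (h : IsRatTriangle t) : TriangleCut t {t} :=
  ⟨{t}, rfl, ⟨by simpa using ⟨h.1, h.2.1⟩, by simp, by simp⟩, by simpa using h⟩

theorem Cut.of_fun {A : Multiset (Finset Plane)} {f : Finset Plane → Multiset (Finset Plane)}
    (h : ∀ t ∈ A, TriangleCut t (f t)) : Cut A (A.bind f) := by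
  induction A using Multiset.induction_on with
  | empty => exact cut_zero_left.2 (Multiset.zero_bind f)
  | cons t A ih =>
    rw [Multiset.cons_bind]
    exact cut_cons_left.2 ⟨f t, _, h t (Multiset.mem_cons_self _ _),
      ih fun s hs => h s (Multiset.mem_cons_of_mem hs), rfl⟩

theorem Cut.refl {A : Multiset (Finset Plane)} (h : ∀ t ∈ A, IsRatTriangle t) : Cut A A := by
  have := Cut.of_fun (f := fun t => {t}) fun t ht => TriangleCut.refl (h t ht)
  rwa [Multiset.bind_singleton, Multiset.map_id'] at this

theorem disjoint_openSimplex_of_hull_subset {s t s' t' : Finset Plane}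
    (hs : s.card = 3) (hss : IsSimplex s) (hs' : s'.card = 3) (hss' : IsSimplex s')
    (h : Disjoint (openSimplex t) (openSimplex t')) (hst : hull s ⊆ hull t)
    (hst' : hull s' ⊆ hull t') (ht : t.card = 3) (htt : IsSimplex t) :
    Disjoint (openSimplex s) (openSimplex s') := by
  rw [disjoint_left]
  intro x hx hx'
  obtain ⟨y, ⟨hy1, hy2⟩, hy3⟩ := meets_openSimplex
    ((isOpen_openSimplex hs hss).inter (isOpen_openSimplex hs' hss'))
    (hst (openSimplex_subset_hull _ hx)) ⟨hx, hx'⟩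
  exact notMem_hull_of_disjoint ht htt h hy3 (hst' (openSimplex_subset_hull _ hy2))

/-- Dissecting the triangles of a dissection gives a dissection. -/
theorem IsDissection.glue {R : Set Plane} {T : Finset (Finset Plane)} (hT : IsDissection R T)
    {C : Multiset (Finset Plane)} (hC : Cut T.val C) :
    ∃ S : Finset (Finset Plane), S.val = C ∧ IsDissection R S := by
  classical
  induction T using Finset.induction_on generalizing R C with
  | empty =>
    rw [Finset.empty_val, cut_zero_left] at hC
    exact ⟨∅, hC.symm, hT⟩
  | insert t T htT ih =>
    rw [Finset.insert_val_of_notMem htT] at hC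
    obtain ⟨X, C', ⟨TX, rfl, h1, h1'⟩, h2, rfl⟩ := cut_cons_left.1 hC
    have hT' : IsDissection (⋃ s ∈ T, hull s) T :=
      ⟨fun s hs => hT.1 s (Finset.mem_insert_of_mem hs),
        hT.2.1.subset (Finset.coe_subset.2 (Finset.subset_insert _ _)), rfl⟩
    obtain ⟨S, rfl, hS⟩ := ih hT' h2
    have hdis : ∀ x ∈ TX, ∀ y ∈ S, Disjoint (openSimplex x) (openSimplex y) := by
      intro x hx y hy
      obtain ⟨s, hs, hys⟩ := h2.subset y hy
      have ht' := hT.1 t (Finset.mem_insert_self _ _)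
      refine disjoint_openSimplex_of_hull_subset (h1.1 x hx).1 (h1.1 x hx).2 (hS.1 y hy).1
        (hS.1 y hy).2 (hT.2.1 (Finset.mem_insert_self _ _) (Finset.mem_insert_of_mem hs) ?_) ?_ hys
        ht'.1 ht'.2
      · rintro rfl; exact htT hs
      · rw [← h1.2.2]; exact subset_biUnion_of_mem (u := fun t => hull t) hx
    have hd : Disjoint TX S := by
      rw [Finset.disjoint_left]
      intro x hx hx'
      obtain ⟨y, hy⟩ := openSimplex_nonempty (h1.1 x hx).2.1
      exact disjoint_left.1 (hdis x hx x hx') hy hy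
    refine ⟨TX.disjUnion S hd, by rw [Finset.disjUnion_val], ?_, ?_, ?_⟩
    · intro s hs
      rcases Finset.mem_disjUnion.1 hs with h | h
      · exact h1.1 s h
      · exact hS.1 s h
    · intro x hx y hy hne
      rcases Finset.mem_disjUnion.1 hx with h | h <;> rcases Finset.mem_disjUnion.1 hy with h' | h'
      · exact h1.2.1 h h' hne
      · exact hdis x h y h'
      · exact (hdis y h' x h).symm
      · exact hS.2.1 h h' hne
    · rw [← hT.2.2, Finset.set_biUnion_insert, ← h1.2.2, ← hS.2.2, Finset.disjUnion_eq_union,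
        Finset.set_biUnion_union]

theorem Cut.trans {A B C : Multiset (Finset Plane)} (h : Cut A B) (h' : Cut B C) : Cut A C := by
  induction A using Multiset.induction_on generalizing B C with
  | empty => rw [cut_zero_left] at h; rw [h] at h'; exact h'
  | cons t A ih =>
    obtain ⟨X, B', ⟨T, rfl, h1, -⟩, h2, rfl⟩ := cut_cons_left.1 h
    obtain ⟨C₁, C₂, h3, h4, rfl⟩ := h'.of_add
    obtain ⟨S, rfl, hS⟩ := h1.glue h3
    exact cut_cons_left.2 ⟨S.val, C₂, ⟨S, rfl, hS, h3.isRatTriangle⟩, ih h2 h4, rfl⟩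

/-- The tiles used by a dissection of `R` are determined by `R`: any other tile inside `R` would
overlap one of them. So refinements of different dissections by one tiling coincide. -/
theorem IsDissection.eq_tilesIn {N : ℕ} {Ω R : Set Plane} {T S : Finset (Finset Plane)}
    (hT : IsTiling N Ω T) (hS : IsDissection R S) (hST : S ⊆ T) : S = tilesIn T R := by
  ext t
  rw [mem_tilesIn]
  constructor
  · intro ht
    refine ⟨hST ht, ?_⟩
    rw [← hS.2.2]
    exact subset_biUnion_of_mem (u := fun t => hull t) ht
  · rintro ⟨ht, htR⟩
    have m := hT.2 t ht
    obtain ⟨x, hx⟩ := openSimplex_nonempty m.2.1.1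
    obtain ⟨s, hs, hxs⟩ := hS.mem_iff.1 (htR (openSimplex_subset_hull _ hx))
    rcases hT.1.eq_or_disjoint ht (hST hs) with h | h
    · rwa [h]
    · exact absurd hxs (notMem_hull_of_disjoint m.1 m.2.1 h hx)

/-- Two rational dissections of the same region have a common refinement. -/
theorem exists_common_refinement {R : Set Plane} {X Y : Finset (Finset Plane)}
    (hX : IsDissection R X) (hY : IsDissection R Y) (rX : ∀ t ∈ X, IsRatTriangle t)
    (rY : ∀ t ∈ Y, IsRatTriangle t) :
    ∃ Z : Multiset (Finset Plane), Cut X.val Z ∧ Cut Y.val Z := by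
  classical
  have hrat : ∀ f ∈ edges X ∪ edges Y, f.card = 2 ∧ IsRational f := by
    intro f hf
    rcases Finset.mem_union.1 hf with h | h
    · obtain ⟨t, ht, hft, hc⟩ := mem_edges.1 h
      exact ⟨hc, fun p hp => (rX t ht).2.2 p (hft hp)⟩
    · obtain ⟨t, ht, hft, hc⟩ := mem_edges.1 h
      exact ⟨hc, fun p hp => (rY t ht).2.2 p (hft hp)⟩
  obtain ⟨N, hN, hL⟩ := exists_segments_level hrat
  have hb : Bornology.IsBounded R := by
    rw [← hX.2.2]
    exact (Bornology.isBounded_biUnion X.finite_toSet).2 fun s _ => (isCompact_hull s).isBounded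
  obtain ⟨Ω, T, hT, hsub, hcov⟩ := exists_tiling_of_segments hN (hL N hN dvd_rfl) hb
  -- The tiling `T` contains all edges of `W`, so it restricts to every triangle of `W`. Glued
  -- together, the pieces are the tiles in `R`, independently of `W`.
  have key : ∀ W : Finset (Finset Plane), IsDissection R W → edges W ⊆ edges X ∪ edges Y →
      Cut W.val (tilesIn T R).val := by
    intro W hW hWL
    have hcut : Cut W.val (W.val.bind fun t => (tilesIn T (hull t)).val) := by
      refine Cut.of_fun fun t ht => ?_
      have hd := hT.restrict_triangle hcov (hW.1 t ht).1 (hW.1 t ht).2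
        (by
          refine Subset.trans ?_ hsub
          rw [← hW.2.2]
          exact subset_biUnion_of_mem (u := fun t => hull t) (show t ∈ W from ht))
        (fun e he hc => hWL (mem_edges.2 ⟨t, ht, he, hc⟩))
      exact ⟨_, rfl, hd.1, fun x hx => (hd.2 x hx).isRatTriangle⟩
    obtain ⟨S, hSv, hS⟩ := hW.glue hcut
    have hST : S ⊆ T := by
      intro s hs
      have : s ∈ S.val := hs
      rw [hSv, Multiset.mem_bind] at this
      obtain ⟨t, -, hst⟩ := this
      exact (mem_tilesIn.1 (show s ∈ tilesIn T (hull t) from hst)).1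
    rw [← hS.eq_tilesIn hT hST, hSv]
    exact hcut
  exact ⟨_, key X hX Finset.subset_union_left, key Y hY Finset.subset_union_right⟩

/-- Confluence of cutting: triangle by triangle, two dissections of the same triangle have a common
refinement. -/
theorem Cut.diamond {A B C : Multiset (Finset Plane)} (h : Cut A B) (h' : Cut A C) :
    ∃ D, Cut B D ∧ Cut C D := by
  induction A using Multiset.induction_on generalizing B C with
  | empty =>
    rw [cut_zero_left] at h h'
    exact ⟨0, by rw [h, cut_zero_left], by rw [h', cut_zero_left]⟩
  | cons t A ih =>
    obtain ⟨X, B', ⟨TX, rfl, h1, h1'⟩, h2, rfl⟩ := cut_cons_left.1 h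
    obtain ⟨Y, C', ⟨TY, rfl, h3, h3'⟩, h4, rfl⟩ := cut_cons_left.1 h'
    obtain ⟨D, hD1, hD2⟩ := ih h2 h4
    obtain ⟨Z, hZ1, hZ2⟩ := exists_common_refinement h1 h3 h1' h3'
    exact ⟨Z + D, hZ1.add hD1, hZ2.add hD2⟩

theorem GMap.isRational_image (g : GMap) {s : Finset Plane} (h : IsRational s) :
    IsRational (s.image g.act) := by
  intro p hp
  obtain ⟨q, hq, rfl⟩ := Finset.mem_image.1 hp
  obtain ⟨r, hr⟩ := h q hq 0
  obtain ⟨r', hr'⟩ := h q hq 1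
  refine Fin.forall_fin_two.2 ⟨⟨g.lin.1 0 0 * r + g.lin.1 0 1 * r' + g.trans 0, ?_⟩,
    ⟨g.lin.1 1 0 * r + g.lin.1 1 1 * r' + g.trans 1, ?_⟩⟩
  · rw [GMap.act_zero, hr, hr']; push_cast; rfl
  · rw [GMap.act_one, hr, hr']; push_cast; rfl

theorem GMap.image_injective (g : GMap) :
    Function.Injective fun s : Finset Plane => s.image g.act :=
  Finset.image_injective g.injective

theorem IsDissection.image (g : GMap) {R : Set Plane} {T : Finset (Finset Plane)}
    (h : IsDissection R T) : IsDissection (g.act '' R) (T.image fun s => s.image g.act) := by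
  refine ⟨?_, ?_, ?_⟩
  · intro t ht
    obtain ⟨s, hs, rfl⟩ := Finset.mem_image.1 ht
    exact ⟨(g.card_image s).trans (h.1 s hs).1, g.isSimplex_image (h.1 s hs).2⟩
  · intro t ht t' ht' hne
    obtain ⟨s, hs, rfl⟩ := Finset.mem_image.1 (Finset.mem_coe.1 ht)
    obtain ⟨s', hs', rfl⟩ := Finset.mem_image.1 (Finset.mem_coe.1 ht')
    change Disjoint (openSimplex (s.image g.act)) (openSimplex (s'.image g.act))
    rw [g.openSimplex_image, g.openSimplex_image, disjoint_image_iff g.injective]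
    exact h.2.1 hs hs' fun e => hne (by rw [e])
  · rw [← h.2.2, image_iUnion₂, Finset.set_biUnion_finset_image]
    simp only [g.hull_image]

/-- Two multisets of triangles agree up to `G`-equivalence. -/
abbrev GEq (A B : Multiset (Finset Plane)) : Prop := Multiset.Rel GEquiv A B

theorem GEq.symm {A B : Multiset (Finset Plane)} (h : GEq A B) : GEq B A := by
  rw [GEq, ← Multiset.rel_flip]
  exact h.mono fun a _ b _ hab => hab.symm

theorem GEq.refl (A : Multiset (Finset Plane)) : GEq A A :=
  Multiset.rel_refl_of_refl_on fun a _ => GEquiv.refl a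

theorem GEq.trans {A B C : Multiset (Finset Plane)} (h : GEq A B) (h' : GEq B C) : GEq A C := by
  have : IsTrans (Finset Plane) GEquiv := ⟨fun _ _ _ => GEquiv.trans⟩
  exact Multiset.Rel.trans _ h h'

/-- A dissection of each triangle of `B` is pulled back by the `G`-map that identifies it with its
partner in `A`. -/
theorem Cut.transport {A B B' : Multiset (Finset Plane)} (h : GEq A B) (hB : Cut B B') :
    ∃ A', Cut A A' ∧ GEq A' B' := by
  induction A using Multiset.induction_on generalizing B B' with
  | empty =>
    rw [GEq, Multiset.rel_zero_left] at h
    rw [h, cut_zero_left] at hB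
    exact ⟨0, cut_zero_left.2 rfl, by rw [hB]; exact Multiset.Rel.zero⟩
  | cons t A ih =>
    obtain ⟨s, B₀, hts, hAB, rfl⟩ := Multiset.rel_cons_left.1 h
    obtain ⟨X, B₁, ⟨T, rfl, h1, h1'⟩, h2, rfl⟩ := cut_cons_left.1 hB
    obtain ⟨A', h3, h4⟩ := ih hAB h2
    obtain ⟨g, hg⟩ := hts.symm
    refine ⟨T.val.map (fun x => x.image g.act) + A', cut_cons_left.2 ⟨_, A',
      ⟨T.image fun x => x.image g.act, Finset.image_val_of_injOn g.image_injective.injOn,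
        ?_, ?_⟩, h3, rfl⟩, Multiset.Rel.add ?_ h4⟩
    · rw [← hg, g.hull_image]; exact h1.image g
    · intro x hx
      obtain ⟨y, hy, rfl⟩ := Finset.mem_image.1 hx
      obtain ⟨y1, y2, y3⟩ := h1' y hy
      exact ⟨(g.card_image y).trans y1, g.isSimplex_image y2, g.isRational_image y3⟩
    · rw [Multiset.rel_map_left]
      exact Multiset.rel_refl_of_refl_on fun a _ => GEquiv.symm ⟨g, rfl⟩

/-- Two multisets of triangles are scissors congruent if they can be dissected into `G`-equivalent
triangles. -/
def Scissors (A B : Multiset (Finset Plane)) : Prop :=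
  ∃ A' B', Cut A A' ∧ Cut B B' ∧ GEq A' B'

/-- The two cuts of the middle multiset have a common refinement, which is transported to both
sides. -/
theorem Scissors.trans {A B C : Multiset (Finset Plane)} (h : Scissors A B) (h' : Scissors B C) :
    Scissors A C := by
  obtain ⟨A', B', h1, h2, h3⟩ := h
  obtain ⟨B'', C', h4, h5, h6⟩ := h'
  obtain ⟨D, h7, h8⟩ := h2.diamond h4
  obtain ⟨A'', h9, h10⟩ := h7.transport h3
  obtain ⟨C'', h11, h12⟩ := h8.transport h6.symm
  exact ⟨A'', C'', h1.trans h9, h5.trans h11, h10.trans h12.symm⟩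

theorem Scissors.add {A A' B B' : Multiset (Finset Plane)} (h : Scissors A A')
    (h' : Scissors B B') : Scissors (A + B) (A' + B') := by
  obtain ⟨A₁, A₂, h1, h2, h3⟩ := h
  obtain ⟨B₁, B₂, h4, h5, h6⟩ := h'
  exact ⟨_, _, h1.add h4, h2.add h5, Multiset.Rel.add h3 h6⟩

theorem Scissors.of_gEq {A B : Multiset (Finset Plane)} (hA : ∀ t ∈ A, IsRatTriangle t)
    (hB : ∀ t ∈ B, IsRatTriangle t) (h : GEq A B) : Scissors A B :=
  ⟨A, B, Cut.refl hA, Cut.refl hB, h⟩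

theorem Scissors.of_dissections {R : Set Plane} {X Y : Finset (Finset Plane)}
    (hX : IsDissection R X) (hY : IsDissection R Y) (rX : ∀ t ∈ X, IsRatTriangle t)
    (rY : ∀ t ∈ Y, IsRatTriangle t) : Scissors X.val Y.val := by
  obtain ⟨Z, h1, h2⟩ := exists_common_refinement hX hY rX rY
  exact ⟨Z, Z, h1, h2, GEq.refl Z⟩

/-! ### Weights -/

theorem scaled_eq {N : ℕ} {x : ℝ} {m : ℤ} (h : N * x = m) : scaled N x = m := by
  rw [scaled, h, Int.floor_intCast]

theorem orientedWeight_eq {N : ℕ} {p q : Plane} {p0 p1 q0 q1 : ℤ} (hp0 : N * p 0 = p0)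
    (hp1 : N * p 1 = p1) (hq0 : N * q 0 = q0) (hq1 : N * q 1 = q1) :
    orientedWeight N p q = ((p0 * q1 - q0 * p1 : ℤ) : ZMod N) := by
  rw [orientedWeight, scaled_eq hp0, scaled_eq hp1, scaled_eq hq0, scaled_eq hq1]

theorem orientedWeight_swap (N : ℕ) (p q : Plane) :
    orientedWeight N q p = -orientedWeight N p q := by
  simp only [orientedWeight]
  push_cast; ring

/-- A translation changes the scaled coordinates by multiples of `N`, so modulo `N` only the linear
part acts on the determinant. -/
theorem GMap.orientedWeight (g : GMap) {N : ℕ} (hN : 0 < N) {p q : Plane} (hp : p ∈ lattice N)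
    (hq : q ∈ lattice N) : DiscreteEquidecomp.orientedWeight N (g.act p) (g.act q) =
      (g.det : ZMod N) * DiscreteEquidecomp.orientedWeight N p q := by
  obtain ⟨p0, p1, hp0, hp1⟩ := (DiscreteEquidecomp.mem_lattice_iff hN).1 hp
  obtain ⟨q0, q1, hq0, hq1⟩ := (DiscreteEquidecomp.mem_lattice_iff hN).1 hq
  have key0 : ∀ (x : Plane) (x0 x1 : ℤ), N * x 0 = x0 → N * x 1 = x1 → N * g.act x 0 =
      (g.lin.1 0 0 * x0 + g.lin.1 0 1 * x1 + N * g.trans 0 : ℤ) := by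
    intro x x0 x1 h0 h1
    rw [GMap.act_zero]; push_cast; rw [← h0, ← h1]; ring
  have key1 : ∀ (x : Plane) (x0 x1 : ℤ), N * x 0 = x0 → N * x 1 = x1 → N * g.act x 1 =
      (g.lin.1 1 0 * x0 + g.lin.1 1 1 * x1 + N * g.trans 1 : ℤ) := by
    intro x x0 x1 h0 h1
    rw [GMap.act_one]; push_cast; rw [← h0, ← h1]; ring
  rw [orientedWeight_eq (key0 p _ _ hp0 hp1) (key1 p _ _ hp0 hp1) (key0 q _ _ hq0 hq1)
    (key1 q _ _ hq0 hq1), orientedWeight_eq hp0 hp1 hq0 hq1, GMap.det]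
  push_cast
  simp only [CharP.cast_eq_zero]
  ring

theorem exists_ccw {t : Finset Plane} (hc : t.card = 3) (hs : IsSimplex t) :
    ∃ a b c, t = {a, b, c} ∧ 0 < signedArea a b c := by
  obtain ⟨a, b, c, rfl, hD⟩ := exists_triple hc hs
  rcases lt_or_gt_of_ne hD with h | h
  · refine ⟨a, c, b, by rw [Finset.pair_comm], ?_⟩
    have : signedArea a c b = -signedArea a b c := by simp only [signedArea]; ring
    rw [this]; linarith
  · exact ⟨a, b, c, rfl, h⟩

theorem triangleWeight_ccw (N : ℕ) {a b c : Plane} (h : 0 < signedArea a b c) :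
    triangleWeight N {a, b, c} =
      {orientedWeight N a b, orientedWeight N b c, orientedWeight N c a} := by
  classical
  obtain ⟨hab, hac, hbc⟩ := ne_of_signedArea_ne_zero h.ne'
  have e : ccwEdges {a, b, c} = {(a, b), (b, c), (c, a)} := by
    ext ⟨x, y⟩
    have s1 : signedArea b c a = signedArea a b c := by simp only [signedArea]; ring
    have s2 : signedArea c a b = signedArea a b c := by simp only [signedArea]; ring
    have s3 : signedArea b a c = -signedArea a b c := by simp only [signedArea]; ring
    have s4 : signedArea a c b = -signedArea a b c := by simp only [signedArea]; ring
    have s5 : signedArea c b a = -signedArea a b c := by simp only [signedArea]; ring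
    have s6 : ∀ x y : Plane, signedArea x y x = 0 := by
      intro x y; simp only [signedArea]; ring
    have s7 : ∀ x y : Plane, signedArea x y y = 0 := by
      intro x y; simp only [signedArea]; ring
    have s8 : ∀ x y : Plane, signedArea x x y = 0 := by
      intro x y; simp only [signedArea]; ring
    have hn : ¬ 0 < -signedArea a b c := by linarith
    simp only [ccwEdges, Finset.mem_filter, Finset.mem_product, Finset.mem_insert,
      Finset.mem_singleton, Prod.mk.injEq]
    constructor
    · rintro ⟨⟨rfl | rfl | rfl, rfl | rfl | rfl⟩, r, rfl | rfl | rfl, hr⟩ <;>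
        simp_all
    · rintro (⟨rfl, rfl⟩ | ⟨rfl, rfl⟩ | ⟨rfl, rfl⟩)
      · exact ⟨⟨by simp, by simp⟩, c, by simp, h⟩
      · exact ⟨⟨by simp, by simp⟩, a, by simp, s1 ▸ h⟩
      · exact ⟨⟨by simp, by simp⟩, b, by simp, s2 ▸ h⟩
  rw [triangleWeight, e, Finset.insert_val_of_notMem (by simp [hab, hac, hbc]),
    Finset.insert_val_of_notMem (by simp [hbc, hac.symm]), Finset.singleton_val]
  simp [Multiset.insert_eq_cons]

theorem GMap.signedArea (g : GMap) (a b c : Plane) :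
    DiscreteEquidecomp.signedArea (g.act a) (g.act b) (g.act c) =
      g.det * DiscreteEquidecomp.signedArea a b c := by
  simp only [DiscreteEquidecomp.signedArea, GMap.act_zero, GMap.act_one, GMap.det]
  push_cast; ring

/-- A map of determinant `-1` also reverses the counterclockwise orientation of the edges, and the
two signs cancel. -/
theorem triangleWeight_image (g : GMap) {N : ℕ} (hN : 0 < N) {t : Finset Plane}
    (h : IsMinimalTriangle N t) : triangleWeight N (t.image g.act) = triangleWeight N t := by
  obtain ⟨a, b, c, rfl, hD⟩ := exists_ccw h.1 h.2.1
  have ha := h.2.mem_lattice (p := a) (by simp)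
  have hb := h.2.mem_lattice (p := b) (by simp)
  have hc := h.2.mem_lattice (p := c) (by simp)
  have e : ({a, b, c} : Finset Plane).image g.act = {g.act a, g.act b, g.act c} := by
    simp [Finset.image_insert]
  rw [e, triangleWeight_ccw N hD]
  rcases g.det_eq with hd | hd
  · rw [triangleWeight_ccw N (by rw [g.signedArea, hd]; simpa using hD),
      g.orientedWeight hN ha hb, g.orientedWeight hN hb hc, g.orientedWeight hN hc ha, hd]
    simp
  · rw [Finset.insert_comm, triangleWeight_ccw N (by
      rw [g.signedArea, hd]
      have : DiscreteEquidecomp.signedArea b a c = -DiscreteEquidecomp.signedArea a b c := by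
        simp only [DiscreteEquidecomp.signedArea]; ring
      rw [this]; push_cast; linarith),
      g.orientedWeight hN hb ha, g.orientedWeight hN ha hc, g.orientedWeight hN hc hb, hd,
      orientedWeight_swap N a b, orientedWeight_swap N c a, orientedWeight_swap N b c]
    push_cast
    simp only [neg_mul, one_mul, neg_neg, Multiset.insert_eq_cons]
    rw [← Multiset.singleton_add, ← Multiset.singleton_add, ← Multiset.singleton_add,
      ← Multiset.singleton_add]
    abel

/-- The affine map between the triangles has an integral linear part because `D` is a unit. Its
translation part, the image of the origin, has to be divisible by `N`, and this is what the
congruences of the weights give. -/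
theorem exists_integral_affine {N a0 a1 b0 b1 c0 c1 x0 x1 y0 y1 z0 z1 D D' σ k1 k2 k3 : ℤ}
    (hσ : σ * σ = 1) (hDdef : D = (b0 - a0) * (c1 - a1) - (c0 - a0) * (b1 - a1))
    (hDdef' : D' = (y0 - x0) * (z1 - x1) - (z0 - x0) * (y1 - x1))
    (hD1 : D = 1 ∨ D = -1) (hD1' : D' = 1 ∨ D' = -1)
    (hk1 : σ * (a0 * b1 - b0 * a1) - (x0 * y1 - y0 * x1) = N * k1)
    (hk2 : σ * (b0 * c1 - c0 * b1) - (y0 * z1 - z0 * y1) = N * k2)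
    (hk3 : σ * (c0 * a1 - a0 * c1) - (z0 * x1 - x0 * z1) = N * k3) :
    ∃ U00 U01 U10 U11 V0 V1 : ℤ, (U00 * U11 - U01 * U10 = 1 ∨ U00 * U11 - U01 * U10 = -1) ∧
      (U00 * a0 + U01 * a1 + N * V0 = x0 ∧ U10 * a0 + U11 * a1 + N * V1 = x1) ∧
      (U00 * b0 + U01 * b1 + N * V0 = y0 ∧ U10 * b0 + U11 * b1 + N * V1 = y1) ∧
      (U00 * c0 + U01 * c1 + N * V0 = z0 ∧ U10 * c0 + U11 * c1 + N * V1 = z1) := by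
  have hDD : D * D = 1 := by rcases hD1 with h | h <;> rw [h] <;> norm_num
  -- The barycentric coordinates of the origin in `a b c` are, up to the factor `D`, the
  -- determinants of the edges. Modulo `N` these are `σ` times the determinants for `x y z`, and the
  -- combination of `x`, `y`, `z` with the latter vanishes identically; the remainder is `N` times
  -- this expression.
  obtain ⟨V0, hV0⟩ : ∃ v, v = D * σ * (k2 * x0 + k3 * y0 + k1 * z0) := ⟨_, rfl⟩
  obtain ⟨V1, hV1⟩ : ∃ v, v = D * σ * (k2 * x1 + k3 * y1 + k1 * z1) := ⟨_, rfl⟩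
  obtain ⟨U00, hU00⟩ : ∃ v, v = D * ((y0 - x0) * (c1 - a1) - (z0 - x0) * (b1 - a1)) := ⟨_, rfl⟩
  obtain ⟨U01, hU01⟩ : ∃ v, v = D * (-(y0 - x0) * (c0 - a0) + (z0 - x0) * (b0 - a0)) := ⟨_, rfl⟩
  obtain ⟨U10, hU10⟩ : ∃ v, v = D * ((y1 - x1) * (c1 - a1) - (z1 - x1) * (b1 - a1)) := ⟨_, rfl⟩
  obtain ⟨U11, hU11⟩ : ∃ v, v = D * (-(y1 - x1) * (c0 - a0) + (z1 - x1) * (b0 - a0)) := ⟨_, rfl⟩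
  have e1 : U00 * (b0 - a0) + U01 * (b1 - a1) = y0 - x0 := by
    rw [hU00, hU01]
    linear_combination (y0 - x0) * hDD - (D * (y0 - x0)) * hDdef
  have e2 : U00 * (c0 - a0) + U01 * (c1 - a1) = z0 - x0 := by
    rw [hU00, hU01]
    linear_combination (z0 - x0) * hDD - (D * (z0 - x0)) * hDdef
  have e3 : U10 * (b0 - a0) + U11 * (b1 - a1) = y1 - x1 := by
    rw [hU10, hU11]
    linear_combination (y1 - x1) * hDD - (D * (y1 - x1)) * hDdef
  have e4 : U10 * (c0 - a0) + U11 * (c1 - a1) = z1 - x1 := by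
    rw [hU10, hU11]
    linear_combination (z1 - x1) * hDD - (D * (z1 - x1)) * hDdef
  have hdet : U00 * U11 - U01 * U10 = D' * D := by
    have : (U00 * U11 - U01 * U10) * D = D' := by
      rw [hDdef, hDdef']
      linear_combination (z1 - x1) * e1 +
        (U00 * (b0 - a0) + U01 * (b1 - a1)) * e4 - (z0 - x0) * e3 -
        (U10 * (b0 - a0) + U11 * (b1 - a1)) * e2
    rw [← this]; linear_combination (-(U00 * U11 - U01 * U10)) * hDD
  have hu : U00 * U11 - U01 * U10 = 1 ∨ U00 * U11 - U01 * U10 = -1 := by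
    rw [hdet]
    rcases hD1 with h1 | h1 <;> rcases hD1' with h2 | h2 <;> simp [h1, h2]
  have f0 : U00 * a0 + U01 * a1 + N * V0 = x0 := by
    rw [hV0, hU00, hU01]
    linear_combination (-D * σ) * (x0 * hk2 + y0 * hk3 + z0 * hk1) +
      (D * (x0 * (b0 * c1 - c0 * b1) + y0 * (c0 * a1 - a0 * c1) + z0 * (a0 * b1 - b0 * a1))) * hσ
      + x0 * hDD - (D * x0) * hDdef
  have f1 : U10 * a0 + U11 * a1 + N * V1 = x1 := by
    rw [hV1, hU10, hU11]
    linear_combination (-D * σ) * (x1 * hk2 + y1 * hk3 + z1 * hk1) +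
      (D * (x1 * (b0 * c1 - c0 * b1) + y1 * (c0 * a1 - a0 * c1) + z1 * (a0 * b1 - b0 * a1))) * hσ
      + x1 * hDD - (D * x1) * hDdef
  exact ⟨U00, U01, U10, U11, V0, V1, hu, ⟨f0, f1⟩,
    ⟨by linear_combination f0 + e1, by linear_combination f1 + e3⟩,
    ⟨by linear_combination f0 + e2, by linear_combination f1 + e4⟩⟩

theorem exists_gMap_of_weights {N : ℕ} (hN : 0 < N) {a b c a' b' c' : Plane}
    (h : IsMinimalTriangle N {a, b, c}) (h' : IsMinimalTriangle N {a', b', c'}) {σ : ℤ}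
    (hσ : σ * σ = 1)
    (w1 : orientedWeight N a' b' = σ * orientedWeight N a b)
    (w2 : orientedWeight N b' c' = σ * orientedWeight N b c)
    (w3 : orientedWeight N c' a' = σ * orientedWeight N c a) :
    GEquiv {a, b, c} {a', b', c'} := by
  obtain ⟨ha, hb, hc, hD⟩ := (isMinimalTriangle_iff hN h.signedArea_ne_zero).1 h
  obtain ⟨ha', hb', hc', hD'⟩ := (isMinimalTriangle_iff hN h'.signedArea_ne_zero).1 h'
  obtain ⟨a0, a1, ha0, ha1⟩ := (mem_lattice_iff hN).1 ha
  obtain ⟨b0, b1, hb0, hb1⟩ := (mem_lattice_iff hN).1 hb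
  obtain ⟨c0, c1, hc0, hc1⟩ := (mem_lattice_iff hN).1 hc
  obtain ⟨x0, x1, hx0, hx1⟩ := (mem_lattice_iff hN).1 ha'
  obtain ⟨y0, y1, hy0, hy1⟩ := (mem_lattice_iff hN).1 hb'
  obtain ⟨z0, z1, hz0, hz1⟩ := (mem_lattice_iff hN).1 hc'
  set D : ℤ := (b0 - a0) * (c1 - a1) - (c0 - a0) * (b1 - a1) with hDdef
  set D' : ℤ := (y0 - x0) * (z1 - x1) - (z0 - x0) * (y1 - x1) with hDdef'
  have eD : (N : ℝ) ^ 2 * signedArea a b c = D := by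
    rw [hDdef]; push_cast
    rw [← ha0, ← ha1, ← hb0, ← hb1, ← hc0, ← hc1, signedArea]; ring
  have eD' : (N : ℝ) ^ 2 * signedArea a' b' c' = D' := by
    rw [hDdef']; push_cast
    rw [← hx0, ← hx1, ← hy0, ← hy1, ← hz0, ← hz1, signedArea]; ring
  have hD1 : D = 1 ∨ D = -1 := by rw [eD] at hD; exact_mod_cast hD
  have hD1' : D' = 1 ∨ D' = -1 := by rw [eD'] at hD'; exact_mod_cast hD'
  rw [orientedWeight_eq hx0 hx1 hy0 hy1, orientedWeight_eq ha0 ha1 hb0 hb1, ← Int.cast_mul,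
    ZMod.intCast_eq_intCast_iff_dvd_sub] at w1
  rw [orientedWeight_eq hy0 hy1 hz0 hz1, orientedWeight_eq hb0 hb1 hc0 hc1, ← Int.cast_mul,
    ZMod.intCast_eq_intCast_iff_dvd_sub] at w2
  rw [orientedWeight_eq hz0 hz1 hx0 hx1, orientedWeight_eq hc0 hc1 ha0 ha1, ← Int.cast_mul,
    ZMod.intCast_eq_intCast_iff_dvd_sub] at w3
  obtain ⟨k1, hk1⟩ := w1
  obtain ⟨k2, hk2⟩ := w2
  obtain ⟨k3, hk3⟩ := w3
  have hNR : (N : ℝ) ≠ 0 := by positivity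
  obtain ⟨U00, U01, U10, U11, V0, V1, hu, ⟨f0, f1⟩, ⟨f2, f3⟩, ⟨f4, f5⟩⟩ :=
    exists_integral_affine hσ hDdef hDdef' hD1 hD1' hk1 hk2 hk3
  have act : ∀ (p q : Plane) (p0 p1 q0 q1 : ℤ), N * p 0 = p0 → N * p 1 = p1 → N * q 0 = q0 →
      N * q 1 = q1 → U00 * p0 + U01 * p1 + N * V0 = q0 → U10 * p0 + U11 * p1 + N * V1 = q1 →
      (GMap.ofCoeffs U00 U01 U10 U11 V0 V1 hu).act p = q := by
    intro p q p0 p1 q0 q1 h1 h2 h3 h4 h5 h6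
    have h5' : (U00 * p0 + U01 * p1 + N * V0 : ℝ) = q0 := by exact_mod_cast h5
    have h6' : (U10 * p0 + U11 * p1 + N * V1 : ℝ) = q1 := by exact_mod_cast h6
    apply plane_ext
    · apply mul_left_cancel₀ hNR
      rw [GMap.ofCoeffs_zero, h3, ← h5', ← h1, ← h2]
      ring
    · apply mul_left_cancel₀ hNR
      rw [GMap.ofCoeffs_one, h4, ← h6', ← h1, ← h2]
      ring
  refine ⟨GMap.ofCoeffs U00 U01 U10 U11 V0 V1 hu, ?_⟩
  rw [Finset.image_insert, Finset.image_insert, Finset.image_singleton,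
    act a a' _ _ _ _ ha0 ha1 hx0 hx1 f0 f1, act b b' _ _ _ _ hb0 hb1 hy0 hy1 f2 f3,
    act c c' _ _ _ _ hc0 hc1 hz0 hz1 f4 f5]

theorem triple_eq_triple {α : Type*} {u v w p q r : α} (h : ({u, v, w} : Multiset α) = {p, q, r}) :
    (p = u ∧ q = v ∧ r = w) ∨ (p = u ∧ q = w ∧ r = v) ∨ (p = v ∧ q = u ∧ r = w) ∨
      (p = v ∧ q = w ∧ r = u) ∨ (p = w ∧ q = u ∧ r = v) ∨ (p = w ∧ q = v ∧ r = u) := by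
  have h' : [u, v, w].Perm [p, q, r] := Multiset.coe_eq_coe.1 h
  have := List.mem_permutations'.2 h'.symm
  simp only [List.permutations', List.flatMap_cons, List.flatMap_nil, List.permutations'Aux,
    List.map_cons, List.map_nil, List.append_nil, List.cons_append, List.nil_append,
    List.mem_cons, List.not_mem_nil, or_false, List.cons.injEq, and_true] at this
  rcases this with h | h | h | h | h | h <;> simp only [h, and_self, true_or, or_true]

/-- Every permutation of the three edge weights comes from relabelling the vertices: the even ones
from rotations, realized with sign `1`, the odd ones from reflections, which reverse all edges and
are realized with sign `-1`. -/
theorem gEquiv_of_triangleWeight_eq {N : ℕ} (hN : 0 < N) {s t : Finset Plane}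
    (hs : IsMinimalTriangle N s) (ht : IsMinimalTriangle N t)
    (h : triangleWeight N s = triangleWeight N t) : GEquiv s t := by
  obtain ⟨a, b, c, rfl, h1⟩ := exists_ccw hs.1 hs.2.1
  obtain ⟨x, y, z, rfl, h2⟩ := exists_ccw ht.1 ht.2.1
  rw [triangleWeight_ccw N h1, triangleWeight_ccw N h2] at h
  have rot : ({x, y, z} : Finset Plane) = {y, z, x} := by
    ext p; simp only [Finset.mem_insert, Finset.mem_singleton]; tauto
  have rot' : ({x, y, z} : Finset Plane) = {z, x, y} := by
    ext p; simp only [Finset.mem_insert, Finset.mem_singleton]; tauto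
  have ref1 : ({x, y, z} : Finset Plane) = {y, x, z} := Finset.insert_comm _ _ _
  have ref2 : ({x, y, z} : Finset Plane) = {x, z, y} := by rw [Finset.pair_comm]
  have ref3 : ({x, y, z} : Finset Plane) = {z, y, x} := by
    ext p; simp only [Finset.mem_insert, Finset.mem_singleton]; tauto
  have pos := fun {p q r : Plane} (e : ({x, y, z} : Finset Plane) = {p, q, r})
    (u1 : orientedWeight N p q = orientedWeight N a b)
    (u2 : orientedWeight N q r = orientedWeight N b c)
    (u3 : orientedWeight N r p = orientedWeight N c a) =>
    (e ▸ exists_gMap_of_weights hN hs (e ▸ ht) (σ := 1) (by norm_num)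
      (by simpa using u1) (by simpa using u2) (by simpa using u3) :
      GEquiv {a, b, c} {x, y, z})
  have neg := fun {p q r : Plane} (e : ({x, y, z} : Finset Plane) = {p, q, r})
    (u1 : orientedWeight N q p = orientedWeight N a b)
    (u2 : orientedWeight N r q = orientedWeight N b c)
    (u3 : orientedWeight N p r = orientedWeight N c a) =>
    (e ▸ exists_gMap_of_weights hN hs (e ▸ ht) (σ := -1) (by norm_num)
      (by rw [orientedWeight_swap, u1]; simp) (by rw [orientedWeight_swap, u2]; simp)
      (by rw [orientedWeight_swap, u3]; simp) :
      GEquiv {a, b, c} {x, y, z})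
  generalize orientedWeight N a b = u at *
  generalize orientedWeight N b c = v at *
  generalize orientedWeight N c a = w at *
  rcases triple_eq_triple h with ⟨h1, h2, h3⟩ | ⟨h1, h2, h3⟩ | ⟨h1, h2, h3⟩ | ⟨h1, h2, h3⟩ |
    ⟨h1, h2, h3⟩ | ⟨h1, h2, h3⟩
  · exact pos rfl h1 h2 h3
  · exact neg ref1 h1 h3 h2
  · exact neg ref3 h2 h1 h3
  · exact pos rot' h3 h1 h2
  · exact pos rot h2 h3 h1
  · exact neg ref2 h3 h2 h1

/-! ### Pseudo-flips as scissors congruences -/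

theorem scissors_flip {N : ℕ} (hN : 0 < N) {a b c e : Plane} (h : a + e = b + c)
    (h1 : IsMinimalTriangle N {a, b, c}) (h2 : IsMinimalTriangle N {b, c, e}) :
    Scissors {{a, b, c}, {b, c, e}} {{a, b, e}, {a, c, e}} := by
  classical
  have hD := h1.signedArea_ne_zero
  obtain ⟨h3, h4⟩ := flip_minimal hN h h1 h2
  have d1 : Disjoint (openSimplex {a, b, e}) (openSimplex {a, c, e}) :=
    parallelogram_disjoint h hD
  have d2 : Disjoint (openSimplex {a, b, c}) (openSimplex {b, c, e}) := by
    -- The pair with diagonal `b c` arises from the previous disjointness by exchanging the roles of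
    -- the two diagonals.
    have hD' : signedArea b a e ≠ 0 := by
      have : signedArea b a e = -signedArea a b e := by simp only [signedArea]; ring
      rw [this, (parallelogram_signedArea h).2.1]
      exact neg_ne_zero.2 hD
    have := parallelogram_disjoint h.symm hD'
    rwa [Finset.insert_comm, Finset.pair_comm e c] at this
  have key : ∀ s t : Finset Plane, IsMinimalTriangle N s → IsMinimalTriangle N t →
      Disjoint (openSimplex s) (openSimplex t) →
      ∃ X : Finset (Finset Plane), X.val = {s, t} ∧ IsDissection (hull s ∪ hull t) X ∧
        ∀ x ∈ X, IsRatTriangle x := by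
    intro s t hs ht hst
    have hne : s ≠ t := by
      rintro rfl
      obtain ⟨x, hx⟩ := openSimplex_nonempty hs.2.1.1
      exact disjoint_left.1 hst hx hx
    refine ⟨{s, t}, ?_, ⟨?_, ?_, ?_⟩, ?_⟩
    · rw [Finset.insert_val_of_notMem (by simpa using hne), Finset.singleton_val]; rfl
    · intro x hx
      rcases Finset.mem_insert.1 hx with rfl | hx
      · exact ⟨hs.1, hs.2.1⟩
      · rw [Finset.mem_singleton.1 hx]; exact ⟨ht.1, ht.2.1⟩
    · rw [Finset.coe_pair]
      rw [Set.PairwiseDisjoint, Set.pairwise_pair]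
      exact fun _ => ⟨hst, hst.symm⟩
    · simp
    · intro x hx
      rcases Finset.mem_insert.1 hx with rfl | hx
      · exact hs.isRatTriangle
      · rw [Finset.mem_singleton.1 hx]; exact ht.isRatTriangle
  obtain ⟨X, hX, hX1, hX2⟩ := key _ _ h1 h2 d2
  obtain ⟨Y, hY, hY1, hY2⟩ := key _ _ h3 h4 d1
  rw [parallelogram_hull h hD] at hX1
  rw [← hX, ← hY]
  exact Scissors.of_dissections hX1 hY1 hX2 hY2

theorem gEq_of_map_triangleWeight_eq {N : ℕ} (hN : 0 < N) {A B : Multiset (Finset Plane)}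
    (hA : ∀ t ∈ A, IsMinimalTriangle N t) (hB : ∀ t ∈ B, IsMinimalTriangle N t)
    (h : A.map (triangleWeight N) = B.map (triangleWeight N)) : GEq A B := by
  rw [← Multiset.rel_eq, Multiset.rel_map] at h
  exact h.mono fun a ha b hb hab => gEquiv_of_triangleWeight_eq hN (hA a ha) (hB b hb) hab

/-- A pseudo-flip only sees weights, and its parallelogram need not occur among the triangles at
hand. But triangles with the required weights are present and are equivalent to those of the
parallelogram, so one may pass to it and cut there. -/
theorem scissors_of_pseudoFlips {N : ℕ} (hN : 0 < N) {A B : Multiset (Finset Plane)}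
    (hA : ∀ t ∈ A, IsMinimalTriangle N t) (hB : ∀ t ∈ B, IsMinimalTriangle N t)
    (h : Relation.ReflTransGen (PseudoFlip N) (A.map (triangleWeight N))
      (B.map (triangleWeight N))) : Scissors A B := by
  generalize hτ : B.map (triangleWeight N) = τ at h
  suffices H : ∃ A' : Multiset (Finset Plane), (∀ t ∈ A', IsMinimalTriangle N t) ∧
      A'.map (triangleWeight N) = τ ∧ Scissors A A' by
    obtain ⟨A', h1, h2, h3⟩ := H
    exact h3.trans (Scissors.of_gEq (fun t ht => (h1 t ht).isRatTriangle)
      (fun t ht => (hB t ht).isRatTriangle)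
      (gEq_of_map_triangleWeight_eq hN h1 hB (h2.trans hτ.symm)))
  clear hτ hB
  induction h with
  | refl => exact ⟨A, hA, rfl, Scissors.of_gEq (fun t ht => (hA t ht).isRatTriangle)
      (fun t ht => (hA t ht).isRatTriangle) (GEq.refl A)⟩
  | tail _ hf ih =>
    obtain ⟨A', h1, h2, h3⟩ := ih
    obtain ⟨a, b, c, e, hs, m1, m2, ρ, e1, e2⟩ := hf
    obtain ⟨m3, m4⟩ := flip_minimal hN hs m1 m2
    -- The two replaced weights belong to actual members `s` and `t` of `A'`.
    rw [e1, Multiset.insert_eq_cons, Multiset.cons_add, ← Multiset.map_eq_cons] at h2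
    obtain ⟨s, hs', ws, h2⟩ := h2
    rw [Multiset.singleton_add, ← Multiset.map_eq_cons] at h2
    obtain ⟨t, ht', wt, h2⟩ := h2
    have hρ : ∀ x ∈ (A'.erase s).erase t, IsMinimalTriangle N x := fun x hx =>
      h1 x (Multiset.mem_of_mem_erase (Multiset.mem_of_mem_erase hx))
    have hs1 := h1 s hs'
    have ht1 := h1 t (Multiset.mem_of_mem_erase ht')
    have eA : A' = {s, t} + (A'.erase s).erase t := by
      rw [Multiset.insert_eq_cons, Multiset.cons_add, Multiset.singleton_add,
        Multiset.cons_erase ht', Multiset.cons_erase hs']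
    refine ⟨{{a, b, e}, {a, c, e}} + (A'.erase s).erase t, ?_, ?_, h3.trans ?_⟩
    · intro x hx
      simp only [Multiset.mem_add, Multiset.insert_eq_cons, Multiset.mem_cons,
        Multiset.mem_singleton] at hx
      rcases hx with (rfl | rfl) | hx
      · exact m3
      · exact m4
      · exact hρ x hx
    · rw [Multiset.map_add, h2, e2]; simp
    · have s1 : Scissors {s, t} {{a, b, c}, {b, c, e}} := by
        refine Scissors.of_gEq ?_ ?_ ?_
        · intro x hx
          simp only [Multiset.insert_eq_cons, Multiset.mem_cons, Multiset.mem_singleton] at hx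
          rcases hx with rfl | rfl
          · exact hs1.isRatTriangle
          · exact ht1.isRatTriangle
        · intro x hx
          simp only [Multiset.insert_eq_cons, Multiset.mem_cons, Multiset.mem_singleton] at hx
          rcases hx with rfl | rfl
          · exact m1.isRatTriangle
          · exact m2.isRatTriangle
        · exact Multiset.Rel.cons (gEquiv_of_triangleWeight_eq hN hs1 m1 ws)
            (Multiset.Rel.cons (gEquiv_of_triangleWeight_eq hN ht1 m2 wt) Multiset.Rel.zero)
      have s2 := s1.trans (scissors_flip hN hs m1 m2)
      have hR := fun x hx => (hρ x hx).isRatTriangle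
      have := s2.add (Scissors.of_gEq hR hR (GEq.refl _))
      rwa [← eA] at this

/-! ### Weights of edges -/

theorem unorientedWeight_image {N : ℕ} (hN : 0 < N) (g : GMap) {e : Finset Plane}
    (he : ∀ p ∈ e, p ∈ lattice N) :
    unorientedWeight N e ⊆ unorientedWeight N (e.image g.act) := by
  rintro w ⟨p, hp, q, hq, hne, rfl⟩
  have hp' := Finset.mem_image_of_mem g.act hp
  have hq' := Finset.mem_image_of_mem g.act hq
  rcases g.det_eq with h | h
  · exact ⟨_, hp', _, hq', g.injective.ne hne, by
      rw [g.orientedWeight hN (he p hp) (he q hq), h]; simp⟩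
  · exact ⟨_, hq', _, hp', g.injective.ne hne.symm, by
      rw [g.orientedWeight hN (he q hq) (he p hp), h, orientedWeight_swap N p q]; simp⟩

/-- The weight up to sign is invariant under `G`, so the class already determines the whole Weight.
-/
theorem edgeWeight_eq_iff {N : ℕ} (hN : 0 < N) {e f : Finset Plane}
    (he : ∀ p ∈ e, p ∈ lattice N) (hf : ∀ p ∈ f, p ∈ lattice N) :
    edgeWeight N e = edgeWeight N f ↔ gClass e = gClass f := by
  refine ⟨fun h => (Prod.ext_iff.1 h).2, fun h => Prod.ext ?_ h⟩
  have key : ∀ {e f : Finset Plane}, (∀ p ∈ e, p ∈ lattice N) → gClass e = gClass f →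
      unorientedWeight N e ⊆ unorientedWeight N f := by
    intro e f he h
    obtain ⟨g, rfl⟩ := gClass_eq_iff.1 h
    exact unorientedWeight_image hN g he
  exact Subset.antisymm (key he h) (key hf h.symm)

/-! ### The boundary of a polygon -/

/-- Near `v`, the set `F` is a straight line. -/
def Straight (F : Set Plane) (v : Plane) : Prop :=
  ∃ u : Plane, u ≠ 0 ∧ F =ᶠ[𝓝 v] {x | ∃ t : ℝ, x = v + t • u}

theorem tendsto_add_smul (x u : Plane) : Filter.Tendsto (fun r : ℝ => x + r • u) (𝓝 0) (𝓝 x) := by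
  have : Continuous fun r : ℝ => x + r • u := by fun_prop
  simpa using this.tendsto 0

theorem eventually_line_mem {F : Set Plane} {x u : Plane}
    (h : F =ᶠ[𝓝 x] {y | ∃ t : ℝ, y = x + t • u}) : ∃ δ : ℝ, 0 < δ ∧ ∀ r, |r| < δ → x + r • u ∈ F := by
  have h1 := (tendsto_add_smul x u).eventually h
  obtain ⟨δ, hδ, h2⟩ := Metric.eventually_nhds_iff.1 h1
  refine ⟨δ, hδ, fun r hr => ?_⟩
  have h3 := h2 (y := r) (by simpa [Real.dist_eq] using hr)
  exact (eq_iff_iff.1 h3).2 ⟨r, rfl⟩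

/-- Follow the line as long as it stays in `F`. Compactness stops it, and at the last point `F`
cannot be straight, since otherwise the line could be continued. -/
theorem exists_end_of_straight {F : Set Plane} (hF : IsCompact F) {x u : Plane} (hu : u ≠ 0)
    (h : F =ᶠ[𝓝 x] {y | ∃ t : ℝ, y = x + t • u}) :
    ∃ s : ℝ, 0 < s ∧ (∀ r, 0 ≤ r → r ≤ s → x + r • u ∈ F) ∧ ¬ Straight F (x + s • u) := by
  set S : Set ℝ := {s | 0 ≤ s ∧ ∀ r, 0 ≤ r → r ≤ s → x + r • u ∈ F} with hS
  obtain ⟨δ, hδ, hx⟩ := eventually_line_mem h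
  have hδS : δ / 2 ∈ S := ⟨by positivity, fun r h0 h1 => hx r (by rw [abs_of_nonneg h0]; linarith)⟩
  obtain ⟨C, hC⟩ := hF.isBounded.exists_norm_le
  have hu' : 0 < ‖u‖ := norm_pos_iff.2 hu
  have hbdd : BddAbove S := by
    refine ⟨(C + ‖x‖) / ‖u‖, fun s hs => ?_⟩
    have h1 := hC _ (hs.2 s hs.1 le_rfl)
    have h2 : ‖s • u‖ ≤ ‖x + s • u‖ + ‖x‖ := by
      have := norm_sub_le (x + s • u) x
      rwa [add_sub_cancel_left] at this
    rw [norm_smul, Real.norm_of_nonneg hs.1] at h2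
    rw [le_div_iff₀ hu']; linarith
  have hpos : 0 < sSup S := lt_of_lt_of_le (by positivity) (le_csSup hbdd hδS)
  have hmem : ∀ r, 0 ≤ r → r ≤ sSup S → x + r • u ∈ F := by
    have hcl : IsClosed {r : ℝ | x + r • u ∈ F} :=
      hF.isClosed.preimage (by fun_prop : Continuous fun r : ℝ => x + r • u)
    have hsub : Ico 0 (sSup S) ⊆ {r : ℝ | x + r • u ∈ F} := by
      rintro r ⟨h0, h1⟩
      obtain ⟨s, hs, hrs⟩ := exists_lt_of_lt_csSup ⟨_, hδS⟩ h1
      exact hs.2 r h0 hrs.le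
    have := closure_minimal hsub hcl
    rw [closure_Ico hpos.ne] at this
    exact fun r h0 h1 => this ⟨h0, h1⟩
  refine ⟨sSup S, hpos, hmem, ?_⟩
  rintro ⟨v, -, hv⟩
  have h1 := (tendsto_add_smul (x + sSup S • u) u).eventually hv
  obtain ⟨ε, hε, h2⟩ := Metric.eventually_nhds_iff.1 h1
  have h3 : ∀ r, |r| < ε → (x + (sSup S + r) • u ∈ F ↔ ∃ t : ℝ, r • u = t • v) := by
    intro r hr
    have := eq_iff_iff.1 (h2 (y := r) (by simpa [Real.dist_eq] using hr))
    rw [add_smul, ← add_assoc]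
    exact this.trans (exists_congr fun t => add_right_inj _)
  -- The point at distance `ρ` before the end lies in `F`, so a straight line through the end must
  -- have the direction of `u`; then it also contains the points up to `ρ` beyond, against the
  -- choice of the supremum.
  set ρ := min (ε / 2) (sSup S) with hρ
  have hρ0 : 0 < ρ := lt_min (by positivity) hpos
  have hρε : ρ < ε := (min_le_left _ _).trans_lt (by linarith)
  obtain ⟨t, ht⟩ := (h3 (-ρ) (by rwa [abs_neg, abs_of_pos hρ0])).1
    (hmem _ (by linarith [min_le_right (ε / 2) (sSup S)]) (by linarith))
  have hin : sSup S + ρ ∈ S := by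
    refine ⟨by positivity, fun r h0 hr => ?_⟩
    rcases le_or_gt r (sSup S) with h4 | h4
    · exact hmem r h0 h4
    · have h5 := (h3 (r - sSup S) (by rw [abs_of_pos (by linarith)]; linarith)).2
        ⟨-(r - sSup S) / ρ * t, by
          rw [mul_smul, ← ht, smul_smul]; congr 1; field_simp⟩
      rwa [add_sub_cancel] at h5
  linarith [le_csSup hbdd hin]

/-- Followed in both directions, the line through `x` ends in points where `F` is not straight,
which are lattice points; the segment between them has a minimal piece through `x`. -/
theorem exists_minimalEdge_of_straight {N : ℕ} (hN : 0 < N) {F : Set Plane} (hF : IsCompact F)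
    (hl : ∀ v ∈ F, ¬ Straight F v → v ∈ lattice N) {x : Plane} (hx : Straight F x) :
    ∃ e : Finset Plane, IsMinimalEdge N e ∧ hull e ⊆ F ∧ x ∈ hull e := by
  obtain ⟨u, hu, hx⟩ := hx
  have hx' : F =ᶠ[𝓝 x] {y | ∃ t : ℝ, y = x + t • (-u)} := by
    have : {y | ∃ t : ℝ, y = x + t • (-u)} = {y | ∃ t : ℝ, y = x + t • u} := by
      ext y
      exact ⟨fun ⟨t, ht⟩ => ⟨-t, by rw [ht]; module⟩, fun ⟨t, ht⟩ => ⟨-t, by rw [ht]; module⟩⟩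
    rwa [this]
  obtain ⟨s, hs, h1, h2⟩ := exists_end_of_straight hF hu hx
  obtain ⟨r, hr, h3, h4⟩ := exists_end_of_straight hF (neg_ne_zero.2 hu) hx'
  have hne : x + r • -u ≠ x + s • u := by
    intro h
    have : (r + s) • u = 0 := by
      have h' : r • -u = s • u := add_left_cancel h
      rw [add_smul, ← h']; module
    rcases smul_eq_zero.1 this with h | h
    · linarith
    · exact hu h
  have hsub : hull {x + r • -u, x + s • u} ⊆ F := by
    intro y hy
    obtain ⟨ρ, h0, h1', rfl⟩ := mem_hull_pair.1 hy
    rcases le_total (ρ * (r + s)) r with hle | hle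
    · have := h3 (r - ρ * (r + s)) (by linarith) (by
        have : 0 ≤ ρ * (r + s) := by positivity
        linarith)
      convert this using 1; module
    · have := h1 (ρ * (r + s) - r) (by linarith) (by nlinarith)
      convert this using 1; module
  obtain ⟨e, he, h5, h6⟩ := exists_minimal_subsegment hN hne
    (hl _ (h3 r hr.le le_rfl) h4) (hl _ (h1 s hs.le le_rfl) h2) (x := x)
    (mem_hull_pair.2 ⟨r / (r + s), by positivity, by rw [div_le_one (by positivity)]; linarith, by
      have : r / (r + s) * (r + s) = r := by field_simp
      have e1 : x + r • -u + (r / (r + s)) • (x + s • u - (x + r • -u)) =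
        x - r • u + (r / (r + s) * (r + s)) • u := by module
      rw [e1, this]; module⟩)
  exact ⟨e, he, h5.trans hsub, h6⟩

/-- A crossing point of two segments contained in `F` is not a point where `F` is straight. -/
theorem not_straight_of_cross {F : Set Plane} {e f : Finset Plane} (he : e.card = 2)
    (hf : f.card = 2) (heF : hull e ⊆ F) (hfF : hull f ⊆ F) {x : Plane} (hxe : x ∈ openSimplex e)
    (hxf : x ∈ openSimplex f) (hpar : ¬ Par e f) : ¬ Straight F x := by
  rintro ⟨u, hu, hx⟩
  obtain ⟨p, q, hpq, rfl⟩ := exists_pair he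
  obtain ⟨a, b, hab, rfl⟩ := exists_pair hf
  have key : ∀ {p q : Plane}, p ≠ q → hull {p, q} ⊆ F → x ∈ openSimplex {p, q} →
      ∃ t : ℝ, q - p = t • u := by
    intro p q hpq hF hx'
    have h1 := eventually_mem_pair hpq hx' 1
    have h2 := ((tendsto_add_smul x (q - p)).mono_left nhdsWithin_le_nhds
      (y := 𝓝[>] (0 : ℝ))).eventually hx
    have h3 : ∀ᶠ ε in 𝓝[>] (0 : ℝ), 0 < ε := self_mem_nhdsWithin
    obtain ⟨ε, h1, h2, h3⟩ := (h1.and (h2.and h3)).exists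
    rw [one_smul] at h1
    obtain ⟨t, ht⟩ := (eq_iff_iff.1 h2).1 (hF (openSimplex_subset_hull _ h1))
    refine ⟨ε⁻¹ * t, ?_⟩
    rw [mul_smul, ← add_left_cancel ht, smul_smul, inv_mul_cancel₀ h3.ne', one_smul]
  obtain ⟨t, ht⟩ := key hpq heF hxe
  obtain ⟨s, hs⟩ := key hab hfF hxf
  refine hpar (par_pair ?_)
  rw [ht, hs]; simp only [cross, Pi.smul_apply, smul_eq_mul]; ring

theorem frontierEdges_disjoint {N : ℕ} {F : Set Plane}
    (hl : ∀ v ∈ F, ¬ Straight F v → v ∈ lattice N) {e f : Finset Plane} (he : IsMinimalEdge N e)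
    (hf : IsMinimalEdge N f) (heF : hull e ⊆ F) (hfF : hull f ⊆ F) :
    e = f ∨ Disjoint (openSimplex e) (openSimplex f) := by
  by_contra! h
  obtain ⟨h1, h2⟩ := h
  obtain ⟨x, hx, hx'⟩ := not_disjoint_iff.1 h2
  have hpar : ¬ Par e f := fun hp =>
    h1 (he.eq_of_par hf hx (openSimplex_subset_hull _ hx') hp)
  have := hl x (heF (openSimplex_subset_hull _ hx))
    (not_straight_of_cross he.1 hf.1 heF hfF hx hx' hpar)
  exact he.2.notMem_openSimplex he.1.ge this hx

/-- The boundary of a regular closed set has no isolated points. -/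
theorem frontier_not_isolated {R : Set Plane} (hreg : R ⊆ closure (interior R)) (hR : IsClosed R)
    {v : Plane} (hv : v ∈ frontier R) {ε : ℝ} (hε : 0 < ε) :
    ∃ x ∈ Metric.ball v ε, x ∈ frontier R ∧ x ≠ v := by
  by_contra! hcon
  have hB : IsOpen (Metric.ball v ε) := Metric.isOpen_ball
  have hvB : v ∈ Metric.ball v ε := Metric.mem_ball_self hε
  obtain ⟨p, hpB, hp⟩ := mem_closure_iff.1 (hreg (hR.frontier_subset hv)) _ hB hvB
  have hpv : p ≠ v := by rintro rfl; exact hv.2 hp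
  have hvc : v ∈ closure Rᶜ := by
    have := frontier_compl R ▸ hv
    exact this.1
  obtain ⟨q, hqB, hq⟩ := mem_closure_iff.1 hvc _ hB hvB
  have hO : IsOpen (Metric.ball v ε ∩ Rᶜ) := hB.inter hR.isOpen_compl
  -- A quarter turn of `v - p`, used to push the outer point off the line through `p` and `v`.
  set w : Plane := ![-(v 1 - p 1), v 0 - p 0] with hw
  obtain ⟨q', hq', hc⟩ : ∃ q' ∈ Metric.ball v ε ∩ Rᶜ, cross (q' - p) (v - p) ≠ 0 := by
    by_cases h0 : cross (q - p) (v - p) = 0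
    · have h1 := (tendsto_add_smul q w).eventually (hO.mem_nhds ⟨hqB, hq⟩)
      have h2 : ∀ᶠ r in 𝓝[>] (0 : ℝ), 0 < r := self_mem_nhdsWithin
      obtain ⟨r, h1, h2⟩ := ((h1.filter_mono nhdsWithin_le_nhds).and h2).exists
      refine ⟨q + r • w, h1, fun h3 => hpv ?_⟩
      have h4 : r * ((v 0 - p 0) ^ 2 + (v 1 - p 1) ^ 2) = 0 := by
        simp only [cross, Pi.sub_apply, Pi.add_apply, Pi.smul_apply, smul_eq_mul, hw,
          Matrix.cons_val_zero, Matrix.cons_val_one, Matrix.cons_val_fin_one] at h3 h0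
        linarith
      have h5 := (mul_eq_zero.1 h4).resolve_left h2.ne'
      have h6 : v 0 - p 0 = 0 := by nlinarith [sq_nonneg (v 0 - p 0), sq_nonneg (v 1 - p 1)]
      have h7 : v 1 - p 1 = 0 := by nlinarith [sq_nonneg (v 0 - p 0), sq_nonneg (v 1 - p 1)]
      exact plane_ext (by linarith) (by linarith)
    · exact ⟨q, ⟨hqB, hq⟩, h0⟩
  -- This segment from an inner to an outer point misses `v`, hence the whole frontier within the
  -- ball, which is absurd.
  have hsub : segment ℝ p q' ⊆ R := by
    refine subset_of_preconnected_of_frontier (convex_segment p q').isPreconnected ?_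
      ⟨p, left_mem_segment ℝ p q', interior_subset hp⟩
    intro x hx hxf
    have hxB : x ∈ Metric.ball v ε := (convex_ball v ε).segment_subset hpB hq'.1 hx
    have hxv := hcon x hxB hxf
    rw [segment_eq_image'] at hx
    obtain ⟨r, -, rfl⟩ := hx
    apply hc
    rw [← hxv]
    simp only [cross, Pi.sub_apply, Pi.add_apply, Pi.smul_apply, smul_eq_mul]; ring
  exact hq'.2 (hsub (right_mem_segment ℝ p q'))

/-! ### Decomposing the boundary of a polygon into minimal edges -/

/-- The `N`-minimal edges in the boundary of `P`. -/
def boundaryEdges (N : ℕ) (P : Set Plane) : Set (Finset Plane) :=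
  {e | IsMinimalEdge N e ∧ hull e ⊆ frontier P}

theorem IsPolygon.isCompact {P : Set Plane} (h : IsPolygon P) : IsCompact P := by
  obtain ⟨K, -, -, rfl⟩ := h
  exact K.isCompact_biUnion fun t _ => isCompact_hull t

theorem IsPolygon.nonempty {P : Set Plane} (h : IsPolygon P) : P.Nonempty := by
  obtain ⟨K, ⟨t, ht⟩, hK, rfl⟩ := h
  obtain ⟨p, hp⟩ := (hK t ht).2.1
  exact ⟨p, mem_biUnion ht (mem_hull_of_mem hp)⟩

theorem IsPolygon.subset_closure_interior {P : Set Plane} (h : IsPolygon P) :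
    P ⊆ closure (interior P) := by
  obtain ⟨K, -, hK, rfl⟩ := h
  refine iUnion₂_subset fun t ht => (hull_subset_closure_interior (hK t ht).1 (hK t ht).2).trans
    (closure_mono (interior_mono ?_))
  exact subset_biUnion_of_mem (u := fun t => hull t) ht

theorem IsPolygon.isCompact_frontier {P : Set Plane} (h : IsPolygon P) : IsCompact (frontier P) :=
  h.isCompact.of_isClosed_subset isClosed_frontier h.isCompact.isClosed.frontier_subset

theorem IsPolygon.finite_boundaryEdges {P : Set Plane} (h : IsPolygon P) {N : ℕ} (hN : 0 < N) :
    (boundaryEdges N P).Finite :=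
  finite_minimalEdges hN h.isCompact_frontier.isBounded

/-- Straight points lie on minimal edges by following the line. A corner is not isolated in the
frontier, so straight points accumulate at it; finitely many closed edges contain these, hence also
the corner. -/
theorem IsPolygon.exists_boundaryEdge {P : Set Plane} (h : IsPolygon P) {N : ℕ} (hN : 0 < N)
    (hl : ∀ v, IsVertex P v → v ∈ lattice N) {x : Plane} (hx : x ∈ frontier P) :
    ∃ e ∈ boundaryEdges N P, x ∈ hull e := by
  have hl' : ∀ v ∈ frontier P, ¬ Straight (frontier P) v → v ∈ lattice N :=
    fun v hv hs => hl v ⟨hv, hs⟩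
  have hfin := h.finite_boundaryEdges hN
  have hlat := finite_lattice_inter hN h.isCompact_frontier.isBounded
  by_contra! hcon
  have hU : IsClosed (⋃ e ∈ boundaryEdges N P, hull e) :=
    hfin.isClosed_biUnion fun e _ => isClosed_hull e
  have hV : IsClosed ((lattice N ∩ frontier P) \ {x}) :=
    (hlat.subset sdiff_subset).isClosed
  have hO : ((⋃ e ∈ boundaryEdges N P, hull e) ∪ ((lattice N ∩ frontier P) \ {x}))ᶜ ∈ 𝓝 x := by
    refine (hU.union hV).isOpen_compl.mem_nhds ?_
    rintro (hx' | hx')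
    · obtain ⟨e, he, hxe⟩ := mem_iUnion₂.1 hx'
      exact hcon e he hxe
    · exact hx'.2 rfl
  obtain ⟨ε, hε, hball⟩ := Metric.mem_nhds_iff.1 hO
  obtain ⟨y, hyB, hyF, hyx⟩ := frontier_not_isolated h.subset_closure_interior
    h.isCompact.isClosed hx hε
  refine hball hyB ?_
  by_cases hs : Straight (frontier P) y
  · obtain ⟨e, he, h1, h2⟩ := exists_minimalEdge_of_straight hN h.isCompact_frontier hl' hs
    exact Or.inl (mem_biUnion (⟨he, h1⟩ : e ∈ boundaryEdges N P) h2)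
  · exact Or.inr ⟨⟨hl' y hyF hs, hyF⟩, hyx⟩

theorem IsPolygon.exists_tiling {P : Set Plane} (h : IsPolygon P) {N : ℕ} (hN : 0 < N)
    (hl : ∀ v, IsVertex P v → v ∈ lattice N) : ∃ T, IsTiling N P T := by
  have hfin := h.finite_boundaryEdges hN
  obtain ⟨Ω, T, hT, hB, hS⟩ := exists_tiling_containing hN hfin.toFinset
    (fun s hs => (hfin.mem_toFinset.1 hs).1) (fun s hs s' hs' => by
      rw [hfin.mem_toFinset] at hs hs'
      exact frontierEdges_disjoint (fun v hv hs => hl v ⟨hv, hs⟩) hs.1 hs'.1 hs.2 hs'.2)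
    h.isCompact.isBounded
  refine ⟨_, hT.restrict hB h.isCompact.isClosed h.subset_closure_interior fun x hx => ?_⟩
  obtain ⟨e, he, hxe⟩ := h.exists_boundaryEdge hN hl hx
  exact ⟨e, hS (hfin.mem_toFinset.2 he), hxe⟩

/-! ### Tilings and triangulations -/

theorem IsSimplex.card_le {s : Finset Plane} (h : IsSimplex s) : s.card ≤ 3 := by
  have := h.2.card_le_finrank_succ
  have h1 := Submodule.finrank_le (vectorSpan ℝ (range fun p : s => (p : Plane)))
  simp only [Fintype.card_coe, Module.finrank_fin_fun] at this h1
  omega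

theorem interior_hull_eq_empty {s : Finset Plane} (h : IsSimplex s) (hc : s.card ≠ 3) :
    interior (hull s) = ∅ := by
  by_contra hne
  have h1 := interior_convexHull_nonempty_iff_affineSpan_eq_top.1 (nonempty_iff_ne_empty.2 hne)
  have h2 := h.2.affineSpan_eq_top_iff_card_eq_finrank_add_one
  rw [show range (fun p : s => (p : Plane)) = (s : Set Plane) by simp] at h2
  have h3 := h2.1 h1
  simp at h3
  exact hc h3

theorem interior_biUnion_eq_empty {S : Finset (Finset Plane)}
    (h : ∀ s ∈ S, interior (hull s) = ∅) : interior (⋃ s ∈ S, hull s) = ∅ := by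
  classical
  induction S using Finset.induction_on with
  | empty => simp
  | insert s S _ ih =>
    rw [Finset.set_biUnion_insert, interior_union_isClosed_of_interior_empty (isClosed_hull s)
      (ih fun t ht => h t (Finset.mem_insert_of_mem ht))]
    exact h s (Finset.mem_insert_self _ _)

theorem mem_facets {T : Finset (Finset Plane)} {t : Finset Plane} :
    t ∈ facets T ↔ t ∈ T ∧ t.card = 3 := Finset.mem_filter

/-- Points and segments have empty interior, so the closed triangles cover the interior of `P`,
which is dense. The triangulation is not assumed to be face to face. -/
theorem IsTriangulation.isDissection {P : Set Plane} (hP : IsPolygon P)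
    {T : Finset (Finset Plane)} (hT : IsTriangulation P T) : IsDissection P (facets T) := by
  classical
  have hcl : IsClosed (⋃ t ∈ facets T, hull t) :=
    (facets T).finite_toSet.isClosed_biUnion fun t _ => isClosed_hull t
  refine ⟨fun t ht => ⟨(mem_facets.1 ht).2, (hT.1 t (mem_facets.1 ht).1).1⟩,
    hT.2.1.subset fun t ht => (mem_facets.1 ht).1, Subset.antisymm ?_ ?_⟩
  · refine iUnion₂_subset fun t ht => ?_
    have ht' := (mem_facets.1 ht).1
    refine hull_subset_of_openSimplex_subset (hT.1 t ht').1.1 hP.isCompact.isClosed ?_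
    rw [← hT.2.2]; exact subset_biUnion_of_mem (u := fun t => openSimplex t) ht'
  · refine hP.subset_closure_interior.trans (closure_minimal ?_ hcl)
    have hO : IsOpen (interior P \ ⋃ t ∈ facets T, hull t) := isOpen_interior.sdiff hcl
    have hsub : interior P \ ⋃ t ∈ facets T, hull t ⊆
        ⋃ s ∈ T.filter (fun s => s.card ≠ 3), hull s := by
      rintro x ⟨hx, hx'⟩
      have hxP := interior_subset hx
      rw [← hT.2.2] at hxP
      obtain ⟨s, hs, hxs⟩ := mem_iUnion₂.1 hxP
      have hxs' := openSimplex_subset_hull s hxs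
      refine mem_biUnion (Finset.mem_coe.2 (Finset.mem_filter.2 ⟨hs, fun hc => hx' ?_⟩)) hxs'
      exact mem_biUnion (mem_facets.2 ⟨hs, hc⟩) hxs'
    have hemp := interior_maximal hsub hO
    rw [interior_biUnion_eq_empty fun s hs => interior_hull_eq_empty
      (hT.1 s (Finset.mem_filter.1 hs).1).1 (Finset.mem_filter.1 hs).2, subset_empty_iff,
      sdiff_eq_empty] at hemp
    exact hemp

theorem IsMinimalTriangulation.isTiling {N : ℕ} {P : Set Plane} (hP : IsPolygon P)
    {T : Finset (Finset Plane)} (hT : IsMinimalTriangulation N P T) : IsTiling N P (facets T) :=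
  ⟨hT.1.isDissection hP, hT.2⟩

/-- The simplicial complex of all faces of the triangles of `T`. -/
def faces (T : Finset (Finset Plane)) : Finset (Finset Plane) :=
  T.biUnion fun t => t.powerset.filter Finset.Nonempty

theorem mem_faces {T : Finset (Finset Plane)} {s : Finset Plane} :
    s ∈ faces T ↔ s.Nonempty ∧ ∃ t ∈ T, s ⊆ t := by
  simp only [faces, Finset.mem_biUnion, Finset.mem_filter, Finset.mem_powerset]
  exact ⟨fun ⟨t, h1, h2, h3⟩ => ⟨h3, t, h1, h2⟩, fun ⟨h1, t, h2, h3⟩ => ⟨t, h2, h3, h1⟩⟩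

theorem facets_faces {T : Finset (Finset Plane)} (hT : ∀ t ∈ T, t.card = 3) :
    facets (faces T) = T := by
  ext s
  rw [mem_facets, mem_faces]
  constructor
  · rintro ⟨⟨-, t, ht, hst⟩, hc⟩
    rwa [Finset.eq_of_subset_of_card_le hst (by rw [hT t ht, hc])]
  · intro hs
    exact ⟨⟨Finset.card_pos.1 (by rw [hT s hs]; norm_num), s, hs, Finset.Subset.rfl⟩, hT s hs⟩

theorem IsTiling.isTriangulation {N : ℕ} {P : Set Plane} {T : Finset (Finset Plane)}
    (hT : IsTiling N P T) : IsTriangulation P (faces T) := by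
  refine ⟨fun s hs => ?_, ?_, Subset.antisymm ?_ ?_⟩
  · obtain ⟨hn, t, ht, hst⟩ := mem_faces.1 hs
    exact ⟨(hT.2 t ht).2.1.subset hst hn, fun p hp => (hT.2 t ht).isRatTriangle.2.2 p (hst hp)⟩
  · intro s hs s' hs' hne
    obtain ⟨-, t, ht, hst⟩ := mem_faces.1 hs
    obtain ⟨-, t', ht', hst'⟩ := mem_faces.1 hs'
    exact disjoint_left.2 fun x hx hx' => hne (hT.face_eq ht ht' hst hst' hx hx')
  · refine iUnion₂_subset fun s hs => ?_
    obtain ⟨-, t, ht, hst⟩ := mem_faces.1 hs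
    exact (openSimplex_subset_hull s).trans ((hull_mono hst).trans (hT.hull_subset ht))
  · intro x hx
    obtain ⟨t, ht, hxt⟩ := hT.1.mem_iff.1 hx
    obtain ⟨f, hf, hfn, hxf⟩ := exists_face hxt
    exact mem_biUnion (mem_faces.2 ⟨hfn, t, ht, hf⟩) hxf

theorem IsTiling.isMinimalTriangulation {N : ℕ} {P : Set Plane} {T : Finset (Finset Plane)}
    (hT : IsTiling N P T) : IsMinimalTriangulation N P (faces T) := by
  refine ⟨hT.isTriangulation, ?_⟩
  rw [facets_faces fun t ht => (hT.2 t ht).1]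
  exact hT.2

/-- Any two minimal tilings are connected by flips, so the starting tiling in `dynSystem` is
immaterial. -/
theorem mem_dynSystem {N : ℕ} (hN : 0 < N) {P : Set Plane} (hP : IsPolygon P)
    {T : Finset (Finset Plane)} (hT : IsTiling N P T) {τ : Multiset (Multiset (ZMod N))} :
    τ ∈ dynSystem N P ↔ Relation.ReflTransGen (PseudoFlip N) (T.val.map (triangleWeight N)) τ := by
  constructor
  · rintro ⟨T', hT', h⟩
    exact (pseudoFlips_of_tilings hN hT (hT'.isTiling hP)).trans h
  · intro h
    refine ⟨faces T, hT.isMinimalTriangulation, ?_⟩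
    rwa [pseudoTriangulation, facets_faces fun t ht => (hT.2 t ht).1]

/-! ### Edges of tilings -/

/-- The third vertex of the triangle `t` on the edge `b c` lies on the side given by the sign of
`s`. -/
def OnSide (s : ℝ) (b c : Plane) (t : Finset Plane) : Prop :=
  ∃ a, t = {a, b, c} ∧ 0 < s * signedArea a b c

/-- A vector orthogonal to `b c`. -/
def normal (b c : Plane) : Plane := ![-(c 1 - b 1), c 0 - b 0]

theorem cross_normal {b c : Plane} (h : b ≠ c) : 0 < cross (c - b) (normal b c) := by
  have : cross (c - b) (normal b c) = (c 0 - b 0) ^ 2 + (c 1 - b 1) ^ 2 := by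
    simp [cross, normal]; ring
  rw [this]
  rcases eq_or_ne (b 0) (c 0) with h0 | h0
  · have : b 1 ≠ c 1 := fun h1 => h (plane_ext h0 h1)
    have := pow_pos (abs_pos.2 (sub_ne_zero.2 this.symm)) 2
    rw [sq_abs] at this; positivity
  · have := pow_pos (abs_pos.2 (sub_ne_zero.2 h0.symm)) 2
    rw [sq_abs] at this; positivity

theorem cross_smul_div {b c : Plane} (hbc : b ≠ c) {s D : ℝ} (h : 0 < s * D) :
    0 < cross (c - b) (s • normal b c) / D := by
  have e : cross (c - b) (s • normal b c) = s * cross (c - b) (normal b c) := by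
    simp only [cross, Pi.smul_apply, smul_eq_mul]; ring
  have hD : D ≠ 0 := by rintro rfl; simp at h
  have : s * cross (c - b) (normal b c) / D = s * D * cross (c - b) (normal b c) / D ^ 2 := by
    field_simp
  rw [e, this]
  have := cross_normal hbc
  positivity

theorem onSide_or {t : Finset Plane} (hc : t.card = 3) (hs : IsSimplex t) {b c : Plane}
    (hbc : b ≠ c) (h : {b, c} ⊆ t) {s : ℝ} (hs0 : s ≠ 0) : OnSide s b c t ∨ OnSide (-s) b c t := by
  obtain ⟨a, rfl, hD⟩ := exists_third hc hs hbc h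
  rcases lt_or_gt_of_ne (mul_ne_zero hs0 hD) with h | h
  · exact Or.inr ⟨a, rfl, by linarith⟩
  · exact Or.inl ⟨a, rfl, h⟩

theorem OnSide.eventually {s : ℝ} {b c : Plane} {t : Finset Plane} (h : OnSide s b c t)
    {x : Plane} (hx : x ∈ openSimplex {b, c}) :
    ∀ᶠ ε in 𝓝[>] (0 : ℝ), x + ε • (s • normal b c) ∈ openSimplex t := by
  obtain ⟨a, rfl, h⟩ := h
  have hD : signedArea a b c ≠ 0 := by intro h0; rw [h0] at h; simp at h
  exact eventually_mem_triangle hD hx (cross_smul_div (ne_of_signedArea_ne_zero hD).2.2 h)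

theorem OnSide.notMem {s : ℝ} {b c : Plane} {t : Finset Plane} (h : OnSide (-s) b c t)
    {x : Plane} (hx : x ∈ openSimplex {b, c}) {ε : ℝ} (hε : 0 < ε) :
    x + ε • (s • normal b c) ∉ hull t := by
  obtain ⟨a, rfl, h⟩ := h
  have hD : signedArea a b c ≠ 0 := by intro h0; rw [h0] at h; simp at h
  refine notMem_triangle hD hx ?_ hε
  have := cross_smul_div (ne_of_signedArea_ne_zero hD).2.2 h
  have e : cross (c - b) (-s • normal b c) = -cross (c - b) (s • normal b c) := by
    simp only [cross, Pi.smul_apply, smul_eq_mul]; ring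
  rw [e, neg_div] at this
  linarith

theorem IsDissection.eq_of_onSide {R : Set Plane} {T : Finset (Finset Plane)}
    (hT : IsDissection R T) {t t' : Finset Plane} (ht : t ∈ T) (ht' : t' ∈ T) {s : ℝ} {b c : Plane}
    (h : OnSide s b c t) (h' : OnSide s b c t') : t = t' := by
  obtain ⟨x, hx⟩ := openSimplex_nonempty (s := {b, c}) (by simp)
  obtain ⟨ε, h1, h2⟩ := ((h.eventually hx).and (h'.eventually hx)).exists
  exact (hT.eq_or_disjoint ht ht').resolve_right fun hd => disjoint_left.1 hd h1 h2

/-- Near `x` all sides other than `b c` impose open conditions that hold; the sign of `signedArea y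
b c` then decides which of the two triangles contains `y`. -/
theorem mem_interior_of_onSide {t t' : Finset Plane} {b c : Plane} (h : OnSide 1 b c t)
    (h' : OnSide (-1) b c t') {x : Plane} (hx : x ∈ openSimplex {b, c}) :
    x ∈ interior (hull t ∪ hull t') := by
  obtain ⟨a, rfl, h⟩ := h
  obtain ⟨a', rfl, h'⟩ := h'
  rw [one_mul] at h
  have h'' : signedArea a' b c < 0 := by linarith
  have hbc := (ne_of_signedArea_ne_zero h.ne').2.2
  have key : ∀ a : Plane, signedArea a b c ≠ 0 → ∀ᶠ y in 𝓝 x,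
      0 < signedArea a y c / signedArea a b c ∧ 0 < signedArea a b y / signedArea a b c := by
    intro a hD
    obtain ⟨r, h0, h1, rfl⟩ := (mem_openSimplex_pair hbc).1 hx
    have c1 : Continuous fun y => signedArea a y c / signedArea a b c := by
      simp only [signedArea]; fun_prop
    have c2 : Continuous fun y => signedArea a b y / signedArea a b c := by
      simp only [signedArea]; fun_prop
    have e1 : signedArea a (b + r • (c - b)) c = (1 - r) * signedArea a b c := by
      simp only [signedArea, Pi.add_apply, Pi.smul_apply, Pi.sub_apply, smul_eq_mul]; ring
    have e2 : signedArea a b (b + r • (c - b)) = r * signedArea a b c := by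
      simp only [signedArea, Pi.add_apply, Pi.smul_apply, Pi.sub_apply, smul_eq_mul]; ring
    refine (c1.continuousAt.eventually (lt_mem_nhds ?_)).and
      (c2.continuousAt.eventually (lt_mem_nhds ?_))
    · change 0 < signedArea a _ c / _
      rw [e1, mul_div_assoc, div_self hD]; linarith
    · change 0 < signedArea a b _ / _
      rw [e2, mul_div_assoc, div_self hD]; linarith
  rw [mem_interior_iff_mem_nhds]
  filter_upwards [key a h.ne', key a' h''.ne] with y h1 h2
  rcases le_total 0 (signedArea y b c) with h3 | h3
  · exact Or.inl ((mem_hull_iff_signedArea h.ne' y).2 ⟨div_nonneg h3 h.le, h1.1.le, h1.2.le⟩)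
  · exact Or.inr ((mem_hull_iff_signedArea h''.ne y).2
      ⟨div_nonneg_of_nonpos h3 h''.le, h2.1.le, h2.2.le⟩)

theorem IsTiling.subset_of_mem {N : ℕ} {R : Set Plane} {T : Finset (Finset Plane)}
    (hT : IsTiling N R T) {t e : Finset Plane} (ht : t ∈ T) (he : e ∈ edges T) {x : Plane}
    (hx : x ∈ openSimplex e) (hx' : x ∈ hull t) : e ⊆ t := by
  obtain ⟨t', ht', het', -⟩ := mem_edges.1 he
  obtain ⟨f, hf, -, hxf⟩ := exists_face hx'
  rwa [hT.face_eq ht' ht het' hf hx hxf]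

/-- A small step from `x` off the edge stays in `R` and so in one tile, which has the edge as a face
because minimal tilings are face to face. -/
theorem IsTiling.exists_onSide {N : ℕ} {R : Set Plane} {T : Finset (Finset Plane)}
    (hT : IsTiling N R T) {b c : Plane} (hbc : b ≠ c) (he : {b, c} ∈ edges T) {x : Plane}
    (hx : x ∈ openSimplex {b, c}) (hxi : x ∈ interior R) {s : ℝ} (hs : s ≠ 0) :
    ∃ t ∈ T, OnSide s b c t := by
  have h1 := ((tendsto_add_smul x (s • normal b c)).mono_left nhdsWithin_le_nhds
    (y := 𝓝[>] (0 : ℝ))).eventually (mem_interior_iff_mem_nhds.1 hxi)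
  obtain ⟨t, ht, hxt, hev⟩ := exists_common_tile hT.1 h1
  refine ⟨t, ht, ?_⟩
  rcases onSide_or (hT.1.1 t ht).1 (hT.1.1 t ht).2 hbc (hT.subset_of_mem ht he hx hxt) hs with h | h
  · exact h
  · have h2 : ∀ᶠ ε in 𝓝[>] (0 : ℝ), 0 < ε := self_mem_nhdsWithin
    obtain ⟨ε, h3, h4⟩ := (hev.and h2).exists
    exact absurd h3 (h.notMem hx h4)

open scoped Classical in
/-- An edge of a tiling lies in one triangle or in two, according to whether it lies in the
boundary. -/
theorem IsTiling.card_filter_subset {N : ℕ} {R : Set Plane} {T : Finset (Finset Plane)}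
    (hT : IsTiling N R T) {e : Finset Plane} (he : e ∈ edges T) :
    (T.filter fun t => e ⊆ t).card + (if hull e ⊆ frontier R then 1 else 0) = 2 := by
  obtain ⟨t₀, ht₀, het₀, hc⟩ := mem_edges.1 he
  obtain ⟨b, c, hbc, rfl⟩ := exists_pair hc
  have side := fun t ht h => onSide_or (t := t) (hT.1.1 t ht).1 (hT.1.1 t ht).2 hbc h one_ne_zero
  have hmem : ∀ {t s}, OnSide s b c t → {b, c} ⊆ t := by
    rintro t s ⟨a, rfl, -⟩; exact Finset.subset_insert _ _
  have hR : IsClosed R := by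
    rw [← hT.1.2.2]; exact T.finite_toSet.isClosed_biUnion fun t _ => isClosed_hull t
  split_ifs with hfr
  · suffices T.filter (fun t => {b, c} ⊆ t) = {t₀} by rw [this]; simp
    ext t
    rw [Finset.mem_filter, Finset.mem_singleton]
    refine ⟨fun ⟨ht, hbt⟩ => ?_, fun h => h ▸ ⟨ht₀, het₀⟩⟩
    obtain ⟨x, hx⟩ := openSimplex_nonempty (s := {b, c}) (by simp)
    have hxf := (hfr (openSimplex_subset_hull _ hx)).2
    have hno : ∀ t ∈ T, ∀ t' ∈ T, OnSide 1 b c t → OnSide (-1) b c t' → False := by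
      intro t ht t' ht' h1 h2
      exact hxf (interior_mono (union_subset (hT.hull_subset ht) (hT.hull_subset ht'))
        (mem_interior_of_onSide h1 h2 hx))
    rcases side t ht hbt with h1 | h1 <;> rcases side t₀ ht₀ het₀ with h2 | h2
    · exact hT.1.eq_of_onSide ht ht₀ h1 h2
    · exact (hno _ ht _ ht₀ h1 h2).elim
    · exact (hno _ ht₀ _ ht h2 h1).elim
    · exact hT.1.eq_of_onSide ht ht₀ h1 h2
  · obtain ⟨y, hy, hyf⟩ := not_subset.1 hfr
    have hyR : y ∈ R := hT.hull_subset ht₀ (hull_mono het₀ hy)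
    have hyi : y ∈ interior R := by
      by_contra h; exact hyf ⟨subset_closure hyR, h⟩
    obtain ⟨x, hxi, hx⟩ := meets_openSimplex isOpen_interior hy hyi
    obtain ⟨t, ht, h1⟩ := hT.exists_onSide hbc he hx hxi one_ne_zero
    obtain ⟨t', ht', h2⟩ := hT.exists_onSide hbc he hx hxi (neg_ne_zero.2 one_ne_zero)
    have hne : t ≠ t' := by
      rintro rfl
      obtain ⟨ε, h3, h4⟩ := ((h1.eventually hx).and
        (self_mem_nhdsWithin : ∀ᶠ ε in 𝓝[>] (0 : ℝ), 0 < ε)).exists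
      exact h2.notMem hx h4 (openSimplex_subset_hull _ h3)
    suffices T.filter (fun t => {b, c} ⊆ t) = {t, t'} by rw [this, Finset.card_pair hne]
    ext u
    rw [Finset.mem_filter, Finset.mem_insert, Finset.mem_singleton]
    constructor
    · rintro ⟨hu, hbu⟩
      rcases side u hu hbu with h | h
      · exact Or.inl (hT.1.eq_of_onSide hu ht h h1)
      · exact Or.inr (hT.1.eq_of_onSide hu ht' h h2)
    · rintro (rfl | rfl)
      · exact ⟨ht, hmem h1⟩
      · exact ⟨ht', hmem h2⟩

open scoped Classical in
theorem IsTiling.two_nsmul_sum_edges {M : Type*} [AddCommMonoid M] {N : ℕ} {R : Set Plane}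
    {T : Finset (Finset Plane)} (hT : IsTiling N R T) (f : Finset Plane → M) :
    2 • ∑ e ∈ edges T, f e = (∑ t ∈ T, ∑ e ∈ t.powersetCard 2, f e) +
      ∑ e ∈ (edges T).filter (fun e => hull e ⊆ frontier R), f e := by
  have h1 : ∑ t ∈ T, ∑ e ∈ t.powersetCard 2, f e =
      ∑ e ∈ edges T, ∑ t ∈ T.filter (fun t => e ⊆ t), f e := by
    refine Finset.sum_comm' fun t e => ?_
    rw [Finset.mem_powersetCard, Finset.mem_filter, mem_edges]
    exact ⟨fun ⟨h1, h2, h3⟩ => ⟨⟨h1, h2⟩, t, h1, h2, h3⟩,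
      fun ⟨⟨h1, h2⟩, _, _, _, h3⟩ => ⟨h1, h2, h3⟩⟩
  rw [h1, Finset.sum_filter, ← Finset.sum_add_distrib, Finset.smul_sum]
  refine Finset.sum_congr rfl fun e he => ?_
  have h2 := congrArg (fun n => n • f e) (hT.card_filter_subset he)
  simp only [add_smul, ite_smul, one_smul, zero_smul] at h2
  rw [Finset.sum_const, ← h2]

theorem infinite_openSimplex_pair {p q : Plane} (hpq : p ≠ q) : (openSimplex {p, q}).Infinite := by
  have : openSimplex {p, q} = (fun r : ℝ => p + r • (q - p)) '' Ioo 0 1 := by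
    ext x
    rw [mem_openSimplex_pair hpq]
    exact ⟨fun ⟨r, h0, h1, h⟩ => ⟨r, ⟨h0, h1⟩, h.symm⟩, fun ⟨r, ⟨h0, h1⟩, h⟩ => ⟨r, h0, h1, h.symm⟩⟩
  rw [this]
  refine (Ioo_infinite zero_lt_one).image ?_
  intro r _ r' _ h
  exact smul_left_injective ℝ (sub_ne_zero.2 hpq.symm) (add_left_cancel h)

/-- Pigeonhole: infinitely many points of `f` lie on finitely many segments, so two of them lie on
the same one, which is then parallel to `f`. -/
theorem exists_par_of_cover {f : Finset Plane} (hf : f.card = 2) {S : Set (Finset Plane)}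
    (hS : S.Finite) (hc : ∀ s ∈ S, s.card = 2) (h : ∀ x ∈ openSimplex f, ∃ s ∈ S, x ∈ hull s) :
    ∃ s ∈ S, Par f s ∧ ∃ x ∈ openSimplex f, x ∈ hull s := by
  choose! s hs hxs using h
  obtain ⟨p, q, hpq, rfl⟩ := exists_pair hf
  obtain ⟨x, hx, y, hy, hxy, hs'⟩ := (infinite_openSimplex_pair hpq).exists_ne_map_eq_of_mapsTo
    (fun x hx => hs x hx) hS
  exact ⟨s x, hs x hx, par_of_two_points hf (hc _ (hs x hx)) hxy (openSimplex_subset_hull _ hx)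
    (openSimplex_subset_hull _ hy) (hxs x hx) (hs' ▸ hxs y hy), x, hx, hxs x hx⟩

/-- Inner points of the edge are neither interior to a tile nor lattice points, so edges of tiles
cover them. One of these is parallel, and minimality makes it equal. -/
theorem IsTiling.mem_edges_of_frontier {N : ℕ} {R : Set Plane} {T : Finset (Finset Plane)}
    (hT : IsTiling N R T) {e : Finset Plane} (he : e ∈ boundaryEdges N R) : e ∈ edges T := by
  have hR : IsClosed R := by
    rw [← hT.1.2.2]; exact T.finite_toSet.isClosed_biUnion fun t _ => isClosed_hull t
  have key : ∀ x ∈ openSimplex e, ∃ s ∈ edges T, x ∈ openSimplex s := by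
    intro x hx
    have hxf := he.2 (openSimplex_subset_hull _ hx)
    obtain ⟨t, ht, hxt⟩ := hT.1.mem_iff.1 (hR.frontier_subset hxf)
    obtain ⟨s, hs, hsn, hxs⟩ := exists_face hxt
    refine ⟨s, mem_edges.2 ⟨t, ht, hs, ?_⟩, hxs⟩
    have m := hT.2 t ht
    have h3 : s.card ≤ 3 := m.1 ▸ Finset.card_le_card hs
    have h1 : s.card ≠ 1 := by
      intro h1
      obtain ⟨p, rfl⟩ := Finset.card_eq_one.1 h1
      rw [openSimplex_singleton, mem_singleton_iff] at hxs
      exact he.1.2.notMem_openSimplex he.1.1.ge (m.2.mem_lattice (by simpa using hs)) (hxs ▸ hx)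
    have h2 : s.card ≠ 3 := by
      intro h3
      have := Finset.eq_of_subset_of_card_le hs (by rw [h3, m.1])
      rw [this] at hxs
      exact hxf.2 (interior_mono (hT.hull_subset ht) (openSimplex_subset_interior m.1 m.2.1 hxs))
    have := hsn.card_pos
    omega
  obtain ⟨s, hs, hpar, x, hx, hxs⟩ := exists_par_of_cover he.1.1 (edges T).finite_toSet
    (fun s hs => (hT.isMinimalEdge hs).1) fun x hx =>
      (key x hx).imp fun s hs => ⟨hs.1, openSimplex_subset_hull _ hs.2⟩
  rwa [he.1.eq_of_par (hT.isMinimalEdge hs) hx hxs hpar]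

/-! ### Minimal edges of the boundary at different levels -/

open scoped Classical in
/-- The `N`-minimal edges inside `R` (if there are finitely many). -/
def minimalIn (N : ℕ) (R : Set Plane) : Finset (Finset Plane) :=
  if h : {e : Finset Plane | IsMinimalEdge N e ∧ hull e ⊆ R}.Finite then h.toFinset else ∅

theorem mem_minimalIn {N : ℕ} (hN : 0 < N) {R : Set Plane} (hR : Bornology.IsBounded R)
    {e : Finset Plane} : e ∈ minimalIn N R ↔ IsMinimalEdge N e ∧ hull e ⊆ R := by
  rw [minimalIn, dif_pos (finite_minimalEdges hN hR), Set.Finite.mem_toFinset]; rfl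

theorem mem_minimalIn_hull {N : ℕ} (hN : 0 < N) {e f : Finset Plane} :
    f ∈ minimalIn N (hull e) ↔ IsMinimalEdge N f ∧ hull f ⊆ hull e :=
  mem_minimalIn hN (isCompact_hull e).isBounded

theorem IsPolygon.mem_minimalIn {P : Set Plane} (h : IsPolygon P) {N : ℕ} (hN : 0 < N)
    {e : Finset Plane} : e ∈ minimalIn N (frontier P) ↔ e ∈ boundaryEdges N P :=
  DiscreteEquidecomp.mem_minimalIn hN h.isCompact_frontier.isBounded

theorem openSimplex_subset_of_hull_subset {N d : ℕ} (hN : 0 < N) (hd : d ∣ N) {e f : Finset Plane}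
    (hf : IsMinimalEdge N f) (he : IsMinimalEdge d e) (h : hull f ⊆ hull e) :
    openSimplex f ⊆ openSimplex e := by
  obtain ⟨x, hx⟩ := openSimplex_nonempty hf.2.1.1
  exact hf.subset_of_par he.1 (fun p hp => lattice_mono hN hd (he.2.mem_lattice hp)) hx
    (h (openSimplex_subset_hull _ hx)) (par_of_subset_hull he.1 he.1 (par_self he.1) h Subset.rfl)

theorem IsMinimalEdge.eq_of_hull_subset {N d : ℕ} (hN : 0 < N) (hd : d ∣ N) {e e' f : Finset Plane}
    (hf : IsMinimalEdge N f) (he : IsMinimalEdge d e) (he' : IsMinimalEdge d e')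
    (h : hull f ⊆ hull e) (h' : hull f ⊆ hull e') : e = e' := by
  obtain ⟨x, hx⟩ := openSimplex_nonempty hf.2.1.1
  have h1 := openSimplex_subset_of_hull_subset hN hd hf he h hx
  obtain ⟨p, q, hpq, rfl⟩ := exists_pair hf.1
  refine he.eq_of_par he' h1 (h' (openSimplex_subset_hull _ hx)) (par_of_two_points he.1 he'.1 hpq
    (h (mem_hull_of_mem (by simp))) (h (mem_hull_of_mem (by simp)))
    (h' (mem_hull_of_mem (by simp))) (h' (mem_hull_of_mem (by simp))))

/-- Every boundary edge of the fine level lies in exactly one boundary edge of the coarse level. -/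
theorem IsPolygon.sum_boundaryEdges {M : Type*} [AddCommMonoid M] {P : Set Plane}
    (h : IsPolygon P) {N d : ℕ} (hN : 0 < N) (hd : 0 < d) (hdN : d ∣ N)
    (hl : ∀ v, IsVertex P v → v ∈ lattice d) (φ : Finset Plane → M) :
    ∑ f ∈ minimalIn N (frontier P), φ f =
      ∑ e ∈ minimalIn d (frontier P), ∑ f ∈ minimalIn N (hull e), φ f := by
  classical
  have hu : minimalIn N (frontier P) =
      (minimalIn d (frontier P)).biUnion fun e => minimalIn N (hull e) := by
    ext f
    simp only [Finset.mem_biUnion, h.mem_minimalIn hN, h.mem_minimalIn hd, mem_minimalIn_hull hN]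
    constructor
    · intro hf
      obtain ⟨e, he, hpar, x, hx, hxe⟩ := exists_par_of_cover hf.1.1 (h.finite_boundaryEdges hd)
        (fun s hs => hs.1.1)
        (fun x hx => h.exists_boundaryEdge hd hl (hf.2 (openSimplex_subset_hull _ hx)))
      refine ⟨e, he, hf.1, hull_subset_of_openSimplex_subset hf.1.2.1.1 (isClosed_hull e) ?_⟩
      exact (hf.1.subset_of_par he.1.1 (fun p hp => lattice_mono hN hdN (he.1.2.mem_lattice hp)) hx
        hxe hpar).trans (openSimplex_subset_hull e)
    · rintro ⟨e, he, hf, hfe⟩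
      exact ⟨hf, hfe.trans he.2⟩
  rw [hu, Finset.sum_biUnion]
  intro e he e' he' hne
  refine Finset.disjoint_left.2 fun f hf hf' => hne ?_
  rw [mem_minimalIn_hull hN] at hf hf'
  exact IsMinimalEdge.eq_of_hull_subset hN hdN hf.1 ((h.mem_minimalIn hd).1 he).1
    ((h.mem_minimalIn hd).1 he').1 hf.2 hf'.2

/-! ### Classes of boundary edges and change of level -/

/-- The multiset of the `G`-classes of the members of `A`. -/
def classes (A : Finset (Finset Plane)) : Multiset (Set (Finset Plane)) := A.val.map gClass

theorem gEq_of_classes_eq {A B : Multiset (Finset Plane)} (h : A.map gClass = B.map gClass) :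
    GEq A B := by
  rw [← Multiset.rel_eq, Multiset.rel_map] at h
  exact h.mono fun a _ b _ hab => gClass_eq_iff.1 hab

theorem GEq.map_eq {α : Type*} {A B : Multiset (Finset Plane)} (h : GEq A B)
    {φ : Finset Plane → α} (hφ : ∀ a ∈ A, ∀ b ∈ B, GEquiv a b → φ a = φ b) :
    A.map φ = B.map φ := by
  rw [← Multiset.rel_eq, Multiset.rel_map]
  exact h.mono hφ

theorem classes_eq_sum (A : Finset (Finset Plane)) : classes A = ∑ e ∈ A, {gClass e} := by
  rw [classes, Finset.sum, ← Multiset.sum_map_singleton (A.val.map gClass), Multiset.map_map]; rfl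

theorem sum_eq_of_classes_eq {M : Type*} [AddCommMonoid M] {A B : Finset (Finset Plane)}
    (h : classes A = classes B) {φ : Finset Plane → M}
    (hφ : ∀ a ∈ A, ∀ b ∈ B, GEquiv a b → φ a = φ b) : ∑ a ∈ A, φ a = ∑ b ∈ B, φ b :=
  congrArg Multiset.sum ((gEq_of_classes_eq h).map_eq hφ)

theorem minimalIn_image_of_bounded {N : ℕ} (hN : 0 < N) (g : GMap) {R R' : Set Plane}
    (hR : Bornology.IsBounded R) (hR' : Bornology.IsBounded R') (h : R' = g.act '' R) :
    minimalIn N R' = (minimalIn N R).image fun f => f.image g.act := by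
  ext f
  rw [mem_minimalIn hN hR', Finset.mem_image]
  subst h
  constructor
  · rintro ⟨h1, h2⟩
    obtain ⟨k, hk, hk'⟩ := g.exists_inv
    refine ⟨f.image k.act, (mem_minimalIn hN hR).2 ⟨k.isMinimalEdge_image hN h1, ?_⟩, ?_⟩
    · rw [k.hull_image]
      rintro _ ⟨x, hx, rfl⟩
      obtain ⟨y, hy, rfl⟩ := h2 hx
      rwa [hk]
    · exact GMap.image_image_inv hk' f
  · rintro ⟨f, hf, rfl⟩
    rw [mem_minimalIn hN hR] at hf
    refine ⟨g.isMinimalEdge_image hN hf.1, ?_⟩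
    rw [g.hull_image]
    exact image_mono hf.2

theorem minimalIn_image {N : ℕ} (hN : 0 < N) (g : GMap) (e : Finset Plane) :
    minimalIn N (hull (e.image g.act)) = (minimalIn N (hull e)).image fun f => f.image g.act :=
  minimalIn_image_of_bounded hN g (isCompact_hull e).isBounded (isCompact_hull _).isBounded
    (g.hull_image e)

theorem gClass_image (g : GMap) (s : Finset Plane) : gClass (s.image g.act) = gClass s :=
  gClass_eq_iff.2 (GEquiv.symm ⟨g, rfl⟩)

theorem IsPolygon.classes_eq_of_dvd {P Q : Set Plane} (hP : IsPolygon P) (hQ : IsPolygon Q)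
    {N d : ℕ} (hN : 0 < N) (hd : 0 < d) (hdN : d ∣ N) (hlP : ∀ v, IsVertex P v → v ∈ lattice d)
    (hlQ : ∀ v, IsVertex Q v → v ∈ lattice d)
    (h : classes (minimalIn d (frontier P)) = classes (minimalIn d (frontier Q))) :
    classes (minimalIn N (frontier P)) = classes (minimalIn N (frontier Q)) := by
  rw [classes_eq_sum, classes_eq_sum, hP.sum_boundaryEdges hN hd hdN hlP,
    hQ.sum_boundaryEdges hN hd hdN hlQ]
  refine sum_eq_of_classes_eq h ?_
  rintro e - _ - ⟨g, rfl⟩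
  rw [minimalIn_image hN, Finset.sum_image g.image_injective.injOn]
  exact Finset.sum_congr rfl fun f _ => by rw [gClass_image]

/-- The union of the classes of the `d`-minimal edges that contain `f`. -/
def coverClass (d : ℕ) (f : Finset Plane) : Set (Finset Plane) :=
  ⋃ e ∈ {e : Finset Plane | IsMinimalEdge d e ∧ hull f ⊆ hull e}, gClass e

/-- Only one `d`-minimal edge contains `f`. Forming the union avoids choosing it and makes
invariance under `G` evident. -/
theorem coverClass_eq {N d : ℕ} (hN : 0 < N) (hd : d ∣ N) {e f : Finset Plane}
    (hf : IsMinimalEdge N f) (he : IsMinimalEdge d e) (h : hull f ⊆ hull e) :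
    coverClass d f = gClass e := by
  have : {e : Finset Plane | IsMinimalEdge d e ∧ hull f ⊆ hull e} = {e} := by
    ext e'
    exact ⟨fun h' => hf.eq_of_hull_subset hN hd h'.1 he h'.2 h, fun h' => by
      rw [mem_singleton_iff.1 h']; exact ⟨he, h⟩⟩
  rw [coverClass, this, biUnion_singleton]

theorem coverClass_image {d : ℕ} (hd : 0 < d) (g : GMap) (f : Finset Plane) :
    coverClass d (f.image g.act) = coverClass d f := by
  have key : ∀ (g : GMap) (f : Finset Plane), coverClass d f ⊆ coverClass d (f.image g.act) := by
    intro g f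
    refine iUnion₂_subset fun e he => ?_
    rw [← gClass_image g e]
    refine subset_biUnion_of_mem (u := fun e => gClass e) (x := e.image g.act)
      ⟨g.isMinimalEdge_image hd he.1, ?_⟩
    rw [g.hull_image, g.hull_image]
    exact image_mono he.2
  refine Subset.antisymm ?_ (key g f)
  obtain ⟨k, hk, -⟩ := g.exists_inv
  have h := key k (f.image g.act)
  rwa [GMap.image_image_inv hk] at h

/-- The segment `f` has an endpoint in the lattice of level `d`. -/
def IsEnd (d : ℕ) (f : Finset Plane) : Prop := ∃ p ∈ f, p ∈ lattice d

theorem isEnd_image {d : ℕ} (hd : 0 < d) (g : GMap) (f : Finset Plane) :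
    IsEnd d (f.image g.act) ↔ IsEnd d f := by
  constructor
  · rintro ⟨q, hq, hl⟩
    obtain ⟨p, hp, rfl⟩ := Finset.mem_image.1 hq
    exact ⟨p, hp, (g.mem_lattice_iff hd).1 hl⟩
  · rintro ⟨p, hp, hl⟩
    exact ⟨_, Finset.mem_image_of_mem _ hp, (g.mem_lattice_iff hd).2 hl⟩

/-- Of two minimal pieces starting at `p`, the endpoint of the shorter would be a lattice point
inside the longer. -/
theorem exists_unique_end {N d : ℕ} (hN : 0 < N) (hd : d ∣ N) {p q : Plane} (hpq : p ≠ q)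
    (he : IsMinimalEdge d {p, q}) :
    ∃ f, (IsMinimalEdge N f ∧ hull f ⊆ hull {p, q} ∧ p ∈ f) ∧
      ∀ f', IsMinimalEdge N f' → hull f' ⊆ hull {p, q} → p ∈ f' → f' = f := by
  have hp := lattice_mono hN hd (he.2.mem_lattice (p := p) (by simp))
  have hq := lattice_mono hN hd (he.2.mem_lattice (p := q) (by simp))
  obtain ⟨f, hf, hfs, hpf⟩ := exists_minimal_subsegment hN hpq hp hq
    (mem_hull_of_mem (p := p) (by simp))
  have hpf' := hf.2.mem_of_mem_hull hpf hp
  refine ⟨f, ⟨hf, hfs, hpf'⟩, ?_⟩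
  have key : ∀ f, IsMinimalEdge N f → hull f ⊆ hull {p, q} → p ∈ f →
      ∃ r : ℝ, 0 < r ∧ f = {p, p + r • (q - p)} := by
    intro f hf hfs hpf
    obtain ⟨a, b, hab, rfl⟩ := exists_pair hf.1
    have key2 : ∀ b : Plane, b ≠ p → b ∈ hull {p, q} → ∃ r : ℝ, 0 < r ∧ b = p + r • (q - p) := by
      intro b hb hbh
      obtain ⟨r, h0, -, rfl⟩ := mem_hull_pair.1 hbh
      refine ⟨r, lt_of_le_of_ne h0 ?_, rfl⟩
      rintro rfl
      simp at hb
    rcases Finset.mem_insert.1 hpf with rfl | hpb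
    · obtain ⟨r, hr, h⟩ := key2 b hab.symm (hfs (mem_hull_of_mem (by simp)))
      exact ⟨r, hr, by rw [h]⟩
    · rw [Finset.mem_singleton] at hpb
      subst hpb
      obtain ⟨r, hr, h⟩ := key2 a hab (hfs (mem_hull_of_mem (by simp)))
      exact ⟨r, hr, by rw [h, Finset.pair_comm]⟩
  have hne : ∀ r : ℝ, 0 < r → p + r • (q - p) ≠ p := by
    intro r hr h
    rcases smul_eq_zero.1 (left_eq_add.1 h.symm) with h | h
    · exact hr.ne' h
    · exact hpq (sub_eq_zero.1 h).symm
  have key3 : ∀ r s : ℝ, 0 < r → r ≤ s → IsMinimalEdge N {p, p + r • (q - p)} →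
      IsMinimalEdge N {p, p + s • (q - p)} →
      ({p, p + r • (q - p)} : Finset Plane) = {p, p + s • (q - p)} := by
    intro r s hr hrs h1 h2
    have hs : 0 < s := hr.trans_le hrs
    have := h2.2.mem_of_mem_hull (p := p + r • (q - p)) (mem_hull_pair.2 ⟨r / s, by positivity,
      (div_le_one hs).2 hrs, by
        rw [add_sub_cancel_left, smul_smul, div_mul_cancel₀ _ hs.ne']⟩)
      (h1.2.mem_lattice (by simp))
    rcases Finset.mem_insert.1 this with h | h
    · exact absurd h (hne r hr)
    · rw [Finset.mem_singleton.1 h]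
  intro f' hf' hfs' hpf''
  obtain ⟨r, hr, rfl⟩ := key f hf hfs hpf'
  obtain ⟨s, hs, rfl⟩ := key f' hf' hfs' hpf''
  rcases le_total r s with h | h
  · exact (key3 r s hr h hf hf').symm
  · exact key3 s r hs h hf' hf

open scoped Classical in
/-- The class of the `d`-minimal edge of which `f` is an end piece. -/
def endClass (d : ℕ) (f : Finset Plane) : Multiset (Set (Finset Plane)) :=
  if IsEnd d f then {coverClass d f} else 0

/-- The factor `2` in `2 * d ∣ N` makes the midpoint of `e` a lattice point of level `N`, so that
`e` has two different end pieces, each of which contributes the class of `e` once. -/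
theorem sum_endClass {N d : ℕ} (hN : 0 < N) (hd : 0 < d) (hdN : 2 * d ∣ N) {e : Finset Plane}
    (he : IsMinimalEdge d e) :
    ∑ f ∈ minimalIn N (hull e), endClass d f = 2 • {gClass e} := by
  classical
  have hdN' : d ∣ N := (Dvd.intro_left 2 rfl).trans hdN
  have h1 : ∀ f ∈ minimalIn N (hull e), endClass d f = if IsEnd d f then {gClass e} else 0 := by
    intro f hf
    rw [mem_minimalIn_hull hN] at hf
    rw [endClass, coverClass_eq hN hdN' hf.1 he hf.2]
  rw [Finset.sum_congr rfl h1, ← Finset.sum_filter, Finset.sum_const]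
  congr 1
  obtain ⟨p, q, hpq, rfl⟩ := exists_pair he.1
  obtain ⟨f, ⟨hf1, hf2, hf3⟩, hfu⟩ := exists_unique_end hN hdN' hpq he
  rw [Finset.pair_comm] at he hf2
  obtain ⟨f', ⟨hf1', hf2', hf3'⟩, hfu'⟩ := exists_unique_end hN hdN' hpq.symm he
  rw [Finset.card_eq_two]
  have hp := he.2.mem_lattice (p := p) (by simp)
  have hq := he.2.mem_lattice (p := q) (by simp)
  refine ⟨f, f', ?_, ?_⟩
  · rintro rfl
    have hfe : {p, q} = f := by
      apply Finset.eq_of_subset_of_card_le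
      · exact Finset.insert_subset hf3 (Finset.singleton_subset_iff.2 hf3')
      · rw [hf1.1, Finset.card_pair hpq]
    rw [← hfe] at hf1
    have hmid : p + (1 / 2 : ℝ) • (q - p) ∈ lattice N := by
      refine lattice_mono hN hdN ?_
      rw [mem_lattice_iff (by omega)]
      obtain ⟨a, b, ha, hb⟩ := (mem_lattice_iff hd).1 hp
      obtain ⟨a', b', ha', hb'⟩ := (mem_lattice_iff hd).1 hq
      refine ⟨a + a', b + b', ?_, ?_⟩
      · push_cast
        rw [← ha, ← ha']
        simp only [Pi.add_apply, Pi.smul_apply, Pi.sub_apply, smul_eq_mul]; ring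
      · push_cast
        rw [← hb, ← hb']
        simp only [Pi.add_apply, Pi.smul_apply, Pi.sub_apply, smul_eq_mul]; ring
    exact hf1.2.notMem_openSimplex hf1.1.ge hmid
      ((mem_openSimplex_pair hpq).2 ⟨1 / 2, by norm_num, by norm_num, rfl⟩)
  · ext s
    rw [Finset.mem_filter, mem_minimalIn_hull hN, Finset.mem_insert, Finset.mem_singleton]
    constructor
    · rintro ⟨⟨h2, h3⟩, x, hx, hxl⟩
      have := he.2.mem_of_mem_hull (by rw [Finset.pair_comm]; exact h3 (mem_hull_of_mem hx)) hxl
      rcases Finset.mem_insert.1 this with rfl | h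
      · right; exact hfu' s h2 (by rw [Finset.pair_comm]; exact h3) hx
      · rw [Finset.mem_singleton] at h
        subst h
        left; exact hfu s h2 h3 hx
    · rw [Finset.pair_comm] at hf2 hf2'
      rintro (rfl | rfl)
      · exact ⟨⟨hf1, hf2⟩, p, hf3, hp⟩
      · exact ⟨⟨hf1', hf2'⟩, q, hf3', hq⟩

theorem two_nsmul_injective {α : Type*} {A B : Multiset α} (h : 2 • A = 2 • B) : A = B := by
  classical
  ext a
  have := congrArg (Multiset.count a) h
  simp only [Multiset.count_nsmul] at this
  omega

/-- Fine edges remember the class of the coarse edge through `endClass`, an invariant of `G`;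
summing it counts every coarse class twice. -/
theorem IsPolygon.classes_eq_of_mul_dvd {P Q : Set Plane} (hP : IsPolygon P) (hQ : IsPolygon Q)
    {N d : ℕ} (hN : 0 < N) (hd : 0 < d) (hdN : 2 * d ∣ N) (hlP : ∀ v, IsVertex P v → v ∈ lattice d)
    (hlQ : ∀ v, IsVertex Q v → v ∈ lattice d)
    (h : classes (minimalIn N (frontier P)) = classes (minimalIn N (frontier Q))) :
    classes (minimalIn d (frontier P)) = classes (minimalIn d (frontier Q)) := by
  have hdN' : d ∣ N := (Dvd.intro_left 2 rfl).trans hdN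
  have h1 : ∑ f ∈ minimalIn N (frontier P), endClass d f =
      ∑ f ∈ minimalIn N (frontier Q), endClass d f := by
    refine sum_eq_of_classes_eq h ?_
    rintro f - _ - ⟨g, rfl⟩
    have := isEnd_image hd g f
    by_cases h0 : IsEnd d f
    · rw [endClass, endClass, coverClass_image hd, if_pos h0, if_pos (this.2 h0)]
    · rw [endClass, endClass, if_neg h0, if_neg fun h1 => h0 (this.1 h1)]
  have key : ∀ {P : Set Plane}, IsPolygon P → (∀ v, IsVertex P v → v ∈ lattice d) →
      ∑ f ∈ minimalIn N (frontier P), endClass d f = 2 • classes (minimalIn d (frontier P)) := by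
    intro P hP hl
    rw [hP.sum_boundaryEdges hN hd hdN' hl, classes_eq_sum, Finset.smul_sum]
    exact Finset.sum_congr rfl fun e he => sum_endClass hN hd hdN ((hP.mem_minimalIn hd).1 he).1
  rw [key hP hlP, key hQ hlQ] at h1
  exact two_nsmul_injective h1

theorem IsPolygon.polygonWeight_eq {P : Set Plane} (hP : IsPolygon P) {d : ℕ} (hd : 0 < d) :
    polygonWeight d P = (minimalIn d (frontier P)).val.map (edgeWeight d) := by
  have h1 : {e : Finset Plane | IsMinimalEdge d e ∧ convexHull ℝ (e : Set Plane) ⊆ frontier P} =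
      (minimalIn d (frontier P) : Set (Finset Plane)) := by
    ext e; exact (hP.mem_minimalIn hd).symm
  rw [polygonWeight, h1, finsum_mem_coe_finset, Finset.sum,
    ← Multiset.sum_map_singleton (Multiset.map (edgeWeight d) _), Multiset.map_map]
  rfl

theorem polygonWeight_eq_iff {P Q : Set Plane} (hP : IsPolygon P) (hQ : IsPolygon Q) {d : ℕ}
    (hd : 0 < d) : polygonWeight d P = polygonWeight d Q ↔
      classes (minimalIn d (frontier P)) = classes (minimalIn d (frontier Q)) := by
  rw [hP.polygonWeight_eq hd, hQ.polygonWeight_eq hd]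
  constructor
  · intro h
    have := congrArg (Multiset.map Prod.snd) h
    rwa [Multiset.map_map, Multiset.map_map] at this
  · intro h
    refine (gEq_of_classes_eq h).map_eq fun e he f hf hef => ?_
    exact (edgeWeight_eq_iff hd
      (fun p hp => ((hP.mem_minimalIn hd).1 he).1.2.mem_lattice hp)
      (fun p hp => ((hQ.mem_minimalIn hd).1 hf).1.2.mem_lattice hp)).2 (gClass_eq_iff.2 hef)

/-! ### Lattice points -/

/-- The least positive level of a lattice that contains `x`. -/
def pointDen (x : Plane) : ℕ := sInf {k : ℕ | 0 < k ∧ x ∈ lattice k}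

theorem pointDen_spec {N : ℕ} (hN : 0 < N) {x : Plane} (hx : x ∈ lattice N) :
    0 < pointDen x ∧ x ∈ lattice (pointDen x) :=
  Nat.sInf_mem (s := {k : ℕ | 0 < k ∧ x ∈ lattice k}) ⟨N, hN, hx⟩

theorem mem_lattice_gcd {a b : ℕ} (ha : 0 < a) (hb : 0 < b) {x : Plane} (hxa : x ∈ lattice a)
    (hxb : x ∈ lattice b) : x ∈ lattice (a.gcd b) := by
  obtain ⟨m, n, hm, hn⟩ := (mem_lattice_iff ha).1 hxa
  obtain ⟨m', n', hm', hn'⟩ := (mem_lattice_iff hb).1 hxb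
  refine (mem_lattice_iff (Nat.gcd_pos_of_pos_left b ha)).2
    ⟨a.gcdA b * m + a.gcdB b * m', a.gcdA b * n + a.gcdB b * n', ?_, ?_⟩
  all_goals
    have h : ((a.gcd b : ℤ) : ℝ) = ((a * a.gcdA b + b * a.gcdB b : ℤ) : ℝ) := by
      exact_mod_cast Nat.gcd_eq_gcd_ab a b
    push_cast at h ⊢
    rw [h]
  · rw [← hm, ← hm']; ring
  · rw [← hn, ← hn']; ring

theorem pointDen_dvd_iff {N : ℕ} (hN : 0 < N) {x : Plane} (hx : x ∈ lattice N) {k : ℕ}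
    (hk : 0 < k) : pointDen x ∣ k ↔ x ∈ lattice k := by
  obtain ⟨h0, h1⟩ := pointDen_spec hN hx
  refine ⟨fun h => lattice_mono hk h h1, fun h => ?_⟩
  have h2 := mem_lattice_gcd h0 hk h1 h
  have h3 : pointDen x ≤ (pointDen x).gcd k :=
    Nat.sInf_le (s := {k : ℕ | 0 < k ∧ x ∈ lattice k}) ⟨Nat.gcd_pos_of_pos_left k h0, h2⟩
  have h4 : (pointDen x).gcd k = pointDen x :=
    le_antisymm (Nat.le_of_dvd h0 (Nat.gcd_dvd_left _ _)) h3
  exact h4 ▸ Nat.gcd_dvd_right _ _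

/-- A Bézout relation completes to a matrix of determinant `1` that takes `(a', b')` to `(1, 0)`. -/
theorem gEquiv_singleton_of_isCoprime {k : ℕ} (hk : 0 < k) {a b a' b' g : ℤ}
    (h : IsCoprime a' b') (ha : a = g * a') (hb : b = g * b') :
    GEquiv {latticePoint k a b} {latticePoint k g 0} := by
  obtain ⟨u, v, huv⟩ := h
  have hk' : (k : ℝ) ≠ 0 := by positivity
  refine ⟨GMap.ofCoeffs u v (-b') a' 0 0 (Or.inl (by linear_combination huv)), ?_⟩
  rw [Finset.image_singleton]
  have huv' : (u * a' + v * b' : ℝ) = 1 := by exact_mod_cast huv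
  congr 1
  apply plane_ext
  · rw [GMap.ofCoeffs_zero]
    simp only [latticePoint, Matrix.cons_val_zero, Matrix.cons_val_one, Matrix.cons_val_fin_one]
    rw [ha, hb]; push_cast
    field_simp
    linear_combination (g : ℝ) * huv'
  · rw [GMap.ofCoeffs_one]
    simp only [latticePoint, Matrix.cons_val_zero, Matrix.cons_val_one, Matrix.cons_val_fin_one]
    rw [ha, hb]; push_cast
    field_simp
    ring

/-- With `k` the exact denominator, `(a, b) / k` is carried to `(g, 0) / k`, shifted to `(g, k) /
k`, and carried on to `(1, 0) / k`, as `g` and `k` are coprime by minimality of `k`. So lattice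
points are classified by their denominators. -/
theorem gClass_singleton {N : ℕ} (hN : 0 < N) {x : Plane} (hx : x ∈ lattice N) :
    gClass {x} = gClass {latticePoint (pointDen x) 1 0} := by
  rw [gClass_eq_iff]
  obtain ⟨hk, hxk⟩ := pointDen_spec hN hx
  set k := pointDen x with hkdef
  obtain ⟨a, b, ha, hb⟩ := (mem_lattice_iff hk).1 hxk
  have hk' : (k : ℝ) ≠ 0 := by positivity
  have hxe : x = latticePoint k a b := by
    apply plane_ext
    · simp only [latticePoint, Matrix.cons_val_zero]; rw [← ha]; field_simp
    · simp only [latticePoint, Matrix.cons_val_one, Matrix.cons_val_fin_one]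
      rw [← hb]; field_simp
  obtain ⟨g, a', b', hcop, ha', hb'⟩ : ∃ g a' b' : ℤ, IsCoprime a' b' ∧ a = g * a' ∧ b = g * b' := by
    by_cases h0 : a = 0 ∧ b = 0
    -- The origin has no primitive direction, so one is chosen; then `g = 0`, and its coprimality to
    -- `k` amounts to `k = 1`.
    · exact ⟨0, 1, 0, isCoprime_one_left, by rw [h0.1]; simp, by rw [h0.2]; simp⟩
    · have hg : 0 < Int.gcd a b := Int.gcd_pos_iff.2 (by tauto)
      obtain ⟨a', b', h1, h2, h3⟩ := Int.exists_gcd_one hg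
      exact ⟨Int.gcd a b, a', b', Int.isCoprime_iff_gcd_eq_one.2 h1, by rw [mul_comm]; exact h2,
        by rw [mul_comm]; exact h3⟩
  have h1 := gEquiv_singleton_of_isCoprime hk hcop ha' hb'
  have h2 : GEquiv {latticePoint k g 0} {latticePoint k g k} := by
    refine ⟨GMap.ofCoeffs 1 0 0 1 0 1 (by norm_num), ?_⟩
    rw [Finset.image_singleton]
    congr 1
    apply plane_ext
    · rw [GMap.ofCoeffs_zero]; simp [latticePoint]
    · rw [GMap.ofCoeffs_one]; simp [latticePoint, hk']
  have hgk : IsCoprime g (k : ℤ) := by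
    rw [Int.isCoprime_iff_gcd_eq_one]
    set c := Int.gcd g k with hc
    have hc0 : 0 < c := Int.gcd_pos_iff.2 (Or.inr (by omega))
    obtain ⟨g', hg'⟩ := Int.gcd_dvd_left g (k : ℤ)
    have hck : c ∣ k := by
      have := Int.gcd_dvd_right g (k : ℤ)
      rw [← hc] at this
      exact_mod_cast this
    obtain ⟨k', hk'2⟩ := hck
    have hk'0 : 0 < k' := Nat.pos_of_ne_zero (by rintro rfl; omega)
    have hc' : (c : ℝ) ≠ 0 := by positivity
    have hmem : x ∈ lattice k' := by
      have hgr : (g : ℝ) = c * g' := by rw [← hc] at hg'; exact_mod_cast hg'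
      have hkr : (k : ℝ) = c * k' := by exact_mod_cast hk'2
      refine (mem_lattice_iff hk'0).2 ⟨g' * a', g' * b', ?_, ?_⟩
      · apply mul_left_cancel₀ hc'
        rw [← mul_assoc, ← hkr, ha, ha']; push_cast; rw [hgr]; ring
      · apply mul_left_cancel₀ hc'
        rw [← mul_assoc, ← hkr, hb, hb']; push_cast; rw [hgr]; ring
    have hle : k ≤ k' := Nat.sInf_le (s := {k : ℕ | 0 < k ∧ x ∈ lattice k}) ⟨hk'0, hmem⟩
    rw [hk'2] at hle
    have : c * k' ≤ 1 * k' := by linarith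
    have := Nat.le_of_mul_le_mul_right this hk'0
    omega
  have h3 := gEquiv_singleton_of_isCoprime hk (g := 1) hgk (one_mul _).symm (one_mul _).symm
  rw [hxe]
  exact h1.trans (h2.trans h3)

/-! ### Counting lattice points by the Ehrhart function -/

open scoped Classical in
/-- The points of the lattice of level `N` in `P` (if there are finitely many). -/
def latticeIn (N : ℕ) (P : Set Plane) : Finset Plane :=
  if h : (lattice N ∩ P).Finite then h.toFinset else ∅

theorem mem_latticeIn {N : ℕ} (hN : 0 < N) {P : Set Plane} (hP : Bornology.IsBounded P)
    {x : Plane} : x ∈ latticeIn N P ↔ x ∈ lattice N ∧ x ∈ P := by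
  rw [latticeIn, dif_pos (finite_lattice_inter hN hP), Set.Finite.mem_toFinset]; rfl

theorem ehr_eq_card {P : Set Plane} (hP : Bornology.IsBounded P) {k : ℕ} (hk : 0 < k) :
    ehr P k = (latticeIn k P).card := by
  have hk' : (k : ℝ) ≠ 0 := by positivity
  rw [ehr, ← Set.ncard_coe_finset]
  refine Set.ncard_congr (fun z _ => latticePoint k (z 0) (z 1)) ?_ ?_ ?_
  · intro z hz
    have hz' := (mem_smul_set_iff_inv_smul_mem₀ hk' P _).1 hz
    have e : (k : ℝ)⁻¹ • (fun i => (z i : ℝ)) = latticePoint k (z 0) (z 1) := by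
      apply plane_ext <;> simp [latticePoint] <;> field_simp
    rw [e] at hz'
    refine Finset.mem_coe.2 ((mem_latticeIn hk hP).2 ⟨(mem_lattice_iff hk).2 ⟨z 0, z 1, ?_, ?_⟩, hz'⟩)
    · simp [latticePoint]; field_simp
    · simp [latticePoint]; field_simp
  · intro z w _ _ h
    have h0 := congrFun h 0
    have h1 := congrFun h 1
    simp only [latticePoint, Matrix.cons_val_zero, Matrix.cons_val_one,
      Matrix.cons_val_fin_one] at h0 h1
    rw [div_left_inj' hk'] at h0 h1
    funext i
    fin_cases i
    · exact_mod_cast h0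
    · exact_mod_cast h1
  · intro x hx
    obtain ⟨hl, hxP⟩ := (mem_latticeIn hk hP).1 (Finset.mem_coe.1 hx)
    obtain ⟨m, n, hm, hn⟩ := (mem_lattice_iff hk).1 hl
    have e : latticePoint k m n = x := by
      apply plane_ext
      · simp only [latticePoint, Matrix.cons_val_zero]; rw [← hm]; field_simp
      · simp only [latticePoint, Matrix.cons_val_one, Matrix.cons_val_fin_one]
        rw [← hn]; field_simp
    refine ⟨![m, n], (mem_smul_set_iff_inv_smul_mem₀ hk' P _).2 ?_, by simpa using e⟩
    convert hxP
    rw [← e]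
    apply plane_ext <;> simp [latticePoint] <;> field_simp

theorem card_latticeIn_eq_sum {P : Set Plane} (hP : Bornology.IsBounded P) {k : ℕ} (hk : 0 < k) :
    (latticeIn k P).card =
      ∑ j ∈ k.divisors, ((latticeIn j P).filter fun x => pointDen x = j).card := by
  rw [Finset.card_eq_sum_card_fiberwise (f := pointDen) (t := k.divisors)]
  · refine Finset.sum_congr rfl fun j hj => ?_
    congr 1
    have hj0 := Nat.pos_of_mem_divisors hj
    ext x
    rw [Finset.mem_filter, Finset.mem_filter, mem_latticeIn hk hP, mem_latticeIn hj0 hP]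
    constructor
    · rintro ⟨⟨h1, h2⟩, rfl⟩
      exact ⟨⟨(pointDen_spec hk h1).2, h2⟩, rfl⟩
    · rintro ⟨⟨h1, h2⟩, rfl⟩
      exact ⟨⟨lattice_mono hk (Nat.dvd_of_mem_divisors hj) h1, h2⟩, rfl⟩
  · intro x hx
    have h1 := ((mem_latticeIn hk hP).1 hx).1
    exact Finset.mem_coe.2 (Nat.mem_divisors.2 ⟨(pointDen_dvd_iff hk h1 hk).2 h1, hk.ne'⟩)

/-- Möbius inversion over divisors, in the form of a strong induction: the count at level `j` is the
sum of the counts by exact denominator, and those for proper divisors agree already. -/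
theorem card_filter_pointDen {P Q : Set Plane} (hP : Bornology.IsBounded P)
    (hQ : Bornology.IsBounded Q) (h : ehr P = ehr Q) {j : ℕ} (hj : 0 < j) :
    ((latticeIn j P).filter fun x => pointDen x = j).card =
      ((latticeIn j Q).filter fun x => pointDen x = j).card := by
  induction j using Nat.strong_induction_on with
  | _ j ih =>
    have h1 := congrFun h j
    rw [ehr_eq_card hP hj, ehr_eq_card hQ hj, card_latticeIn_eq_sum hP hj,
      card_latticeIn_eq_sum hQ hj, ← Nat.cons_self_properDivisors hj.ne',
      Finset.sum_cons, Finset.sum_cons, Finset.sum_congr rfl fun i hi =>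
        ih i (Nat.mem_properDivisors.1 hi).2 (Nat.pos_of_mem_properDivisors hi)] at h1
    omega

theorem classes_latticeIn_eq {P Q : Set Plane} (hP : Bornology.IsBounded P)
    (hQ : Bornology.IsBounded Q) (h : ehr P = ehr Q) {N : ℕ} (hN : 0 < N) :
    (latticeIn N P).val.map (fun x => gClass {x}) = (latticeIn N Q).val.map fun x => gClass {x} := by
  have key : ∀ {P : Set Plane}, Bornology.IsBounded P →
      (latticeIn N P).val.map (fun x => gClass {x}) =
        ((latticeIn N P).val.map pointDen).map fun k => gClass {latticePoint k 1 0} := by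
    intro P hP
    rw [Multiset.map_map]
    exact Multiset.map_congr rfl fun x hx => gClass_singleton hN ((mem_latticeIn hN hP).1 hx).1
  have count : ∀ {P : Set Plane}, Bornology.IsBounded P → ∀ j : ℕ,
      Multiset.count j ((latticeIn N P).val.map pointDen) = if j ∣ N then
        ((latticeIn j P).filter fun x => pointDen x = j).card else 0 := by
    intro P hP j
    rw [Multiset.count_map]
    have e : ((latticeIn N P).val.filter fun x => j = pointDen x).card =
      ((latticeIn N P).filter fun x => j = pointDen x).card := rfl
    rw [e]
    split_ifs with hj
    · have hj0 := Nat.pos_of_dvd_of_pos hj hN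
      congr 1
      ext x
      rw [Finset.mem_filter, Finset.mem_filter, mem_latticeIn hN hP, mem_latticeIn hj0 hP]
      constructor
      · rintro ⟨⟨h1, h2⟩, rfl⟩
        exact ⟨⟨(pointDen_spec hN h1).2, h2⟩, rfl⟩
      · rintro ⟨⟨h1, h2⟩, rfl⟩
        exact ⟨⟨lattice_mono hN hj h1, h2⟩, rfl⟩
    · rw [Finset.card_eq_zero, Finset.filter_eq_empty_iff]
      rintro x hx rfl
      have h1 := ((mem_latticeIn hN hP).1 hx).1
      exact hj ((pointDen_dvd_iff hN h1 hN).2 h1)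
  rw [key hP, key hQ]
  congr 1
  ext j
  rw [count hP, count hQ]
  split_ifs with hj
  · exact card_filter_pointDen hP hQ h (Nat.pos_of_dvd_of_pos hj hN)
  · rfl

/-! ### From equal classes to an equidecomposability relation -/

theorem exists_bijOn_of_rel {α β : Type*} [Nonempty β] {r : α → β → Prop} {A : Finset α}
    {B : Finset β} (h : Multiset.Rel r A.val B.val) :
    ∃ σ : α → β, BijOn σ A B ∧ ∀ a ∈ A, r a (σ a) := by
  classical
  induction A using Finset.induction_on generalizing B with
  | empty =>
    rw [Finset.empty_val, Multiset.rel_zero_left] at h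
    obtain rfl : B = ∅ := Finset.val_eq_zero.1 h
    exact ⟨fun _ => Classical.arbitrary β, by simp, by simp⟩
  | insert a A ha ih =>
    rw [Finset.insert_val_of_notMem ha] at h
    obtain ⟨b, B', hab, hr, hB⟩ := Multiset.rel_cons_left.1 h
    have hb : b ∈ B := by rw [← Finset.mem_val, hB]; exact Multiset.mem_cons_self _ _
    have hB' : B' = (B.erase b).val := by
      rw [Finset.erase_val, hB, Multiset.erase_cons_head]
    subst hB'
    obtain ⟨σ, hσ, hrel⟩ := ih hr
    have hne : ∀ x ∈ A, x ≠ a := fun x hx h => ha (h ▸ hx)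
    refine ⟨Function.update σ a b, ?_, ?_⟩
    · have h1 : BijOn (Function.update σ a b) A (B.erase b) :=
        hσ.congr fun x hx => (Function.update_of_ne (hne x hx) _ _).symm
      have h2 := h1.insert (a := a) (by simp)
      rw [Function.update_self] at h2
      rwa [Finset.coe_insert, ← Finset.insert_erase hb, Finset.coe_insert]
    · intro x hx
      rcases Finset.mem_insert.1 hx with rfl | hx
      · rwa [Function.update_self]
      · rw [Function.update_of_ne (hne x hx)]; exact hrel x hx

theorem IsTriangulation.eq_of_mem {P : Set Plane} {T : Finset (Finset Plane)}
    (hT : IsTriangulation P T) {s s' : Finset Plane} (hs : s ∈ T) (hs' : s' ∈ T) {x : Plane}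
    (hx : x ∈ openSimplex s) (hx' : x ∈ openSimplex s') : s = s' := by
  by_contra hne
  exact disjoint_left.1 (hT.2.1 hs hs' hne) hx hx'

theorem IsTriangulation.exists_mem {P : Set Plane} {T : Finset (Finset Plane)}
    (hT : IsTriangulation P T) {x : Plane} (hx : x ∈ P) : ∃ s ∈ T, x ∈ openSimplex s := by
  rw [← hT.2.2] at hx
  simpa using hx

theorem IsTriangulation.openSimplex_subset {P : Set Plane} {T : Finset (Finset Plane)}
    (hT : IsTriangulation P T) {s : Finset Plane} (hs : s ∈ T) : openSimplex s ⊆ P := by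
  rw [← hT.2.2]; exact subset_biUnion_of_mem (u := fun t => openSimplex t) hs

/-- Equal multisets of classes give a bijection between the simplices and a `G`-map for each; the
open simplices partition `P` and `Q`, so the maps glue to a bijection. -/
theorem exists_equidecompRel {P Q : Set Plane} {T S : Finset (Finset Plane)}
    (hT : IsTriangulation P T) (hS : IsTriangulation Q S) (h : classes T = classes S) :
    ∃ F, IsEquidecompRel P T Q S F := by
  obtain ⟨σ, hσ, hg⟩ := exists_bijOn_of_rel (gEq_of_classes_eq h)
  have : Nonempty GMap := ⟨GMap.exists_id.choose⟩
  choose! g hg using hg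
  choose! c hc hxc using fun x => hT.exists_mem (x := x)
  have hF : ∀ s ∈ T, ∀ x ∈ openSimplex s, (g (c x)).act x = (g s).act x := by
    intro s hs x hx
    have hxP := hT.openSimplex_subset hs hx
    rw [hT.eq_of_mem (hc x hxP) hs (hxc x hxP) hx]
  have hFm : ∀ s ∈ T, ∀ x ∈ openSimplex s, (g (c x)).act x ∈ openSimplex (σ s) := by
    intro s hs x hx
    rw [hF s hs x hx, ← hg s hs, (g s).openSimplex_image]
    exact mem_image_of_mem _ hx
  refine ⟨fun x => (g (c x)).act x, hT, hS, ⟨?_, ?_, ?_⟩, fun s hs => ⟨g s, ?_, ?_⟩⟩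
  · intro x hx
    exact hS.openSimplex_subset (hσ.mapsTo (hc x hx)) (hFm _ (hc x hx) x (hxc x hx))
  · intro x hx y hy hxy
    have h1 := hFm _ (hc x hx) x (hxc x hx)
    have h2 := hFm _ (hc y hy) y (hxc y hy)
    dsimp only at hxy
    rw [hxy] at h1
    have h3 := hσ.injOn (hc x hx) (hc y hy)
      (hS.eq_of_mem (hσ.mapsTo (hc x hx)) (hσ.mapsTo (hc y hy)) h1 h2)
    rw [h3] at hxy
    exact (g (c y)).injective hxy
  · intro y hy
    obtain ⟨s', hs', hys⟩ := hS.exists_mem hy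
    obtain ⟨s, hs, rfl⟩ := hσ.surjOn hs'
    rw [← hg s hs, (g s).openSimplex_image] at hys
    obtain ⟨x, hx, rfl⟩ := hys
    exact ⟨x, hT.openSimplex_subset hs hx, hF s hs x hx⟩
  · rw [GMap.coe_eq_act]
    exact fun x hx => hF s hs x hx
  · rw [GMap.coe_eq_act, hg s hs]
    exact hσ.mapsTo hs

/-- Faces are sorted by dimension. The vertices of a minimal tiling are all lattice points of `P`,
whatever the tiling. -/
theorem IsTiling.faces_eq {N : ℕ} (hN : 0 < N) {P : Set Plane} (hP : Bornology.IsBounded P)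
    {T : Finset (Finset Plane)} (hT : IsTiling N P T) (M : Type*) [AddCommMonoid M]
    (φ : Finset Plane → M) : ∑ s ∈ faces T, φ s =
      ∑ x ∈ latticeIn N P, φ {x} + (∑ e ∈ edges T, φ e + ∑ t ∈ T, φ t) := by
  classical
  have hc : ∀ s ∈ faces T, s.card = 1 ∨ s.card = 2 ∨ s.card = 3 := by
    intro s hs
    obtain ⟨hn, t, ht, hst⟩ := mem_faces.1 hs
    have h1 := Finset.card_le_card hst
    have h2 := hn.card_pos
    rw [(hT.2 t ht).1] at h1
    omega
  have h1 : (faces T).filter (fun s => s.card = 1) = (latticeIn N P).image fun x => {x} := by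
    ext s
    rw [Finset.mem_filter, mem_faces, Finset.mem_image]
    constructor
    · rintro ⟨⟨-, t, ht, hst⟩, hc⟩
      obtain ⟨x, rfl⟩ := Finset.card_eq_one.1 hc
      have hx : x ∈ t := by simpa using hst
      exact ⟨x, (mem_latticeIn hN hP).2 ⟨(hT.2 t ht).2.mem_lattice hx,
        hT.hull_subset ht (mem_hull_of_mem hx)⟩, rfl⟩
    · rintro ⟨x, hx, rfl⟩
      obtain ⟨hl, hxP⟩ := (mem_latticeIn hN hP).1 hx
      obtain ⟨t, ht, hxt⟩ := hT.1.mem_iff.1 hxP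
      exact ⟨⟨by simp, t, ht, by simpa using (hT.2 t ht).2.mem_of_mem_hull hxt hl⟩, by simp⟩
  have h2 : ((faces T).filter (fun s => ¬ s.card = 1)).filter (fun s => s.card = 2) = edges T := by
    ext s
    rw [Finset.mem_filter, Finset.mem_filter, mem_faces, mem_edges]
    constructor
    · rintro ⟨⟨⟨-, t, ht, hst⟩, -⟩, hc⟩
      exact ⟨t, ht, hst, hc⟩
    · rintro ⟨t, ht, hst, hc⟩
      exact ⟨⟨⟨Finset.card_pos.1 (by omega), t, ht, hst⟩, by omega⟩, hc⟩
  have h3 : ((faces T).filter (fun s => ¬ s.card = 1)).filter (fun s => ¬ s.card = 2) = T := by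
    have : ((faces T).filter (fun s => ¬ s.card = 1)).filter (fun s => ¬ s.card = 2) =
        facets (faces T) := by
      ext s
      rw [Finset.mem_filter, Finset.mem_filter, mem_facets]
      constructor
      · rintro ⟨⟨h, h1⟩, h2⟩
        have := hc s h
        exact ⟨h, by omega⟩
      · rintro ⟨h, h1⟩
        exact ⟨⟨h, by omega⟩, by omega⟩
    rw [this, facets_faces fun t ht => (hT.2 t ht).1]
  rw [← Finset.sum_filter_add_sum_filter_not (faces T) (fun s => s.card = 1), h1,
    ← Finset.sum_filter_add_sum_filter_not ((faces T).filter fun s => ¬ s.card = 1)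
      (fun s => s.card = 2), h2, h3, Finset.sum_image fun x _ y _ h => Finset.singleton_injective h]

theorem sum_powersetCard_image {M : Type*} [AddCommMonoid M] (g : GMap) (t : Finset Plane)
    {φ : Finset Plane → M} (hφ : ∀ e, φ (e.image g.act) = φ e) :
    ∑ e ∈ (t.image g.act).powersetCard 2, φ e = ∑ e ∈ t.powersetCard 2, φ e := by
  have : (t.image g.act).powersetCard 2 = (t.powersetCard 2).image fun e => e.image g.act := by
    ext e
    rw [Finset.mem_powersetCard, Finset.mem_image]
    constructor
    · rintro ⟨he, hc⟩
      obtain ⟨f, hf, rfl⟩ := Finset.subset_image_iff.1 he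
      exact ⟨f, Finset.mem_powersetCard.2 ⟨by exact_mod_cast hf, by rw [← hc, g.card_image]⟩, rfl⟩
    · rintro ⟨f, hf, rfl⟩
      rw [Finset.mem_powersetCard] at hf
      exact ⟨Finset.image_subset_image hf.1, by rw [g.card_image, hf.2]⟩
  rw [this, Finset.sum_image g.image_injective.injOn]
  exact Finset.sum_congr rfl fun e _ => hφ e

theorem IsTiling.filter_edges_eq_minimalIn {N : ℕ} (hN : 0 < N) {R : Set Plane}
    (hR : Bornology.IsBounded (frontier R)) {T : Finset (Finset Plane)} (hT : IsTiling N R T)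
    [DecidablePred fun e : Finset Plane => hull e ⊆ frontier R] :
    (edges T).filter (fun e => hull e ⊆ frontier R) = minimalIn N (frontier R) := by
  ext e
  rw [Finset.mem_filter, mem_minimalIn hN hR]
  exact ⟨fun h => ⟨hT.isMinimalEdge h.1, h.2⟩, fun h => ⟨hT.mem_edges_of_frontier h, h.2⟩⟩

theorem classes_eq_iff_gEq {A B : Finset (Finset Plane)} :
    classes A = classes B ↔ GEq A.val B.val :=
  ⟨gEq_of_classes_eq, fun h => h.map_eq fun _ _ _ _ hab => gClass_eq_iff.2 hab⟩

/-- In the double count, the triangle sides agree because the triangles do, and the boundary edges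
agree by hypothesis; the factor `2` can be cancelled for multisets. -/
theorem classes_edges_eq {P Q : Set Plane} (hP : IsPolygon P) (hQ : IsPolygon Q) {N : ℕ}
    (hN : 0 < N) {T S : Finset (Finset Plane)} (hT : IsTiling N P T) (hS : IsTiling N Q S)
    (h : classes T = classes S)
    (hb : classes (minimalIn N (frontier P)) = classes (minimalIn N (frontier Q))) :
    classes (edges T) = classes (edges S) := by
  classical
  apply two_nsmul_injective
  rw [classes_eq_sum, classes_eq_sum, hT.two_nsmul_sum_edges, hS.two_nsmul_sum_edges,
    hT.filter_edges_eq_minimalIn hN hP.isCompact_frontier.isBounded,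
    hS.filter_edges_eq_minimalIn hN hQ.isCompact_frontier.isBounded, ← classes_eq_sum,
    ← classes_eq_sum, hb]
  congr 1
  refine sum_eq_of_classes_eq h ?_
  rintro t - _ - ⟨g, rfl⟩
  exact (sum_powersetCard_image g t fun e => by rw [gClass_image]).symm

theorem classes_faces_eq {P Q : Set Plane} (hP : IsPolygon P) (hQ : IsPolygon Q) {N : ℕ}
    (hN : 0 < N) {T S : Finset (Finset Plane)} (hT : IsTiling N P T) (hS : IsTiling N Q S)
    (h : classes T = classes S) (he : ehr P = ehr Q)
    (hb : classes (minimalIn N (frontier P)) = classes (minimalIn N (frontier Q))) :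
    classes (faces T) = classes (faces S) := by
  rw [classes_eq_sum, classes_eq_sum, hT.faces_eq hN hP.isCompact.isBounded,
    hS.faces_eq hN hQ.isCompact.isBounded, ← classes_eq_sum (edges T), ← classes_eq_sum T,
    ← classes_eq_sum (edges S), ← classes_eq_sum S, h, classes_edges_eq hP hQ hN hT hS h hb]
  congr 1
  have := congrArg (fun m => (m.map fun c => ({c} : Multiset (Set (Finset Plane)))).sum)
    (classes_latticeIn_eq hP.isCompact.isBounded hQ.isCompact.isBounded he hN)
  simp only [Multiset.map_map] at this
  exact this

/-! ### The invariants give a relation -/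

/-- A rational dissection has a refinement into `N`-minimal triangles. -/
theorem exists_minimal_cut {N : ℕ} (hN : 0 < N) {A : Multiset (Finset Plane)}
    (hA : ∀ t ∈ A, IsRatTriangle t) (hl : ∀ t ∈ A, ∀ p ∈ t, p ∈ lattice N) :
    ∃ B, Cut A B ∧ ∀ t ∈ B, IsMinimalTriangle N t := by
  have : ∀ t ∈ A, ∃ T, IsTiling N (hull t) T := fun t ht =>
    exists_tiling_triangle hN (hA t ht).1 (hA t ht).2.1 (hl t ht)
  choose! τ hτ using this
  refine ⟨A.bind fun t => (τ t).val, Cut.of_fun fun t ht =>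
    ⟨τ t, rfl, (hτ t ht).1, fun x hx => ((hτ t ht).2 x hx).isRatTriangle⟩, fun x hx => ?_⟩
  obtain ⟨t, ht, hxt⟩ := Multiset.mem_bind.1 hx
  exact (hτ t ht).2 x hxt

/-- Dissections with equivalent triangles have refinements into equivalent tilings. -/
theorem exists_gEq_tilings {P Q : Set Plane} {X Y : Finset (Finset Plane)} (hX : IsDissection P X)
    (hY : IsDissection Q Y) (rY : ∀ t ∈ Y, IsRatTriangle t) (h : GEq X.val Y.val) {N : ℕ}
    (hN : 0 < N) (hl : ∀ t ∈ Y, ∀ p ∈ t, p ∈ lattice N) :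
    ∃ T S, IsTiling N P T ∧ IsTiling N Q S ∧ classes T = classes S := by
  obtain ⟨B, hB, hBm⟩ := exists_minimal_cut hN (A := Y.val) rY hl
  obtain ⟨A, hA, hAB⟩ := hB.transport h
  obtain ⟨T, rfl, hT⟩ := hX.glue hA
  obtain ⟨S, rfl, hS⟩ := hY.glue hB
  refine ⟨T, S, ⟨hT, fun t ht => ?_⟩, ⟨hS, hBm⟩, classes_eq_iff_gEq.2 hAB⟩
  obtain ⟨s, hs, hts⟩ := Multiset.exists_mem_of_rel_of_mem hAB ht
  obtain ⟨g, rfl⟩ := hts.symm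
  exact g.isMinimalTriangle_image hN (hBm s hs)

theorem exists_equidecompRel_of_invariants {P Q : Set Plane} {d : ℕ} (hP : IsPolygon P)
    (hQ : IsPolygon Q) (hd : 0 < d) (hlP : ∀ v, IsVertex P v → v ∈ lattice d)
    (hlQ : ∀ v, IsVertex Q v → v ∈ lattice d) (he : ehr P = ehr Q)
    (hw : polygonWeight d P = polygonWeight d Q) {d' : ℕ} (hd' : 0 < d') (hdd : d ∣ d')
    (hD : dynSystem d' P = dynSystem d' Q) : ∃ T S F, IsEquidecompRel P T Q S F := by
  obtain ⟨T₀, hT₀⟩ := hP.exists_tiling hd' fun v hv => lattice_mono hd' hdd (hlP v hv)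
  obtain ⟨S₀, hS₀⟩ := hQ.exists_tiling hd' fun v hv => lattice_mono hd' hdd (hlQ v hv)
  have h1 : S₀.val.map (triangleWeight d') ∈ dynSystem d' P := by
    rw [hD, mem_dynSystem hd' hQ hS₀]
  rw [mem_dynSystem hd' hP hT₀] at h1
  obtain ⟨A, B, hA, hB, hAB⟩ := scissors_of_pseudoFlips hd' (A := T₀.val) (B := S₀.val)
    hT₀.2 hS₀.2 h1
  have rB := hB.isRatTriangle
  obtain ⟨X, rfl, hX⟩ := hT₀.1.glue hA
  obtain ⟨Y, rfl, hY⟩ := hS₀.1.glue hB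
  obtain ⟨n, hn, hl⟩ := exists_common_level Y (fun t N => ∀ p ∈ t, p ∈ lattice N)
    fun t ht => exists_level_of_isRational (rB t ht).2.2
  -- The level must be a multiple of `n`, to contain the vertices of the dissection, and of `d`, to
  -- inherit the boundary classes from level `d`.
  have hN : 0 < d * n := Nat.mul_pos hd hn
  obtain ⟨T, S, hT, hS, hTS⟩ := exists_gEq_tilings hX hY rB hAB hN
    (hl _ hN (Dvd.intro_left d rfl))
  have hb := hP.classes_eq_of_dvd hQ hN hd (Dvd.intro n rfl) hlP hlQ
    ((polygonWeight_eq_iff hP hQ hd).1 hw)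
  exact ⟨_, _, exists_equidecompRel hT.isTriangulation hS.isTriangulation
    (classes_faces_eq hP hQ hN hT hS hTS he hb)⟩

/-! ### Invariants of an equidecomposability relation -/

theorem IsEquidecompRel.exists_act {P Q : Set Plane} {T S : Finset (Finset Plane)}
    {F : Plane → Plane} (h : IsEquidecompRel P T Q S F) {x : Plane} (hx : x ∈ P) :
    ∃ g : GMap, F x = g.act x := by
  obtain ⟨s, hs, hxs⟩ := h.1.exists_mem hx
  obtain ⟨g, hg, -⟩ := h.2.2.2 s hs
  exact ⟨g, (hg hxs).trans (congrFun g.coe_eq_act x)⟩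

theorem IsEquidecompRel.ehr_eq {P Q : Set Plane} {T S : Finset (Finset Plane)} {F : Plane → Plane}
    (h : IsEquidecompRel P T Q S F) (hP : IsPolygon P) (hQ : IsPolygon Q) : ehr P = ehr Q := by
  funext k
  rcases Nat.eq_zero_or_pos k with rfl | hk
  -- At `0` both dilates are the origin, since the polygons are nonempty.
  · simp only [ehr, Nat.cast_zero]
    rw [zero_smul_set hP.nonempty, zero_smul_set hQ.nonempty]
  rw [ehr_eq_card hP.isCompact.isBounded hk, ehr_eq_card hQ.isCompact.isBounded hk]
  have hm : ∀ x ∈ P, (F x ∈ lattice k ↔ x ∈ lattice k) := by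
    intro x hx
    obtain ⟨g, hg⟩ := h.exists_act hx
    rw [hg, g.mem_lattice_iff hk]
  refine Finset.card_bij (fun x _ => F x) ?_ ?_ ?_
  · intro x hx
    rw [mem_latticeIn hk hP.isCompact.isBounded] at hx
    exact (mem_latticeIn hk hQ.isCompact.isBounded).2
      ⟨(hm x hx.2).2 hx.1, h.2.2.1.mapsTo hx.2⟩
  · intro x hx y hy hxy
    rw [mem_latticeIn hk hP.isCompact.isBounded] at hx hy
    exact h.2.2.1.injOn hx.2 hy.2 hxy
  · intro y hy
    rw [mem_latticeIn hk hQ.isCompact.isBounded] at hy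
    obtain ⟨x, hx, rfl⟩ := h.2.2.1.surjOn hy.2
    exact ⟨x, (mem_latticeIn hk hP.isCompact.isBounded).2 ⟨(hm x hx).1 hy.1, hx⟩, rfl⟩

/-- Bijectivity of `F` makes the images of the simplices pairwise distinct and exhausts the target
triangulation. -/
theorem IsEquidecompRel.classes_eq {P Q : Set Plane} {T S : Finset (Finset Plane)}
    {F : Plane → Plane} (h : IsEquidecompRel P T Q S F) : classes T = classes S := by
  classical
  obtain ⟨hT, hS, hF, hg⟩ := h
  have : Nonempty GMap := ⟨GMap.exists_id.choose⟩
  choose! g hg hgS using hg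
  simp only [GMap.coe_eq_act] at hg hgS
  have hFm : ∀ s ∈ T, ∀ x ∈ openSimplex s, F x ∈ openSimplex (s.image (g s).act) := by
    intro s hs x hx
    rw [hg s hs hx, (g s).openSimplex_image]
    exact mem_image_of_mem _ hx
  have hinj : InjOn (fun s : Finset Plane => s.image (g s).act) (T : Set (Finset Plane)) := by
    intro s hs s' hs' he
    dsimp only at he
    obtain ⟨x, hx⟩ := openSimplex_nonempty (hT.1 s hs).1.1
    have h1 := hFm s hs x hx
    rw [he, (g s').openSimplex_image] at h1
    obtain ⟨y, hy, hxy⟩ := h1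
    rw [← hg s' hs' hy] at hxy
    have := hF.injOn (hT.openSimplex_subset hs' hy) (hT.openSimplex_subset hs hx) hxy
    exact hT.eq_of_mem hs hs' hx (this ▸ hy)
  have hST : S = T.image fun s => s.image (g s).act := by
    refine Finset.Subset.antisymm ?_ ?_
    · intro s' hs'
      obtain ⟨y, hy⟩ := openSimplex_nonempty (hS.1 s' hs').1.1
      obtain ⟨x, hx, rfl⟩ := hF.surjOn (hS.openSimplex_subset hs' hy)
      obtain ⟨s, hs, hxs⟩ := hT.exists_mem hx
      exact Finset.mem_image.2 ⟨s, hs, hS.eq_of_mem (hgS s hs) hs' (hFm s hs x hxs) hy⟩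
    · intro s' hs'
      obtain ⟨s, hs, rfl⟩ := Finset.mem_image.1 hs'
      exact hgS s hs
  rw [classes_eq_sum, classes_eq_sum, hST, Finset.sum_image hinj]
  exact Finset.sum_congr rfl fun s _ => by rw [gClass_image]

theorem interior_hull {t : Finset Plane} (hc : t.card = 3) (hs : IsSimplex t) :
    interior (hull t) = openSimplex t := by
  refine Subset.antisymm (fun x hx => ?_) (openSimplex_subset_interior hc hs)
  obtain ⟨c, hc⟩ := openSimplex_nonempty hs.1
  have h1 := ((tendsto_add_smul x (x - c)).eventually
    (mem_interior_iff_mem_nhds.1 hx)).filter_mono (nhdsWithin_le_nhds (s := Ioi 0))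
  obtain ⟨ε, h2, h3⟩ := (h1.and (self_mem_nhdsWithin : ∀ᶠ ε in 𝓝[>] (0 : ℝ), 0 < ε)).exists
  have h3' : 0 < ε := h3
  -- An interior point stays in the hull when pushed slightly away from `c`. It is then a
  -- combination of the pushed point and `c`, in which `c` has the positive weight `ε / (1 + ε)`.
  have h4 := comb_mem_openSimplex hc h2 (r := ε / (1 + ε)) (by positivity)
    (by rw [div_le_one (by positivity)]; linarith)
  have e : (ε / (1 + ε)) • c + (1 - ε / (1 + ε)) • (x + ε • (x - c)) = x := by
    apply plane_ext <;>
    · simp only [Pi.add_apply, Pi.smul_apply, Pi.sub_apply, smul_eq_mul]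
      field_simp
      ring
  rwa [e] at h4

/-! ### Boundary edges read off from an arbitrary triangulation -/

/-- A minimal edge that avoids the open triangles of a tiling is an edge of the tiling. -/
theorem IsTiling.mem_edges_of_disjoint {N : ℕ} {R : Set Plane} {T : Finset (Finset Plane)}
    (hT : IsTiling N R T) {e : Finset Plane} (he : IsMinimalEdge N e) (heR : openSimplex e ⊆ R)
    (hd : ∀ t ∈ T, Disjoint (openSimplex e) (openSimplex t)) : e ∈ edges T := by
  have key : ∀ x ∈ openSimplex e, ∃ s ∈ edges T, x ∈ hull s := by
    intro x hx
    obtain ⟨t, ht, hxt⟩ := hT.1.mem_iff.1 (heR hx)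
    obtain ⟨s, hs, hc, hxs⟩ := exists_edge_of_notMem (hT.2 t ht).1 hxt
      (disjoint_left.1 (hd t ht) hx)
    exact ⟨s, mem_edges.2 ⟨t, ht, hs, hc⟩, hxs⟩
  obtain ⟨s, hs, hpar, x, hx, hxs⟩ := exists_par_of_cover he.1 (edges T).finite_toSet
    (fun s hs => (hT.isMinimalEdge hs).1) key
  rwa [he.eq_of_par (hT.isMinimalEdge hs) hx hxs hpar]

open scoped Classical in
/-- The edges of a tiling that do not lie in the boundary. -/
def innerEdges (R : Set Plane) (T : Finset (Finset Plane)) : Finset (Finset Plane) :=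
  (edges T).filter fun e => ¬ hull e ⊆ frontier R

theorem IsTiling.two_nsmul_sum_innerEdges {M : Type*} [AddCancelCommMonoid M] {N : ℕ} (hN : 0 < N)
    {R : Set Plane} (hR : Bornology.IsBounded (frontier R)) {T : Finset (Finset Plane)}
    (hT : IsTiling N R T) (φ : Finset Plane → M) :
    2 • ∑ e ∈ innerEdges R T, φ e + ∑ e ∈ minimalIn N (frontier R), φ e =
      ∑ t ∈ T, ∑ e ∈ t.powersetCard 2, φ e := by
  classical
  have h1 := hT.two_nsmul_sum_edges φ
  have h2 := Finset.sum_filter_add_sum_filter_not (edges T) (fun e => hull e ⊆ frontier R) φ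
  rw [hT.filter_edges_eq_minimalIn hN hR] at h1 h2
  rw [← h2, smul_add, two_nsmul (∑ e ∈ minimalIn N (frontier R), φ e)] at h1
  refine add_right_cancel (b := ∑ e ∈ minimalIn N (frontier R), φ e) ?_
  rw [← h1, innerEdges]
  abel

/-- A side of a triangle of `T` may be covered by several segments of `T`. An edge of the refinement
either is inner to exactly one triangle, or lies in the frontier of its triangle. In the second case
its open part avoids all open triangles and vertices of `T`, and by pigeonhole and minimality it
lies in exactly one segment of `T`. -/
theorem IsTriangulation.edges_eq {P : Set Plane} (hP : IsPolygon P) {T : Finset (Finset Plane)}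
    (hT : IsTriangulation P T) {N : ℕ} (hN : 0 < N) (hl : ∀ s ∈ T, ∀ p ∈ s, p ∈ lattice N)
    {τ : Finset Plane → Finset (Finset Plane)} (hτ : ∀ t ∈ facets T, IsTiling N (hull t) (τ t))
    (h : IsTiling N P ((facets T).biUnion τ)) (M : Type*) [AddCommMonoid M]
    (φ : Finset Plane → M) :
    ∑ e ∈ edges ((facets T).biUnion τ), φ e =
      ∑ s ∈ T.filter (fun s => s.card = 2), ∑ e ∈ minimalIn N (hull s), φ e +
        ∑ t ∈ facets T, ∑ e ∈ innerEdges (hull t) (τ t), φ e := by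
  classical
  have hD := hT.isDissection hP
  have hinner : ∀ t ∈ facets T, ∀ e ∈ innerEdges (hull t) (τ t),
      e ∈ edges (τ t) ∧ ∃ x ∈ openSimplex e, x ∈ openSimplex t := by
    intro t ht e he
    obtain ⟨h1, h2⟩ := Finset.mem_filter.1 he
    refine ⟨h1, ?_⟩
    obtain ⟨y, hy, hyf⟩ := not_subset.1 h2
    obtain ⟨u, hu, heu, -⟩ := mem_edges.1 h1
    have hyt : y ∈ hull t := (hτ t ht).hull_subset hu (hull_mono heu hy)
    have hyi : y ∈ interior (hull t) := by
      by_contra h; exact hyf ⟨subset_closure hyt, h⟩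
    obtain ⟨x, hxi, hx⟩ := meets_openSimplex isOpen_interior hy hyi
    rw [interior_hull (hD.1 t ht).1 (hD.1 t ht).2] at hxi
    exact ⟨x, hx, hxi⟩
  have hseg : ∀ s ∈ T.filter (fun s => s.card = 2), ∀ e ∈ minimalIn N (hull s),
      IsMinimalEdge N e ∧ openSimplex e ⊆ openSimplex s := by
    intro s hs e he
    obtain ⟨hsT, hc⟩ := Finset.mem_filter.1 hs
    rw [mem_minimalIn_hull hN] at he
    refine ⟨he.1, ?_⟩
    obtain ⟨x, hx⟩ := openSimplex_nonempty he.1.2.1.1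
    exact he.1.subset_of_par hc (hl s hsT) hx (he.2 (openSimplex_subset_hull _ hx))
      (par_of_subset_hull hc hc (par_self hc) he.2 Subset.rfl)
  have hun : edges ((facets T).biUnion τ) =
      (T.filter (fun s => s.card = 2)).biUnion (fun s => minimalIn N (hull s)) ∪
        (facets T).biUnion fun t => innerEdges (hull t) (τ t) := by
    ext e
    rw [Finset.mem_union, Finset.mem_biUnion, Finset.mem_biUnion]
    constructor
    · intro he
      have hem := h.isMinimalEdge he
      obtain ⟨u, hu, heu, hc⟩ := mem_edges.1 he
      obtain ⟨t, ht, hut⟩ := Finset.mem_biUnion.1 hu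
      have het : e ∈ edges (τ t) := mem_edges.2 ⟨u, hut, heu, hc⟩
      by_cases hfr : hull e ⊆ frontier (hull t)
      · left
        have heP : hull e ⊆ P := (hull_mono heu).trans (h.hull_subset hu)
        have key : ∀ x ∈ openSimplex e, ∃ s ∈ T.filter (fun s => s.card = 2), x ∈ hull s := by
          intro x hx
          obtain ⟨s, hs, hxs⟩ := hT.exists_mem (heP (openSimplex_subset_hull _ hx))
          refine ⟨s, Finset.mem_filter.2 ⟨hs, ?_⟩, openSimplex_subset_hull _ hxs⟩
          have h3 := (hT.1 s hs).1.card_le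
          have h0 := (hT.1 s hs).1.1.card_pos
          have h1 : s.card ≠ 1 := by
            intro h1
            obtain ⟨p, rfl⟩ := Finset.card_eq_one.1 h1
            rw [openSimplex_singleton, mem_singleton_iff] at hxs
            exact hem.2.notMem_openSimplex hem.1.ge (hl _ hs p (by simp)) (hxs ▸ hx)
          have h2 : s.card ≠ 3 := by
            intro h2
            have hsf : s ∈ facets T := mem_facets.2 ⟨hs, h2⟩
            have hxf := hfr (openSimplex_subset_hull _ hx)
            rcases hD.eq_or_disjoint hsf ht with rfl | hd
            · exact hxf.2 (openSimplex_subset_interior h2 (hT.1 s hs).1 hxs)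
            · exact notMem_hull_of_disjoint h2 (hT.1 s hs).1 hd hxs
                ((isClosed_hull t).frontier_subset hxf)
          omega
        obtain ⟨s, hs, hpar, x, hx, hxs⟩ := exists_par_of_cover hem.1
          (T.filter fun s => s.card = 2).finite_toSet (fun s hs => (Finset.mem_filter.1 hs).2) key
        refine ⟨s, hs, (mem_minimalIn_hull hN).2 ⟨hem,
          hull_subset_of_openSimplex_subset hem.2.1.1 (isClosed_hull s) ?_⟩⟩
        exact (hem.subset_of_par (Finset.mem_filter.1 hs).2 (hl s (Finset.mem_filter.1 hs).1) hx hxs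
          hpar).trans (openSimplex_subset_hull s)
      · right
        exact ⟨t, ht, Finset.mem_filter.2 ⟨het, hfr⟩⟩
    · rintro (⟨s, hs, he⟩ | ⟨t, ht, he⟩)
      · obtain ⟨hem, hes⟩ := hseg s hs e he
        obtain ⟨hsT, hc⟩ := Finset.mem_filter.1 hs
        refine h.mem_edges_of_disjoint hem (hes.trans (hT.openSimplex_subset hsT)) fun u hu => ?_
        obtain ⟨t, ht, hut⟩ := Finset.mem_biUnion.1 hu
        have hmu := (hτ t ht).2 u hut
        have hut' : openSimplex u ⊆ openSimplex t := by
          rw [← interior_hull (hD.1 t ht).1 (hD.1 t ht).2]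
          exact (openSimplex_subset_interior hmu.1 hmu.2.1).trans
            (interior_mono ((hτ t ht).hull_subset hut))
        have hne : s ≠ t := by
          rintro rfl
          rw [(hD.1 s ht).1] at hc
          omega
        exact (hT.2.1 hsT (mem_facets.1 ht).1 hne).mono hes hut'
      · obtain ⟨u, hu, heu, hc⟩ := mem_edges.1 (hinner t ht e he).1
        exact mem_edges.2 ⟨u, Finset.mem_biUnion.2 ⟨t, ht, hu⟩, heu, hc⟩
  have hd : Disjoint ((T.filter (fun s => s.card = 2)).biUnion fun s => minimalIn N (hull s))
      ((facets T).biUnion fun t => innerEdges (hull t) (τ t)) := by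
    rw [Finset.disjoint_left]
    intro e he he'
    obtain ⟨s, hs, hes⟩ := Finset.mem_biUnion.1 he
    obtain ⟨t, ht, het⟩ := Finset.mem_biUnion.1 he'
    obtain ⟨-, x, hx, hxt⟩ := hinner t ht e het
    have h1 := hT.eq_of_mem (Finset.mem_filter.1 hs).1 (mem_facets.1 ht).1
      ((hseg s hs e hes).2 hx) hxt
    have h2 := (Finset.mem_filter.1 hs).2
    rw [h1, (mem_facets.1 ht).2] at h2
    omega
  rw [hun, Finset.sum_union hd, Finset.sum_biUnion, Finset.sum_biUnion]
  · intro t ht t' ht' hne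
    refine Finset.disjoint_left.2 fun e he he' => hne ?_
    obtain ⟨h1, x, hx, hxt⟩ := hinner t ht e he
    obtain ⟨h2, -⟩ := hinner t' ht' e he'
    obtain ⟨u, hu, heu, -⟩ := mem_edges.1 h2
    by_contra hne'
    exact notMem_hull_of_disjoint (hD.1 t ht).1 (hD.1 t ht).2 (hD.2.1 ht ht' hne') hxt
      ((hτ t' ht').hull_subset hu (hull_mono heu (openSimplex_subset_hull _ hx)))
  · intro s hs s' hs' hne
    refine Finset.disjoint_left.2 fun e he he' => hne ?_
    obtain ⟨x, hx⟩ := openSimplex_nonempty (hseg s hs e he).1.2.1.1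
    exact hT.eq_of_mem (Finset.mem_filter.1 hs).1 (Finset.mem_filter.1 hs').1
      ((hseg s hs e he).2 hx) ((hseg s' hs' e he').2 hx)

/-- The boundary edges of a polygon, expressed through an arbitrary triangulation. -/
theorem IsTriangulation.classes_boundary {P : Set Plane} (hP : IsPolygon P)
    {T : Finset (Finset Plane)} (hT : IsTriangulation P T) {N : ℕ} (hN : 0 < N)
    (hl : ∀ s ∈ T, ∀ p ∈ s, p ∈ lattice N) :
    classes (minimalIn N (frontier P)) +
        ∑ t ∈ facets T, classes (minimalIn N (frontier (hull t))) =
      2 • ∑ s ∈ T.filter (fun s => s.card = 2), classes (minimalIn N (hull s)) := by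
  classical
  have hD := hT.isDissection hP
  have : ∀ t ∈ facets T, ∃ S, IsTiling N (hull t) S := fun t ht =>
    exists_tiling_triangle hN (hD.1 t ht).1 (hD.1 t ht).2 (hl t (mem_facets.1 ht).1)
  choose! τ hτ using this
  have hcut : Cut (facets T).val ((facets T).val.bind fun t => (τ t).val) := Cut.of_fun fun t ht =>
    ⟨τ t, rfl, (hτ t ht).1, fun x hx => ((hτ t ht).2 x hx).isRatTriangle⟩
  obtain ⟨S, hS, hSD⟩ := hD.glue hcut
  have hSe : S = (facets T).biUnion τ := by
    ext t
    rw [← Finset.mem_val, hS, Multiset.mem_bind, Finset.mem_biUnion]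
    rfl
  have hSm : ∀ t ∈ S, IsMinimalTriangle N t := by
    intro u hu
    rw [hSe, Finset.mem_biUnion] at hu
    obtain ⟨t, ht, hut⟩ := hu
    exact (hτ t ht).2 u hut
  have hST : IsTiling N P ((facets T).biUnion τ) := hSe ▸ ⟨hSD, hSm⟩
  set φ : Finset Plane → Multiset (Set (Finset Plane)) := fun e => {gClass e} with hφ
  -- The double count is made once for the refined tiling of `P` and once within each triangle of
  -- `T`. The edges inner to these triangles occur on both sides and cancel, leaving data of `T`
  -- alone.
  have h1 := hST.two_nsmul_sum_edges φ
  rw [hST.filter_edges_eq_minimalIn hN hP.isCompact_frontier.isBounded,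
    hT.edges_eq hP hN hl hτ hST] at h1
  have h2 : ∑ t ∈ (facets T).biUnion τ, ∑ e ∈ t.powersetCard 2, φ e =
      ∑ t ∈ facets T, ∑ u ∈ τ t, ∑ e ∈ u.powersetCard 2, φ e := by
    rw [← hSe, Finset.sum, hS, Multiset.map_bind, Multiset.sum_bind]
    rfl
  have h3 : ∑ t ∈ facets T, ∑ u ∈ τ t, ∑ e ∈ u.powersetCard 2, φ e =
      2 • ∑ t ∈ facets T, ∑ e ∈ innerEdges (hull t) (τ t), φ e +
        ∑ t ∈ facets T, ∑ e ∈ minimalIn N (frontier (hull t)), φ e := by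
    rw [Finset.smul_sum, ← Finset.sum_add_distrib]
    exact Finset.sum_congr rfl fun t ht => ((hτ t ht).two_nsmul_sum_innerEdges hN
      ((isCompact_hull t).isBounded.subset (isClosed_hull t).frontier_subset) φ).symm
  rw [h2, h3, smul_add] at h1
  simp only [classes_eq_sum]
  refine add_right_cancel
    (b := 2 • ∑ t ∈ facets T, ∑ e ∈ innerEdges (hull t) (τ t), φ e) ?_
  rw [h1]
  abel

theorem GMap.image_frontier (g : GMap) (R : Set Plane) :
    frontier (g.act '' R) = g.act '' frontier R := by
  obtain ⟨k, hk, hk'⟩ := g.exists_inv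
  let e : Plane ≃ₜ Plane :=
    { toFun := g.act, invFun := k.act, left_inv := hk, right_inv := hk'
      continuous_toFun := g.continuous, continuous_invFun := k.continuous }
  exact (e.image_frontier R).symm

theorem classes_minimalIn_frontier_image {N : ℕ} (hN : 0 < N) (g : GMap) (t : Finset Plane) :
    classes (minimalIn N (frontier (hull (t.image g.act)))) =
      classes (minimalIn N (frontier (hull t))) := by
  have hb : ∀ t : Finset Plane, Bornology.IsBounded (frontier (hull t)) := fun t =>
    (isCompact_hull t).isBounded.subset (isClosed_hull t).frontier_subset
  rw [minimalIn_image_of_bounded hN g (hb t) (hb _) (by rw [g.hull_image, g.image_frontier]),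
    classes_eq_sum, classes_eq_sum, Finset.sum_image g.image_injective.injOn]
  exact Finset.sum_congr rfl fun f _ => by rw [gClass_image]

theorem classes_minimalIn_image {N : ℕ} (hN : 0 < N) (g : GMap) (t : Finset Plane) :
    classes (minimalIn N (hull (t.image g.act))) = classes (minimalIn N (hull t)) := by
  rw [minimalIn_image hN, classes_eq_sum, classes_eq_sum,
    Finset.sum_image g.image_injective.injOn]
  exact Finset.sum_congr rfl fun f _ => by rw [gClass_image]

theorem sum_filter_card_eq {M : Type*} [AddCommMonoid M] {A B : Finset (Finset Plane)}
    (h : classes A = classes B) (n : ℕ) {φ : Finset Plane → M}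
    (hφ : ∀ (g : GMap) a, φ (a.image g.act) = φ a) :
    ∑ a ∈ A.filter (fun s => s.card = n), φ a = ∑ b ∈ B.filter (fun s => s.card = n), φ b := by
  rw [Finset.sum_filter, Finset.sum_filter]
  refine sum_eq_of_classes_eq h ?_
  rintro a - _ - ⟨g, rfl⟩
  rw [g.card_image, hφ]

theorem invariants_of_equidecompRel {P Q : Set Plane} {d : ℕ} (hP : IsPolygon P)
    (hQ : IsPolygon Q) (hd : 0 < d) (hlP : ∀ v, IsVertex P v → v ∈ lattice d)
    (hlQ : ∀ v, IsVertex Q v → v ∈ lattice d) {T S : Finset (Finset Plane)} {F : Plane → Plane}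
    (h : IsEquidecompRel P T Q S F) : ehr P = ehr Q ∧ polygonWeight d P = polygonWeight d Q ∧
      ∃ d' : ℕ, 0 < d' ∧ d ∣ d' ∧ dynSystem d' P = dynSystem d' Q := by
  refine ⟨h.ehr_eq hP hQ, ?_⟩
  have hc := h.classes_eq
  obtain ⟨hT, hS, -, -⟩ := h
  obtain ⟨m, hm, hlT⟩ := exists_common_level T (fun t N => ∀ p ∈ t, p ∈ lattice N)
    fun t ht => exists_level_of_isRational (hT.1 t ht).2
  obtain ⟨n, hn, hlS⟩ := exists_common_level S (fun t N => ∀ p ∈ t, p ∈ lattice N)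
    fun t ht => exists_level_of_isRational (hS.1 t ht).2
  -- The factors `m` and `n` make all vertices of both triangulations lattice points; `2 * d` is
  -- needed to descend from level `N` to level `d`.
  have hN : 0 < 2 * d * (m * n) := by positivity
  set N := 2 * d * (m * n) with hNdef
  have hdN : 2 * d ∣ N := Dvd.intro _ rfl
  have hdN' : d ∣ N := (Dvd.intro_left 2 rfl).trans hdN
  have hlT' := hlT N hN ((Dvd.intro n rfl).trans (Dvd.intro_left _ rfl))
  have hlS' := hlS N hN ((Dvd.intro_left m rfl).trans (Dvd.intro_left _ rfl))
  have hb : classes (minimalIn N (frontier P)) = classes (minimalIn N (frontier Q)) := by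
    have h1 := hT.classes_boundary hP hN hlT'
    have h2 := hS.classes_boundary hQ hN hlS'
    rw [sum_filter_card_eq hc 2 fun g a => classes_minimalIn_image hN g a, ← h2, facets,
      sum_filter_card_eq hc 3 fun g a => classes_minimalIn_frontier_image hN g a] at h1
    exact add_right_cancel h1
  refine ⟨(polygonWeight_eq_iff hP hQ hd).2
    (hP.classes_eq_of_mul_dvd hQ hN hd hdN hlP hlQ hb), N, hN, hdN', ?_⟩
  have hf : classes (facets T) = classes (facets S) := by
    rw [classes_eq_sum, classes_eq_sum]
    exact sum_filter_card_eq hc 3 fun g a => by rw [gClass_image]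
  -- Corresponding triangles are cut in corresponding ways. The resulting tilings have the same
  -- weights, so both dynamical systems are orbits of the same multiset.
  obtain ⟨T', S', hT', hS', hTS⟩ := exists_gEq_tilings (hT.isDissection hP) (hS.isDissection hQ)
    (fun t ht => ⟨(mem_facets.1 ht).2, hS.1 t (mem_facets.1 ht).1⟩) (gEq_of_classes_eq hf) hN
    (fun t ht => hlS' t (mem_facets.1 ht).1)
  have hw : T'.val.map (triangleWeight N) = S'.val.map (triangleWeight N) := by
    refine (gEq_of_classes_eq hTS).map_eq ?_
    rintro t ht _ - ⟨g, rfl⟩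
    exact (triangleWeight_image g hN (hT'.2 t ht)).symm
  ext τ
  rw [mem_dynSystem hN hP hT', mem_dynSystem hN hQ hS', hw]

end

end DiscreteEquidecomp

open DiscreteEquidecomp
theorem theorem3 (P Q : Set Plane) (d : ℕ)
    (hP : IsPolygon P) (hQ : IsPolygon Q)
    (hPd : HasDenominator P d) (hQd : HasDenominator Q d) :
    (∃ (T₁ T₂ : Finset (Finset Plane)) (F : Plane → Plane), IsEquidecompRel P T₁ Q T₂ F) ↔
      ehr P = ehr Q ∧
      polygonWeight d P = polygonWeight d Q ∧
      ∃ d' : ℕ, 0 < d' ∧ d ∣ d' ∧ dynSystem d' P = dynSystem d' Q := by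
  obtain ⟨hd, hlP⟩ := hPd.1
  obtain ⟨-, hlQ⟩ := hQd.1
  constructor
  · rintro ⟨T₁, T₂, F, h⟩
    exact invariants_of_equidecompRel hP hQ hd hlP hlQ h
  · rintro ⟨he, hw, d', hd', hdd, hD⟩
    exact exists_equidecompRel_of_invariants hP hQ hd hlP hlQ he hw hd' hdd hD
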